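/- Let $k,m\ge 2$ and $n=km$, let $\Omega_n=\{1,\dots,n\}$, and let $I_i=\{(i-1)m+1,\dots,im\}$ for $1\le i\le k$; for $x\in\Omega_n$ let $i_x$ be the index with $x\in I_{i_x}$. Let $\mathcal{POI}_{k\times m}$ be the monoid (maps being composed from left to right) of all partial permutations $\alpha$ of $\Omega_n$ such that $I_{i_x}\subseteq\mathrm{Dom}(\alpha)$ and $I_{i_x}\alpha=I_{i_{x\alpha}}$ for all $x\in\mathrm{Dom}(\alpha)$, and $i_x\le i_y$ implies $i_{x\alpha}\le i_{y\alpha}$ for all $x,y\in\mathrm{Dom}(\alpha)$. Consider the alphabets $A=\{a_1,\dots,a_k\}$, $B=\{b_1,\dots,b_k\}$, $X=\{x_0,\dots,x_{k-1}\}$ ($3k$ distinct letters), and the following sets of monoid relations. $R$ consists of - $(R_1)$ $a_i^2=1$; $(R_2)$ $b_i^m=1$; $(R_3)$ $(b_ia_i)^{m-1}=1$; $(R_4)$ $(a_ib_i^{m-1}a_ib_i)^3=1$, for $1\le i\le k$; - $(R_5)$ $(a_ib_i^{m-j}a_ib_i^j)^2=1$, for $2\le j\le m-2$, $1\le i\le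 k$; - $(R_6)$ $a_ia_j=a_ja_i$ and $b_ib_j=b_jb_i$, for $1\le i<j\le k$; $a_ib_j=b_ja_i$, for $1\le i,j\le k$, $i\ne j$. $W$ consists of - $(W_1)$ $x_ix_0=x_0x_{i+1}$, for $1\le i\le k-2$; - $(W_2)$ $x_jx_i=x_ix_j$, for $2\le i+1<j\le k-1$; - $(W_3)$ $x_0^2x_1=x_0^2=x_{k-1}x_0^2$; - $(W_4)$ $x_{i+1}x_ix_{i+1}=x_{i+1}x_i=x_ix_{i+1}x_i$, for $1\le i\le k-2$; - $(W_5)$ $x_ix_{i+1}\cdots x_{k-1}x_0x_1\cdots x_{i-1}x_i=x_i$, for $0\le i\le k-1$; - $(W_6)$ $x_{i+1}\cdots x_{k-1}x_0x_1\cdots x_{i-1}x_i^2=x_i^2$, for $1\le i\le k-1$. $R'$ consists of - $(R'_1)$ $a_1x_0=x_0$, $b_1x_0=x_0$; - $(R'_2)$ $x_0a_i=a_{i+1}x_0$, $x_0b_i=b_{i+1}x_0$, for $1\le i\le k-1$; - $(R'_3)$ $x_ia_{k-i}=x_i$, $x_ib_{k-i}=x_i$, for $0\le i\le k-1$; - $(R'_4)$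 $a_ix_{k-i+1}=x_{k-i+1}$, $b_ix_{k-i+1}=x_{k-i+1}$, for $2\le i\le k$; - $(R'_5)$ $x_ia_{k-i+1}=a_{k-i}x_i$, $x_ib_{k-i+1}=b_{k-i}x_i$, for $1\le i\le k-1$; - $(R'_6)$ $x_ia_j=a_jx_i$, $x_ib_j=b_jx_i$, for $1\le i\le k-1$, $1\le j\le k$, $j\notin\{k-i,k-i+1\}$. (In $W_3$ and $W_4$ a chain of two equalities is two relations.) Then the monoid $\mathcal{POI}_{k\times m}$ is defined by the presentation $\langle A\cup B\cup X\mid R\cup W\cup R'\rangle$ on $3k$ generators: the quotient of the free monoid $(A\cup B\cup X)^*$ by the least congruence containing $R\cup W\cup R'$ is isomorphic to $\mathcal{POI}_{k\times m}$, by an isomorphism such that - $a_r$ and $b_r$ are sent to the permutations of $\Omega_n$ that act on $I_r$ (identified with $\{1,\dots,m\}$ by an order preserving translation) as $(1\,2)$ and $(1\,2\cdots m)$, respectively, and fix all points outside $I_r$; - $x_0$ is sent to the partial permutation with domain $I_2\cup\dots\cup I_k$ that translates $I_r$ onto $I_{r-1}$ for $2\le r\le k$; - $x_i$, for $1\le i\le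 k-1$, is sent to the partial permutation with domain $\Omega_n\setminus I_{k-i+1}$ that translates $I_{k-i}$ onto $I_{k-i+1}$ and fixes all other points of its domain. If $m\ge3$, the number of relations in $R\cup W\cup R'$ is $\frac12\left(9k^2+(2m+7)k-4\right)$. If $m=2$, their number is $\frac12\left(9k^2+(2m+7)k-4\right)+k$; in this case the $k$ relations $(R_4)$ may be deleted, and the remaining $\frac12\left(9k^2+(2m+7)k-4\right)$ relations still define $\mathcal{POI}_{k\times m}$ on the same generators. -/

import Mathlib

namespace POIPresentation

/-! ### Partial permutations preserving an ordered partition -/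

/-- The symmetric inverse monoid on `Ω`: partial permutations of `Ω`, multiplied from left to
right (`α * β` means: first `α`, then `β`). -/
instance partialPermMonoid (Ω : Type*) : Monoid (Ω ≃. Ω) where
  mul α β := α.trans β
  one := PEquiv.refl Ω
  mul_assoc := PEquiv.trans_assoc
  one_mul := PEquiv.refl_trans
  mul_one := PEquiv.trans_refl

/-- An ordered partition of `Ω` is given by the map `idx` sending a point to the index of its
block. The partial permutation `α` is stable if for each `x` in its domain, with image `y`, the
whole block of `x` lies in the domain and the image of this block is the block of `y`. -/
def Stable {Ω ι : Type*} (idx : Ω → ι) (α : Ω ≃. Ω) : Prop :=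
  ∀ x y, α x = some y →
    (∀ x', idx x' = idx x → ∃ y', α x' = some y') ∧
      {y' | ∃ x', idx x' = idx x ∧ α x' = some y'} = {y' | idx y' = idx y}

/-- `α` preserves the order of the blocks. -/
def OrderPreserving {Ω ι : Type*} [LinearOrder ι] (idx : Ω → ι) (α : Ω ≃. Ω) : Prop :=
  ∀ x y x' y', α x = some x' → α y = some y' → idx x ≤ idx y → idx x' ≤ idx y'

/-- The monoid of all stable and order preserving partial permutations, for the ordered partition
of `Ω` with block map `idx`. -/
def POIPart {Ω ι : Type*} [LinearOrder ι] (idx : Ω → ι) : Submonoid (Ω ≃. Ω) where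
  carrier := {α | Stable idx α ∧ OrderPreserving idx α}
  one_mem' := by
    have h1 : ∀ x : Ω, (1 : Ω ≃. Ω) x = some x := fun x => rfl
    refine ⟨?_, ?_⟩
    · intro x y h
      rw [h1] at h
      obtain rfl := Option.some.inj h
      refine ⟨fun x' _ => ⟨x', h1 x'⟩, ?_⟩
      ext y'
      simp [h1]
    · intro x y x' y' hx hy h
      rw [h1] at hx hy
      obtain rfl := Option.some.inj hx
      obtain rfl := Option.some.inj hy
      exact h
  mul_mem' := by
    rintro α β ⟨hα, hα'⟩ ⟨hβ, hβ'⟩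
    have hm : ∀ x z, (α * β) x = some z ↔ ∃ y, α x = some y ∧ β y = some z :=
      fun x z => PEquiv.trans_eq_some α β x z
    refine ⟨?_, ?_⟩
    · intro x z h
      obtain ⟨y, hxy, hyz⟩ := (hm x z).1 h
      obtain ⟨ha1, ha2⟩ := hα x y hxy
      obtain ⟨hb1, hb2⟩ := hβ y z hyz
      refine ⟨fun x' hx' => ?_, ?_⟩
      · obtain ⟨y', hy'⟩ := ha1 x' hx'
        have hy2 : idx y' = idx y := by
          have : y' ∈ {y' | idx y' = idx y} := ha2 ▸ ⟨x', hx', hy'⟩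
          exact this
        obtain ⟨z', hz'⟩ := hb1 y' hy2
        exact ⟨z', (hm x' z').2 ⟨y', hy', hz'⟩⟩
      · rw [← hb2]
        ext z'
        constructor
        · rintro ⟨x', hx', hz'⟩
          obtain ⟨y', hy', hyz'⟩ := (hm x' z').1 hz'
          have hy2 : y' ∈ {y' | idx y' = idx y} := ha2 ▸ ⟨x', hx', hy'⟩
          exact ⟨y', hy2, hyz'⟩
        · rintro ⟨y', hy', hyz'⟩
          have hy2 : y' ∈ {y' | ∃ x', idx x' = idx x ∧ α x' = some y'} := by
            rw [ha2]
            exact hy'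
          obtain ⟨x', hx', hxy'⟩ := hy2
          exact ⟨x', hx', (hm x' z').2 ⟨y', hxy', hyz'⟩⟩
    · intro x y x' y' hx hy h
      obtain ⟨u, hu, hu'⟩ := (hm x x').1 hx
      obtain ⟨v, hv, hv'⟩ := (hm y y').1 hy
      exact hβ' u v x' y' hu' hv' (hα' x y u v hu hv h)

/-- `POI_{k×m}`: here `Ω = Fin (k * m)` (the set `{1, …, km}`, numbered from zero), partitioned
into the `k` consecutive intervals of length `m`, in their natural order. -/
abbrev POI (k m : ℕ) : Submonoid (Fin (k * m) ≃. Fin (k * m)) :=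
  POIPart (Fin.divNat : Fin (k * m) → Fin k)

/-! ### The generators -/

/-- The order preserving partial permutation `x_i` of `{1, …, k}`, for `0 ≤ i ≤ k - 1`
(the point `r` of `{1, …, k}` being the element `r - 1` of `Fin k`): `x_0` maps `r` to `r - 1` for
`2 ≤ r ≤ k`, and, for `i ≥ 1`, `x_i` maps `k - i` to `k - i + 1`, is undefined at `k - i + 1`,
and fixes all the other points. -/
def xPoint (k : ℕ) (i : Fin k) : Fin k ≃. Fin k where
  toFun p :=
    if hi : i.val = 0 then
      if p.val = 0 then none else some ⟨p.val - 1, by omega⟩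
    else if p.val + i.val = k then none
    else if hp : p.val + 1 + i.val = k then some ⟨p.val + 1, by omega⟩
    else some p
  invFun q :=
    if i.val = 0 then
      if hq : q.val + 1 < k then some ⟨q.val + 1, hq⟩ else none
    else if q.val + 1 + i.val = k then none
    else if q.val + i.val = k then some ⟨q.val - 1, by omega⟩
    else some q
  inv p q := by
    have hp := p.isLt
    have hq := q.isLt
    have hi := i.isLt
    split_ifs <;> simp [Fin.ext_iff] <;> omega

/-- The copy on `{1, …, km}` of a partial permutation `θ` of `{1, …, k}`: the block of index `r`
is translated onto the block of index `θ r`. -/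
def inflate (k m : ℕ) (θ : Fin k ≃. Fin k) : Fin (k * m) ≃. Fin (k * m) where
  toFun p := (θ p.divNat).map fun r => finProdFinEquiv (r, p.modNat)
  invFun q := (θ.symm q.divNat).map fun r => finProdFinEquiv (r, q.modNat)
  inv p q := by
    have key : ∀ (x y : Fin (k * m)) (r : Fin k),
        finProdFinEquiv (r, x.modNat) = y ↔ r = y.divNat ∧ x.modNat = y.modNat := by
      intro x y r
      rw [← Equiv.eq_symm_apply, finProdFinEquiv_symm_apply, Prod.mk.injEq]
    simp only [Option.map_eq_some_iff, key]
    constructor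
    · rintro ⟨r, hr, rfl, h⟩
      exact ⟨q.divNat, (PEquiv.eq_some_iff θ).1 hr, rfl, h.symm⟩
    · rintro ⟨r, hr, rfl, h⟩
      exact ⟨p.divNat, (PEquiv.eq_some_iff θ).2 hr, rfl, h.symm⟩

/-- The unit of `POI_{k×m}` given by `(z_1, …, z_k)` in the `k`-th power of the symmetric group:
`z_r` acts on the block of index `r`. -/
def blockPerm (k m : ℕ) (z : Fin k → Equiv.Perm (Fin m)) : Fin (k * m) ≃. Fin (k * m) :=
  ((finProdFinEquiv.symm.trans (Equiv.prodCongrRight z)).trans finProdFinEquiv).toPEquiv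

/-- The alphabet: `3k` pairwise distinct letters. The letters `a_1, …, a_k` and `b_1, …, b_k` are
`a r` and `b r`, for `r : Fin k`, with indices shifted by one, and `x_0, …, x_{k-1}`
are `x i`, for `i : Fin k`. -/
inductive Letter (k : ℕ) : Type
  | a (r : Fin k) : Letter k
  | b (r : Fin k) : Letter k
  | x (i : Fin k) : Letter k

/-- The partial permutation represented by a letter: `a_r` and `b_r` stand for the transposition
`(1 2)` and the cycle `(1 2 … m)` acting on the `r`-th block. -/
def genVal {k m : ℕ} (hm : 2 ≤ m) : Letter k → (Fin (k * m) ≃. Fin (k * m))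
  | .a r => blockPerm k m (Pi.mulSingle r (Equiv.swap ⟨0, by omega⟩ ⟨1, by omega⟩))
  | .b r => blockPerm k m (Pi.mulSingle r (finRotate m))
  | .x i => inflate k m (xPoint k i)

/-! ### The relations -/

/-- The letter `a_i`, `1 ≤ i ≤ k`, as a word (the empty word if `i` is out of range). -/
def wa {k : ℕ} (i : ℕ) : FreeMonoid (Letter k) :=
  if h : 1 ≤ i ∧ i ≤ k then FreeMonoid.of (Letter.a ⟨i - 1, by omega⟩) else 1

/-- The letter `b_i`, `1 ≤ i ≤ k`, as a word (the empty word if `i` is out of range). -/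
def wb {k : ℕ} (i : ℕ) : FreeMonoid (Letter k) :=
  if h : 1 ≤ i ∧ i ≤ k then FreeMonoid.of (Letter.b ⟨i - 1, by omega⟩) else 1

/-- The letter `x_i`, `0 ≤ i ≤ k - 1`, as a word (the empty word if `i` is out of range). -/
def wx {k : ℕ} (i : ℕ) : FreeMonoid (Letter k) :=
  if h : i < k then FreeMonoid.of (Letter.x ⟨i, h⟩) else 1

/-- The word `x_i x_{i+1} ⋯ x_{j-1}` (empty if `j ≤ i`). -/
def wxProd {k : ℕ} (i j : ℕ) : FreeMonoid (Letter k) :=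
  ((List.Ico i j).map wx).prod

/-- A set of monoid relations `u = v`, as pairs `(u, v)` of words. -/
abbrev Relations (k : ℕ) : Type := Set (FreeMonoid (Letter k) × FreeMonoid (Letter k))

def R1 (k : ℕ) : Relations k := {p | ∃ i, 1 ≤ i ∧ i ≤ k ∧ p = (wa i ^ 2, 1)}

def R2 (k m : ℕ) : Relations k := {p | ∃ i, 1 ≤ i ∧ i ≤ k ∧ p = (wb i ^ m, 1)}

def R3 (k m : ℕ) : Relations k := {p | ∃ i, 1 ≤ i ∧ i ≤ k ∧ p = ((wb i * wa i) ^ (m - 1), 1)}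

def R4 (k m : ℕ) : Relations k :=
  {p | ∃ i, 1 ≤ i ∧ i ≤ k ∧ p = ((wa i * wb i ^ (m - 1) * wa i * wb i) ^ 3, 1)}

def R5 (k m : ℕ) : Relations k :=
  {p | ∃ i j, 1 ≤ i ∧ i ≤ k ∧ 2 ≤ j ∧ j ≤ m - 2 ∧
    p = ((wa i * wb i ^ (m - j) * wa i * wb i ^ j) ^ 2, 1)}

def R6 (k : ℕ) : Relations k :=
  {p | ∃ i j, 1 ≤ i ∧ i < j ∧ j ≤ k ∧ p = (wa i * wa j, wa j * wa i)} ∪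
  {p | ∃ i j, 1 ≤ i ∧ i < j ∧ j ≤ k ∧ p = (wb i * wb j, wb j * wb i)} ∪
  {p | ∃ i j, 1 ≤ i ∧ i ≤ k ∧ 1 ≤ j ∧ j ≤ k ∧ i ≠ j ∧ p = (wa i * wb j, wb j * wa i)}

/-- The relations of the `k`-th power of the symmetric group of degree `m`. -/
def R (k m : ℕ) : Relations k := R1 k ∪ R2 k m ∪ R3 k m ∪ R4 k m ∪ R5 k m ∪ R6 k

def W1 (k : ℕ) : Relations k :=
  {p | ∃ i, 1 ≤ i ∧ i ≤ k - 2 ∧ p = (wx i * wx 0, wx 0 * wx (i + 1))}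

def W2 (k : ℕ) : Relations k :=
  {p | ∃ i j, 2 ≤ i + 1 ∧ i + 1 < j ∧ j ≤ k - 1 ∧ p = (wx j * wx i, wx i * wx j)}

def W3 (k : ℕ) : Relations k :=
  {(wx 0 ^ 2 * wx 1, wx 0 ^ 2), (wx 0 ^ 2, wx (k - 1) * wx 0 ^ 2)}

def W4 (k : ℕ) : Relations k :=
  {p | ∃ i, 1 ≤ i ∧ i ≤ k - 2 ∧ p = (wx (i + 1) * wx i * wx (i + 1), wx (i + 1) * wx i)} ∪
  {p | ∃ i, 1 ≤ i ∧ i ≤ k - 2 ∧ p = (wx (i + 1) * wx i, wx i * wx (i + 1) * wx i)}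

/-- `x_i x_{i+1} ⋯ x_{k-1} x_0 x_1 ⋯ x_{i-1} x_i = x_i`. -/
def W5 (k : ℕ) : Relations k :=
  {p | ∃ i, 0 ≤ i ∧ i ≤ k - 1 ∧ p = (wxProd i k * wxProd 0 i * wx i, wx i)}

/-- `x_{i+1} ⋯ x_{k-1} x_0 x_1 ⋯ x_{i-1} x_i ^ 2 = x_i ^ 2`. -/
def W6 (k : ℕ) : Relations k :=
  {p | ∃ i, 1 ≤ i ∧ i ≤ k - 1 ∧ p = (wxProd (i + 1) k * wxProd 0 i * wx i ^ 2, wx i ^ 2)}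

/-- The relations of the monoid of order preserving partial permutations of `{1, …, k}`. -/
def W (k : ℕ) : Relations k := W1 k ∪ W2 k ∪ W3 k ∪ W4 k ∪ W5 k ∪ W6 k

def R'1 (k : ℕ) : Relations k := {(wa 1 * wx 0, wx 0), (wb 1 * wx 0, wx 0)}

def R'2 (k : ℕ) : Relations k :=
  {p | ∃ i, 1 ≤ i ∧ i ≤ k - 1 ∧ p = (wx 0 * wa i, wa (i + 1) * wx 0)} ∪
  {p | ∃ i, 1 ≤ i ∧ i ≤ k - 1 ∧ p = (wx 0 * wb i, wb (i + 1) * wx 0)}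

def R'3 (k : ℕ) : Relations k :=
  {p | ∃ i, 0 ≤ i ∧ i ≤ k - 1 ∧ p = (wx i * wa (k - i), wx i)} ∪
  {p | ∃ i, 0 ≤ i ∧ i ≤ k - 1 ∧ p = (wx i * wb (k - i), wx i)}

def R'4 (k : ℕ) : Relations k :=
  {p | ∃ i, 2 ≤ i ∧ i ≤ k ∧ p = (wa i * wx (k - i + 1), wx (k - i + 1))} ∪
  {p | ∃ i, 2 ≤ i ∧ i ≤ k ∧ p = (wb i * wx (k - i + 1), wx (k - i + 1))}

def R'5 (k : ℕ) : Relations k :=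
  {p | ∃ i, 1 ≤ i ∧ i ≤ k - 1 ∧ p = (wx i * wa (k - i + 1), wa (k - i) * wx i)} ∪
  {p | ∃ i, 1 ≤ i ∧ i ≤ k - 1 ∧ p = (wx i * wb (k - i + 1), wb (k - i) * wx i)}

def R'6 (k : ℕ) : Relations k :=
  {p | ∃ i j, 1 ≤ i ∧ i ≤ k - 1 ∧ 1 ≤ j ∧ j ≤ k ∧ j ≠ k - i ∧ j ≠ k - i + 1 ∧
    p = (wx i * wa j, wa j * wx i)} ∪
  {p | ∃ i j, 1 ≤ i ∧ i ≤ k - 1 ∧ 1 ≤ j ∧ j ≤ k ∧ j ≠ k - i ∧ j ≠ k - i + 1 ∧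
    p = (wx i * wb j, wb j * wx i)}

/-- The mixed relations. -/
def R' (k : ℕ) : Relations k := R'1 k ∪ R'2 k ∪ R'3 k ∪ R'4 k ∪ R'5 k ∪ R'6 k

/-- The set of relations `S` defines the monoid `POI_{k×m}`, each letter representing the
generator `genVal`: the quotient of the free monoid by the least congruence containing `S` is
isomorphic to `POI_{k×m}`, by an isomorphism that sends the class of each letter to that
generator. -/
def Defines {k m : ℕ} (hm : 2 ≤ m) (S : Relations k) : Prop :=
  ∃ e : PresentedMonoid (fun u v => (u, v) ∈ S) ≃* POI k m,
    ∀ l : Letter k, (e (PresentedMonoid.of _ l) : Fin (k * m) ≃. Fin (k * m)) = genVal hm l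

end POIPresentation

namespace POIPresentation

open Equiv

/-! ### The symmetric group: Coxeter and Moore relations -/

/-! Let `N` be the monoid given by the presentation. The standard generators satisfy all relations,
which gives a homomorphism `π` from `N` to `POI_{k×m}`; it must be shown to be bijective.

Every element of `POI_{k×m}` is a unit (a permutation inside each block) followed by the inflation
of an order preserving partial permutation `θ` of the `k` blocks. On the side of `N`, the relations
`R'` say that `x_i` carries `a_r`, `b_r` to `a_s`, `b_s` when it moves block `r` to block `s`, and
absorbs them when the block lies outside its domain (from the left) or its image (from the right);
this is `EdgeRel.Follows`. Hence every element of `N` has the form `Φ z * X w`, with `z` in the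
`k`-th power of the symmetric group and `w` a word in the `x_i`. If two such elements have the same
image under `π`, their partial permutations `θ` agree and their units agree on the blocks in the
domain of `θ`; the other coordinates are absorbed. This is `POIRel.injective_and_surjective`. What
remains is that `R` gives the map `Φ` and that `W` presents the monoid of order preserving partial
permutations of `k` points.

For `R`: in the product of the symmetric group with a group satisfying the Coxeter relations, the
pairs of corresponding generators generate the graph of a homomorphism, by a coset decomposition
(`exists_mul_descProd`). Moore's relations reduce to Coxeter's through the conjugates `b⁻ⁱ a bⁱ`.

For `W`: the words `e l` and `z i` behave as the idempotents missing one point and as the inverses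
of the `x i`, and satisfy `EdgeRel`. To a set `D` of points one attaches the product `climb D` of
steps that push `D` to the upper end; it is independent of the path, because two different available
steps commute. An element compatible with these paths (`Good`) is a path up from the domain of `θ`
followed by a path down to its image, so it is determined by `θ`. All generators are good and
goodness is multiplicative, whence `WRel.lift_eq_of_lift_eq`.

For surjectivity, moving domain and image of `θ` to the upper end turns `θ` into a partial identity,
so the `x_i` generate. For the count, additive weights of words tell the relations apart. -/

/-- The product `g n * g (n - 1) * ⋯` with `d` factors. -/
def descProd {G : Type*} [Monoid G] (g : ℕ → G) (n : ℕ) : ℕ → G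
  | 0 => 1
  | d + 1 => descProd g n d * g (n - d)

/-- For `d > 0` the factors have the indices `n - d + 1, …, n`, all at least two above `i`. -/
theorem descProd_mul_far {G : Type*} [Monoid G] (g : ℕ → G) (n : ℕ)
    (hcomm : ∀ i j, i + 1 < j → j ≤ n → g i * g j = g j * g i) (i : ℕ) :
    ∀ d, i + d < n + 1 → (0 < d → i + d < n) → descProd g n d * g i = g i * descProd g n d := by
  intro d
  induction d with
  | zero => intro _ _; simp [descProd]
  | succ d ih =>
    intro h h'
    have h'' := h' (Nat.succ_pos d)
    rw [descProd, mul_assoc, ← hcomm i (n - d) (by omega) (by omega), ← mul_assoc,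
      ih (by omega) (fun _ => by omega), mul_assoc]

/-- `g (i + 1)` moves left past the factors of index below `i`, then meets `g (i + 1) * g i`; the
braid relation brings `g i` to the front, and this commutes with the remaining factors, of index
above `i + 1`. -/
theorem descProd_mul_near {G : Type*} [Monoid G] (g : ℕ → G) (n : ℕ)
    (hbraid : ∀ i, i < n → g (i + 1) * g i * g (i + 1) = g i * g (i + 1) * g i)
    (hcomm : ∀ i j, i + 1 < j → j ≤ n → g i * g j = g j * g i) (i : ℕ) (hi : i < n) :
    ∀ d, n + 1 ≤ i + d → d ≤ n + 1 → descProd g n d * g (i + 1) = g i * descProd g n d := by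
  intro d
  induction d with
  | zero => intro h; omega
  | succ d ih =>
    intro h hd
    by_cases hid : n + 1 ≤ i + d
    · rw [descProd, mul_assoc, hcomm (n - d) (i + 1) (by omega) (by omega), ← mul_assoc,
        ih hid (by omega), mul_assoc]
    · obtain ⟨e, rfl⟩ : ∃ e, d = e + 1 := ⟨d - 1, by omega⟩
      have h1 : n - (e + 1) = i := by omega
      have h2 : n - e = i + 1 := by omega
      rw [descProd, descProd, h1, h2, mul_assoc, mul_assoc, ← mul_assoc (g (i + 1)), hbraid i hi,
        ← mul_assoc, ← mul_assoc, descProd_mul_far g n hcomm i e (by omega) (fun _ => by omega)]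
      simp only [mul_assoc]

/-- Coset decomposition for the chain of parabolic subgroups. -/
theorem exists_mul_descProd {G : Type*} [Group G] (g : ℕ → G) (n : ℕ)
    (hsq : ∀ i, i ≤ n → g i * g i = 1)
    (hbraid : ∀ i, i < n → g (i + 1) * g i * g (i + 1) = g i * g (i + 1) * g i)
    (hcomm : ∀ i j, i + 1 < j → j ≤ n → g i * g j = g j * g i) {x : G}
    (hx : x ∈ Subgroup.closure (g '' {i | i < n + 1})) :
    ∃ y ∈ Subgroup.closure (g '' {i | i < n}), ∃ d ≤ n + 1, x = y * descProd g n d := by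
  have step : ∀ x, (∃ y ∈ Subgroup.closure (g '' {i | i < n}), ∃ d ≤ n + 1,
      x = y * descProd g n d) → ∀ i, i < n + 1 →
      ∃ y ∈ Subgroup.closure (g '' {i | i < n}), ∃ d ≤ n + 1, x * g i = y * descProd g n d := by
    rintro _ ⟨y, hy, d, hd, rfl⟩ i hi
    have hmem : ∀ j, j < n → y * g j ∈ Subgroup.closure (g '' {i | i < n}) := fun j hj =>
      mul_mem hy (Subgroup.subset_closure ⟨j, hj, rfl⟩)
    -- According to `i + d` compared with `n` and `n + 1`, the factor `g i` commutes to the left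
    -- into `y`, prolongs the product, cancels its last factor, or passes to the left as `g (i -
    -- 1)`.
    rcases lt_or_ge (i + d) n with h1 | h1
    · exact ⟨y * g i, hmem i (by omega), d, hd, by
        rw [mul_assoc, descProd_mul_far g n hcomm i d (by omega) (fun _ => h1), mul_assoc]⟩
    rcases eq_or_lt_of_le h1 with h1 | h1
    · refine ⟨y, hy, d + 1, by omega, ?_⟩
      rw [descProd, mul_assoc, show n - d = i by omega]
    rcases eq_or_lt_of_le (Nat.succ_le_of_lt h1) with h2 | h2
    · obtain ⟨e, rfl⟩ : ∃ e, d = e + 1 := ⟨d - 1, by omega⟩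
      refine ⟨y, hy, e, by omega, ?_⟩
      rw [descProd, show n - e = i by omega, mul_assoc, mul_assoc, hsq i (by omega), mul_one]
    · obtain ⟨j, rfl⟩ : ∃ j, i = j + 1 := ⟨i - 1, by omega⟩
      exact ⟨y * g j, hmem j (by omega), d, hd, by
        rw [mul_assoc, descProd_mul_near g n hbraid hcomm j (by omega) d (by omega) hd, mul_assoc]⟩
  induction hx using Subgroup.closure_induction_right with
  | one => exact ⟨1, one_mem _, 0, by omega, by simp [descProd]⟩
  | mul_right x _ z hz ih =>
    obtain ⟨i, hi, rfl⟩ := hz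
    exact step x ih i hi
  | mul_inv_cancel x _ z hz ih =>
    obtain ⟨i, hi, rfl⟩ := hz
    rw [inv_eq_of_mul_eq_one_left (hsq i (Nat.lt_succ_iff.1 hi))]
    exact step x ih i hi

theorem swap_succ_braid (i : ℕ) :
    swap (i + 1) (i + 2) * swap i (i + 1) * swap (i + 1) (i + 2) =
      swap i (i + 1) * swap (i + 1) (i + 2) * swap i (i + 1) := by
  ext p
  simp only [Perm.mul_apply, swap_apply_def]
  split_ifs <;> omega

theorem swap_succ_comm (i j : ℕ) (h : i + 1 < j) :
    swap i (i + 1) * swap j (j + 1) = swap j (j + 1) * swap i (i + 1) := by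
  ext p
  simp only [Perm.mul_apply, swap_apply_def]
  split_ifs <;> omega

/-- A group element that is paired with the identity permutation, in the group generated by the
pairs (adjacent transposition, Coxeter generator), is trivial. -/
theorem eq_one_of_mem_closure_swap {H : Type*} [Group H] (t : ℕ → H) (n : ℕ)
    (hsq : ∀ i, i < n → t i * t i = 1)
    (hbraid : ∀ i, i + 1 < n → t (i + 1) * t i * t (i + 1) = t i * t (i + 1) * t i)
    (hcomm : ∀ i j, i + 1 < j → j < n → t i * t j = t j * t i) (h : H)
    (hh : ((1 : Perm ℕ), h) ∈
      Subgroup.closure ((fun i => (swap i (i + 1), t i)) '' {i | i < n})) : h = 1 := by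
  -- Permutations of `ℕ` keep the ambient group fixed during this induction.
  induction n generalizing h with
  | zero => simpa using hh
  | succ n ih =>
    set g : ℕ → Perm ℕ × H := fun i => (swap i (i + 1), t i) with hg
    obtain ⟨y, hy, d, hd, he⟩ := exists_mul_descProd g n
      (fun i hi => by simp [hg, hsq i (by omega)])
      (fun i hi => by simp [hg, hbraid i (by omega), swap_succ_braid])
      (fun i j hij hj => by simp [hg, hcomm i j hij (by omega), swap_succ_comm i j hij]) hh
    have hfix : ∀ z ∈ Subgroup.closure (g '' {i | i < n}), z.1 (n + 1) = n + 1 := by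
      intro z hz
      have : Subgroup.closure (g '' {i | i < n}) ≤
          (MulAction.stabilizer (Perm ℕ) (n + 1)).comap (MonoidHom.fst (Perm ℕ) H) := by
        rw [Subgroup.closure_le]
        rintro _ ⟨i, hi, rfl⟩
        have hi : i < n := hi
        simp only [hg, SetLike.mem_coe, Subgroup.mem_comap, MonoidHom.coe_fst,
          MulAction.mem_stabilizer_iff, Perm.smul_def]
        exact swap_apply_of_ne_of_ne (by omega) (by omega)
      exact this hz
    have hmove : ∀ d, d ≤ n + 1 → (descProd g n d).1 (n + 1 - d) = n + 1 := by
      intro d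
      induction d with
      | zero => intro _; simp [descProd]
      | succ d ihd =>
        intro hd
        have h1 : n + 1 - (d + 1) = n - d := by omega
        have h2 : n - d + 1 = n + 1 - d := by omega
        rw [descProd, h1, Prod.fst_mul, Perm.mul_apply]
        simp only [hg, swap_apply_left]
        rw [h2]
        exact ihd (by omega)
    -- The descending product sends `n + 1 - d` to `n + 1`, which `y` fixes. As the total
    -- permutation is the identity, `d = 0`, and the pair lies already in the smaller subgroup.
    have h1 : (n + 1 - d) = n + 1 := by
      have h2 : (1 : Perm ℕ) (n + 1 - d) = (y * descProd g n d).1 (n + 1 - d) := by rw [← he]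
      rw [Prod.fst_mul, Perm.mul_apply, hmove d hd, hfix y hy] at h2
      exact h2
    obtain rfl : d = 0 := by omega
    rw [descProd, mul_one] at he
    exact ih (fun i hi => hsq i (by omega)) (fun i hi => hbraid i (by omega))
      (fun i j hij hj => hcomm i j hij (by omega)) h (he ▸ hy)

/-- The symmetric group is defined by the Coxeter relations. -/
theorem exists_hom_of_coxeter {H : Type*} [Group H] (t : ℕ → H) (n : ℕ)
    (hsq : ∀ i, i < n → t i * t i = 1)
    (hbraid : ∀ i, i + 1 < n → t (i + 1) * t i * t (i + 1) = t i * t (i + 1) * t i)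
    (hcomm : ∀ i j, i + 1 < j → j < n → t i * t j = t j * t i) :
    ∃ f : Perm (Fin (n + 1)) →* H, ∀ i : Fin n, f (swap i.castSucc i.succ) = t i := by
  let φ : Perm (Fin (n + 1)) →* Perm ℕ := Perm.viaEmbeddingHom Fin.valEmbedding
  have hφ : Function.Injective φ := Perm.viaEmbeddingHom_injective _
  have hφs : ∀ i : Fin n, φ (swap i.castSucc i.succ) = swap (i : ℕ) (i + 1) := by
    intro i
    ext p
    by_cases hp : p < n + 1
    · have := Perm.viaEmbedding_apply (swap i.castSucc i.succ) Fin.valEmbedding ⟨p, hp⟩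
      simp only [φ, Perm.viaEmbeddingHom_apply]
      refine this.trans ?_
      simp only [swap_apply_def, Fin.ext_iff, Fin.valEmbedding_apply, Fin.val_castSucc,
        Fin.val_succ]
      split_ifs <;> rfl
    · have := Perm.viaEmbedding_apply_of_notMem (swap i.castSucc i.succ) Fin.valEmbedding p (by
        rintro ⟨q, rfl⟩; exact hp q.isLt)
      simp only [φ, Perm.viaEmbeddingHom_apply]
      rw [this, swap_apply_of_ne_of_ne] <;> omega
  -- The subgroup `K` is the graph of the desired homomorphism: its first projection is injective by
  -- `eq_one_of_mem_closure_swap`, and surjective because adjacent transpositions generate.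
  let S : Set (Perm (Fin (n + 1)) × H) := Set.range fun i : Fin n => (swap i.castSucc i.succ, t i)
  let K := Subgroup.closure S
  have hK : ∀ z ∈ K, ((φ z.1, z.2) : Perm ℕ × H) ∈
      Subgroup.closure ((fun i => (swap i (i + 1), t i)) '' {i | i < n}) := by
    intro z hz
    have : K ≤ (Subgroup.closure ((fun i => (swap i (i + 1), t i)) '' {i | i < n})).comap
        (φ.prodMap (MonoidHom.id H)) := by
      rw [Subgroup.closure_le]
      rintro _ ⟨i, rfl⟩
      exact Subgroup.subset_closure ⟨i, i.isLt, Prod.ext (hφs i).symm rfl⟩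
    exact this hz
  let p : K →* Perm (Fin (n + 1)) := (MonoidHom.fst _ _).comp K.subtype
  have hp : Function.Bijective p := by
    constructor
    · rw [injective_iff_map_eq_one]
      rintro ⟨⟨σ, h⟩, hz⟩ h1
      obtain rfl : σ = 1 := h1
      have := hK _ hz
      simp only [map_one] at this
      obtain rfl := eq_one_of_mem_closure_swap t n hsq hbraid hcomm h this
      rfl
    · rw [← MonoidHom.range_eq_top, eq_top_iff,
        ← Subgroup.closure_eq_top_of_mclosure_eq_top (Perm.mclosure_swap_castSucc_succ n),
        Subgroup.closure_le]
      rintro _ ⟨i, rfl⟩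
      exact ⟨⟨(swap i.castSucc i.succ, t i), Subgroup.subset_closure ⟨i, rfl⟩⟩, rfl⟩
  let E := MulEquiv.ofBijective p hp
  refine ⟨((MonoidHom.snd _ _).comp K.subtype).comp E.symm.toMonoidHom, fun i => ?_⟩
  have : E.symm (swap i.castSucc i.succ) =
      ⟨(swap i.castSucc i.succ, t i), Subgroup.subset_closure ⟨i, rfl⟩⟩ := by
    rw [MulEquiv.symm_apply_eq]
    rfl
  simp [this]

end POIPresentation

/-! ### Moore's relations on two generators, reduced to the Coxeter relations -/

namespace POIPresentation

open Equiv

/-- Moore's relations for the symmetric group of degree `m`, the generators being a transposition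
`a` of two adjacent points and a cycle `b` of length `m`. -/
structure MooreRel {M : Type*} [Monoid M] (m : ℕ) (a b : M) : Prop where
  sq : a ^ 2 = 1
  pow : b ^ m = 1
  prod : (b * a) ^ (m - 1) = 1
  braid : 3 ≤ m → (a * b ^ (m - 1) * a * b) ^ 3 = 1
  comm : ∀ j, 2 ≤ j → j ≤ m - 2 → (a * b ^ (m - j) * a * b ^ j) ^ 2 = 1

theorem MooreRel.map {M M' : Type*} [Monoid M] [Monoid M'] {m : ℕ} {a b : M}
    (h : MooreRel m a b) (f : M →* M') : MooreRel m (f a) (f b) where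
  sq := by rw [← map_pow, h.sq, map_one]
  pow := by rw [← map_pow, h.pow, map_one]
  prod := by rw [← map_mul, ← map_pow, h.prod, map_one]
  braid hm := by simp only [← map_mul, ← map_pow]; rw [h.braid hm, map_one]
  comm j h1 h2 := by simp only [← map_mul, ← map_pow]; rw [h.comm j h1 h2, map_one]

/-- For `m = 2` the relation `prod` reads `b * a = 1`, so `b = a` and the braid relation is a power
of `a * a`. This is why `R4` is superfluous for `m = 2`. -/
theorem MooreRel.braid_of_two_le {M : Type*} [Monoid M] {m : ℕ} {a b : M} (hm : 2 ≤ m)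
    (h : MooreRel m a b) : (a * b ^ (m - 1) * a * b) ^ 3 = 1 := by
  rcases eq_or_lt_of_le hm with rfl | hm
  · have h1 : b * a = 1 := by simpa using h.prod
    have h2 : a * a = 1 := by simpa [pow_two] using h.sq
    have h3 : b = a := by rw [← mul_one b, ← h2, ← mul_assoc, h1, one_mul]
    subst h3
    simp [h2]
  · exact h.braid hm

theorem braid_of_mul_pow_three {H : Type*} [Group H] {a c : H} (ha : a * a = 1) (hc : c * c = 1)
    (h : (a * c) ^ 3 = 1) : c * a * c = a * c * a := by
  have h1 : a * c * a * (c * a * c) = 1 := by rw [← h]; simp only [pow_succ, pow_zero, one_mul,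
    mul_assoc]
  have h2 : (c * a * c) * (c * a * c) = 1 := by
    calc (c * a * c) * (c * a * c) = c * (a * ((c * c) * (a * c))) := by simp only [mul_assoc]
      _ = c * ((a * a) * c) := by rw [hc, one_mul, mul_assoc]
      _ = 1 := by rw [ha, one_mul, hc]
  exact mul_right_cancel (h2.trans h1.symm)

theorem comm_of_mul_pow_two {H : Type*} [Group H] {a c : H} (ha : a * a = 1) (hc : c * c = 1)
    (h : (a * c) ^ 2 = 1) : a * c = c * a := by
  have h1 : a * c * (a * c) = 1 := by rw [← sq, h]
  have h2 : c * a * (a * c) = 1 := by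
    rw [mul_assoc, ← mul_assoc a, ha, one_mul, hc]
  exact mul_right_cancel (h1.trans h2.symm)

/-- The product telescopes. When `(a * b⁻¹) ^ n = 1` it recovers a power of `b` from the Coxeter
generators. -/
theorem ofFn_conj_prod {H : Type*} [Group H] (a b : H) (n : ℕ) :
    ((List.range n).map fun i => (b ^ i)⁻¹ * a * b ^ i).prod = (a * b⁻¹) ^ n * b ^ n := by
  induction n with
  | zero => simp
  | succ n ih =>
    rw [List.range_succ, List.map_append, List.prod_append, ih]
    simp only [List.map_cons, List.map_nil, List.prod_cons, List.prod_nil, mul_one, pow_succ (a * b⁻¹),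
      pow_succ' b]
    group

theorem val_finRotate (n : ℕ) (p : Fin (n + 1)) :
    (finRotate (n + 1) p : ℕ) = if (p : ℕ) = n then 0 else (p : ℕ) + 1 := by
  rw [coe_finRotate]
  simp [Fin.ext_iff]

theorem succ_mod_succ (x n : ℕ) :
    (x + 1) % (n + 1) = if x % (n + 1) = n then 0 else x % (n + 1) + 1 := by
  have h1 := Nat.div_add_mod x (n + 1)
  have h2 : x % (n + 1) < n + 1 := Nat.mod_lt x (Nat.succ_pos n)
  split_ifs with h
  · have : x + 1 = (n + 1) * (x / (n + 1) + 1) := by rw [mul_add]; omega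
    rw [this, Nat.mul_mod_right]
  · have : x + 1 = (n + 1) * (x / (n + 1)) + (x % (n + 1) + 1) := by omega
    rw [this, Nat.mul_add_mod, Nat.mod_eq_of_lt (by omega)]

theorem finRotate_pow_self (m : ℕ) : finRotate m ^ m = 1 := by
  rcases m with _ | n
  · rfl
  have key : ∀ i (p : Fin (n + 1)),
      ((finRotate (n + 1) ^ i) p : ℕ) = ((p : ℕ) + i) % (n + 1) := by
    intro i
    induction i with
    | zero => intro p; simp [Nat.mod_eq_of_lt p.isLt]
    | succ i ih =>
      intro p
      rw [pow_succ', Perm.mul_apply, val_finRotate, ih, ← add_assoc, succ_mod_succ]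
  ext p
  rw [key]
  simp [Nat.mod_eq_of_lt p.isLt]

/-- The product fixes `0` and permutes the other `n + 1` points in one cycle `1 → 2 → ⋯ → n + 1 →
1`. -/
theorem swap_mul_finRotate_pow (n : ℕ) :
    ((swap ⟨0, by omega⟩ ⟨1, by omega⟩ : Perm (Fin (n + 2))) * finRotate (n + 2)) ^ (n + 1) = 1 := by
  set c := (swap ⟨0, by omega⟩ ⟨1, by omega⟩ : Perm (Fin (n + 2))) * finRotate (n + 2) with hc
  have hval : ∀ p : Fin (n + 2), (c p : ℕ) =
      (if (p : ℕ) = 0 then 0 else if (p : ℕ) = n + 1 then 1 else (p : ℕ) + 1 : ℕ) := by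
    intro p
    have h : ((finRotate (n + 2) p : Fin (n + 2)) : ℕ) = _ := val_finRotate (n + 1) p
    rw [hc, Perm.mul_apply]
    generalize finRotate (n + 2) p = q at h
    have h' : (swap (⟨0, by omega⟩ : Fin (n + 2)) ⟨1, by omega⟩ q : ℕ) =
        (if (q : ℕ) = 0 then 1 else if (q : ℕ) = 1 then 0 else (q : ℕ) : ℕ) := by
      simp only [swap_apply_def, Fin.ext_iff]
      split_ifs <;> rfl
    rw [h']
    by_cases h1 : (p : ℕ) = n + 1
    · rw [if_pos h1] at h
      rw [h, if_pos rfl, if_neg (by omega), if_pos h1]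
    · rw [if_neg h1] at h
      split_ifs <;> omega
  have key : ∀ i (p : Fin (n + 2)), ((c ^ i) p : ℕ) =
      (if (p : ℕ) = 0 then 0 else 1 + ((p : ℕ) - 1 + i) % (n + 1) : ℕ) := by
    intro i
    induction i with
    | zero =>
      intro p
      rw [add_zero, Nat.mod_eq_of_lt (show (p : ℕ) - 1 < n + 1 by omega), pow_zero, Perm.one_apply]
      split_ifs <;> omega
    | succ i ih =>
      intro p
      rw [pow_succ', Perm.mul_apply, hval, ih, ← add_assoc, succ_mod_succ]
      split_ifs <;> omega
  ext p
  rw [key, Nat.add_mod_right, Nat.mod_eq_of_lt (show (p : ℕ) - 1 < n + 1 by omega), Perm.one_apply]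
  split_ifs <;> omega

theorem finRotate_pow_conj_swap (n : ℕ) (i : Fin (n + 1)) :
    finRotate (n + 2) ^ (i : ℕ) * swap ⟨0, by omega⟩ ⟨1, by omega⟩ * (finRotate (n + 2) ^ (i : ℕ))⁻¹ =
      swap i.castSucc i.succ := by
  obtain ⟨i, hi⟩ := i
  induction i with
  | zero => simp
  | succ i ih =>
    have h1 := ih (by omega)
    simp only at h1 ⊢
    rw [pow_succ', mul_inv_rev]
    have : finRotate (n + 2) * finRotate (n + 2) ^ i * swap ⟨0, by omega⟩ ⟨1, by omega⟩ *
        ((finRotate (n + 2) ^ i)⁻¹ * (finRotate (n + 2))⁻¹) = finRotate (n + 2) *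
        (finRotate (n + 2) ^ i * swap ⟨0, by omega⟩ ⟨1, by omega⟩ * (finRotate (n + 2) ^ i)⁻¹) *
        (finRotate (n + 2))⁻¹ := by simp only [mul_assoc]
    rw [this, h1, ← swap_apply_apply]
    congr 1 <;> ext <;> rw [val_finRotate] <;> simp <;> omega

/-- The cycle is inverted because `Perm` composes from right to left; then `b⁻ʲ a bʲ` is the
transposition of `j` and `j + 1`. Thus `braid` is the cube of a 3-cycle, and `comm` the square of a
product of two disjoint transpositions. -/
theorem mooreRel_perm (m : ℕ) (hm : 2 ≤ m) :
    MooreRel m (swap ⟨0, by omega⟩ ⟨1, by omega⟩ : Perm (Fin m)) (finRotate m)⁻¹ := by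
  obtain ⟨n, rfl⟩ : ∃ n, m = n + 2 := ⟨m - 2, by omega⟩
  have hpow : ∀ j, j ≤ n + 2 → ((finRotate (n + 2))⁻¹) ^ (n + 2 - j) = finRotate (n + 2) ^ j := by
    intro j hj
    rw [inv_pow, inv_eq_iff_mul_eq_one, ← pow_add, show n + 2 - j + j = n + 2 by omega,
      finRotate_pow_self]
  refine ⟨by simp [sq], by rw [inv_pow, finRotate_pow_self, inv_one], ?_, ?_, ?_⟩
  · rw [← inv_inj, ← inv_pow, mul_inv_rev, inv_inv, swap_inv, inv_one]
    exact swap_mul_finRotate_pow n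
  · intro h3
    obtain ⟨n, rfl⟩ : ∃ n', n = n' + 1 := ⟨n - 1, by omega⟩
    have := finRotate_pow_conj_swap (n + 1) 1
    rw [hpow 1 (by omega)]
    simp only [Fin.val_one, pow_one] at this ⊢
    have h4 := (Perm.isThreeCycle_swap_mul_swap_same (a := (⟨1, by omega⟩ : Fin (n + 1 + 2)))
      (b := ⟨0, by omega⟩) (c := ⟨2, by omega⟩) (by simp) (by simp) (by simp)).orderOf
    have h5 : (Fin.castSucc 1 : Fin (n + 1 + 2)) = ⟨1, by omega⟩ := rfl
    have h6 : (Fin.succ 1 : Fin (n + 1 + 2)) = ⟨2, by omega⟩ := rfl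
    rw [h5, h6] at this
    rw [mul_assoc, mul_assoc, ← mul_assoc (finRotate _), this,
      swap_comm (⟨0, by omega⟩ : Fin (n + 1 + 2)) ⟨1, by omega⟩, ← h4]
    exact pow_orderOf_eq_one _
  · intro j h2 hj
    have := finRotate_pow_conj_swap n ⟨j, by omega⟩
    rw [hpow j (by omega), inv_pow, mul_assoc, mul_assoc, ← mul_assoc (finRotate _ ^ _), this]
    refine (Commute.mul_pow ?_ 2).trans (by simp [pow_two])
    refine (Perm.disjoint_swap_swap ?_).commute
    simp [Fin.ext_iff]
    omega

/-- The symmetric group is defined by Moore's relations. -/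
theorem MooreRel.exists_hom {H : Type*} [Group H] {m : ℕ} (hm : 2 ≤ m) {a b : H}
    (h : MooreRel m a b) : ∃ f : Perm (Fin m) →* H,
      f (swap ⟨0, by omega⟩ ⟨1, by omega⟩) = a ∧ f (finRotate m)⁻¹ = b := by
  obtain ⟨n, rfl⟩ : ∃ n, m = n + 2 := ⟨m - 2, by omega⟩
  have hpow : ∀ j, j ≤ n + 2 → b ^ (n + 2 - j) = (b ^ j)⁻¹ := by
    intro j hj
    rw [eq_inv_iff_mul_eq_one, ← pow_add, show n + 2 - j + j = n + 2 by omega, h.pow]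
  have ha : a * a = 1 := by rw [← pow_two, h.sq]
  have hconj : ∀ (i : ℕ) (x y : H), ((b ^ i)⁻¹ * x * b ^ i) * ((b ^ i)⁻¹ * y * b ^ i) =
      (b ^ i)⁻¹ * (x * y) * b ^ i := by intro i x y; group
  -- These will be the Coxeter generators. Conjugation by `b ^ i` reduces the relation between `t i`
  -- and `t (i + d)` to the one between `t 0` and `t d`, which is one of Moore's.
  set t : ℕ → H := fun i => (b ^ i)⁻¹ * a * b ^ i with ht
  have htadd : ∀ i d, t (i + d) = (b ^ i)⁻¹ * t d * b ^ i := by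
    intro i d
    simp only [ht, add_comm i d, pow_add, mul_inv_rev, mul_assoc]
  have ht0 : t 0 = a := by simp [ht]
  have hsq : ∀ i, t i * t i = 1 := by
    intro i
    simp only [ht]
    rw [hconj, ha]
    group
  obtain ⟨f, hf⟩ := exists_hom_of_coxeter t (n + 1) (fun i _ => hsq i)
    (fun i hi => by
      have h1 := h.braid (by omega)
      rw [show n + 2 - 1 = n + 1 by omega, show n + 1 = n + 2 - 1 by omega, hpow 1 (by omega), pow_one,
        show a * b⁻¹ * a * b = t 0 * t 1 by simp [ht, mul_assoc]] at h1
      have h2 := braid_of_mul_pow_three (hsq 0) (hsq 1) h1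
      have h3 : t i = (b ^ i)⁻¹ * t 0 * b ^ i := htadd i 0
      rw [htadd i 1, h3, hconj, hconj, h2, hconj, hconj])
    (fun i j hij hj => by
      obtain ⟨d, rfl⟩ : ∃ d, j = i + d := ⟨j - i, by omega⟩
      have h1 := h.comm d (by omega) (by omega)
      rw [hpow d (by omega),
        show a * (b ^ d)⁻¹ * a * b ^ d = t 0 * t d by simp [ht, mul_assoc]] at h1
      have h2 := comm_of_mul_pow_two (hsq 0) (hsq d) h1
      have h3 : t i = (b ^ i)⁻¹ * t 0 * b ^ i := htadd i 0
      rw [htadd i d, h3, hconj, h2, hconj])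
  have hfs : ∀ i : Fin (n + 1), f (finRotate (n + 2) ^ (i : ℕ) * swap ⟨0, by omega⟩ ⟨1, by omega⟩ *
      (finRotate (n + 2) ^ (i : ℕ))⁻¹) = t i := fun i => by
    rw [finRotate_pow_conj_swap n i]; exact hf i
  refine ⟨f, ?_, ?_⟩
  · have := hfs 0
    simpa [ht0] using this
  -- In both groups `(a * b⁻¹) ^ (m - 1) = 1`, so the product of the `m - 1` Coxeter generators is
  -- `b ^ (m - 1) = b⁻¹`. Since `f` matches the Coxeter generators, it matches the cycles.
  · have h1 := ofFn_conj_prod (swap ⟨0, by omega⟩ ⟨1, by omega⟩ : Perm (Fin (n + 2)))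
      (finRotate (n + 2))⁻¹ (n + 1)
    have h2 := ofFn_conj_prod a b (n + 1)
    rw [inv_inv, swap_mul_finRotate_pow, one_mul] at h1
    have h3 : (a * b⁻¹) ^ (n + 1) = 1 := by
      have : a * b⁻¹ = (b * a)⁻¹ := by rw [mul_inv_rev, inv_eq_of_mul_eq_one_left ha]
      rw [this, inv_pow, inv_eq_one]
      exact h.prod
    rw [h3, one_mul] at h2
    have h4 : f ((finRotate (n + 2))⁻¹ ^ (n + 1)) = b ^ (n + 1) := by
      rw [← h1, ← h2, map_list_prod, List.map_map]
      congr 1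
      apply List.map_congr_left
      intro i hi
      have := hfs ⟨i, List.mem_range.1 hi⟩
      simpa [ht] using this
    have h5 : (finRotate (n + 2))⁻¹ = ((finRotate (n + 2))⁻¹ ^ (n + 1))⁻¹ := by
      rw [eq_inv_iff_mul_eq_one, ← pow_succ', inv_pow, finRotate_pow_self, inv_one]
    rw [h5, map_inv, h4, inv_eq_iff_mul_eq_one, ← pow_succ]
    exact h.pow

end POIPresentation

namespace POIPresentation

/-! ### Consequences of the relations of the monoid of order preserving partial permutations

The point `r` of `{1, …, k}` has the label `k - r`; then, for `i ≥ 1`, the generator `x i` moves the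
label `i` to `i - 1`, and `x 0` moves each label `l < k - 1` to `l + 1`. -/

section Words

variable {N : Type*} [Monoid N]

/-- The product `x i * x (i + 1) * ⋯ * x (j - 1)`. -/
def icoProd (x : ℕ → N) (i j : ℕ) : N := ((List.Ico i j).map x).prod

theorem icoProd_self (x : ℕ → N) (i : ℕ) : icoProd x i i = 1 := by simp [icoProd]

theorem icoProd_succ (x : ℕ → N) {i j : ℕ} (h : i ≤ j) :
    icoProd x i (j + 1) = icoProd x i j * x j := by
  simp [icoProd, List.Ico.succ_top h]

theorem icoProd_eq_cons (x : ℕ → N) {i j : ℕ} (h : i < j) :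
    icoProd x i j = x i * icoProd x (i + 1) j := by
  simp [icoProd, List.Ico.eq_cons h]

theorem icoProd_mul (x : ℕ → N) {i j l : ℕ} (h : i ≤ j) (h' : j ≤ l) :
    icoProd x i j * icoProd x j l = icoProd x i l := by
  simp [icoProd, ← List.prod_append, ← List.map_append, List.Ico.append_consecutive h h']

theorem map_icoProd {N' : Type*} [Monoid N'] (f : N →* N') (x : ℕ → N) (i j : ℕ) :
    f (icoProd x i j) = icoProd (fun l => f (x l)) i j := by
  simp [icoProd, map_list_prod, Function.comp_def]

theorem icoProd_commute (x : ℕ → N) (c : N) (i j : ℕ)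
    (h : ∀ l, i ≤ l → l < j → c * x l = x l * c) : c * icoProd x i j = icoProd x i j * c := by
  refine Commute.list_prod_right _ _ ?_
  simp only [List.mem_map, List.Ico.mem]
  rintro _ ⟨l, ⟨h1, h2⟩, rfl⟩
  exact h l h1 h2

/-- The relations of the monoid of order preserving partial permutations of `{1, …, k}`. -/
structure WRel (k : ℕ) (x : ℕ → N) : Prop where
  shift : ∀ i, 1 ≤ i → i + 2 ≤ k → x i * x 0 = x 0 * x (i + 1)
  far : ∀ i j, 1 ≤ i → i + 1 < j → j + 1 ≤ k → x j * x i = x i * x j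
  zero_one : x 0 * x 0 * x 1 = x 0 * x 0
  last_zero : x (k - 1) * (x 0 * x 0) = x 0 * x 0
  near : ∀ i, 1 ≤ i → i + 2 ≤ k → x (i + 1) * x i * x (i + 1) = x (i + 1) * x i
  near' : ∀ i, 1 ≤ i → i + 2 ≤ k → x i * x (i + 1) * x i = x (i + 1) * x i
  regular : ∀ i, i + 1 ≤ k → icoProd x i k * icoProd x 0 i * x i = x i
  square : ∀ i, 1 ≤ i → i + 1 ≤ k →
    icoProd x (i + 1) k * icoProd x 0 i * (x i * x i) = x i * x i

namespace WRel

/-- The word for the idempotent whose domain consists of all labels but `l`. -/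
def e (k : ℕ) (x : ℕ → N) (l : ℕ) : N := icoProd x (l + 1) k * icoProd x 0 (l + 1)

/-- The word for the inverse of `x i`, where `1 ≤ i < k`. -/
def z (k : ℕ) (x : ℕ → N) (i : ℕ) : N := icoProd x (i + 1) k * icoProd x 0 i

variable {k : ℕ} {x : ℕ → N} (h : WRel k x)
include h

/-- By the relation `regular` for index `0`, the product `x 0 * ⋯ * x (k - 1)` is a left identity
for `x 0`. -/
theorem zero_k_mul {i : ℕ} (hi : 1 ≤ i) (hik : i ≤ k) :
    icoProd x 0 k * icoProd x 0 i = icoProd x 0 i := by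
  have h0 := h.regular 0 (by omega)
  rw [icoProd_self, mul_one] at h0
  rw [icoProd_eq_cons x (show 0 < i by omega), ← mul_assoc, h0]

theorem e_mul_self {l : ℕ} (hl : l < k) : e k x l * e k x l = e k x l := by
  rw [e, mul_assoc, ← mul_assoc (icoProd x 0 (l + 1)), icoProd_mul x (by omega) (by omega),
    h.zero_k_mul (by omega) (by omega)]

omit h in
theorem x_mul_z {i : ℕ} (hik : i + 1 < k) : x (i + 1) * z k x (i + 1) = e k x i := by
  rw [z, e, ← mul_assoc, ← icoProd_eq_cons x (by omega)]

omit h in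
theorem z_mul_x (i : ℕ) : z k x i * x i = e k x i := by
  rw [z, e, mul_assoc, icoProd_succ x (Nat.zero_le i)]

theorem e_mul_x {i : ℕ} (hik : i + 1 < k) : e k x i * x (i + 1) = x (i + 1) :=
  h.regular (i + 1) (by omega)

theorem x_mul_e {i : ℕ} (hik : i + 1 < k) : x (i + 1) * e k x (i + 1) = x (i + 1) := by
  rw [← z_mul_x, ← mul_assoc, x_mul_z hik, h.e_mul_x hik]

theorem z_mul_e {i : ℕ} (hi : i + 1 < k) : z k x (i + 1) * e k x i = z k x (i + 1) := by
  rw [← x_mul_z hi, ← mul_assoc, z_mul_x, e, z, mul_assoc, ← mul_assoc (icoProd x 0 _),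
    icoProd_mul x (by omega) (by omega), h.zero_k_mul (by omega) (by omega)]

theorem e_mul_z {i : ℕ} (hi : i + 1 < k) : e k x (i + 1) * z k x (i + 1) = z k x (i + 1) := by
  rw [← z_mul_x, mul_assoc, x_mul_z hi, h.z_mul_e hi]

theorem e_mul_x_eq_sq {i : ℕ} (hi : 1 ≤ i) (hik : i < k) : e k x i * x i = x i * x i := by
  rw [← z_mul_x, mul_assoc]
  exact h.square i hi hik

theorem far_right {j a b : ℕ} (ha : 1 ≤ a) (hb : b < j) (hj : j < k) :
    x j * icoProd x a b = icoProd x a b * x j :=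
  icoProd_commute x _ _ _ fun l h1 h2 => h.far l j (by omega) (by omega) (by omega)

theorem far_left {j a b : ℕ} (hj : 1 ≤ j) (ha : j + 1 < a) (hb : b ≤ k) :
    x j * icoProd x a b = icoProd x a b * x j :=
  icoProd_commute x _ _ _ fun l h1 h2 => (h.far j l (by omega) (by omega) (by omega)).symm

/-- Both `x (i + 1) * x i * x (i + 1)` and `x i * x (i + 1) * x i` equal `x (i + 1) * x i`. Hence
the braid relation holds, and a run of consecutive generators lowers the index of a generator
passing through it, as in a Coxeter group. -/
theorem braid {i a b : ℕ} (ha : 1 ≤ a) (hai : a ≤ i) (hib : i + 1 < b) (hb : b ≤ k) :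
    x (i + 1) * icoProd x a b = icoProd x a b * x i := by
  have h1 : icoProd x a b = icoProd x a i * (x i * (x (i + 1) * icoProd x (i + 2) b)) := by
    rw [← icoProd_eq_cons x hib, ← icoProd_eq_cons x (by omega), icoProd_mul x hai (by omega)]
  have h2 : x (i + 1) * (x i * x (i + 1)) = x i * (x (i + 1) * x i) := by
    rw [← mul_assoc, ← mul_assoc, h.near i (by omega) (by omega), h.near' i (by omega) (by omega)]
  rw [h1, ← mul_assoc, h.far_right ha (by omega) (by omega)]
  simp only [mul_assoc]
  rw [← h.far_left (by omega) (by omega) hb, ← mul_assoc (x i), ← mul_assoc (x (i + 1)), h2]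
  simp only [mul_assoc]

theorem icoProd_mul_zero {a b : ℕ} (ha : 1 ≤ a) (hb : b < k) :
    icoProd x a b * x 0 = x 0 * icoProd x (a + 1) (b + 1) := by
  rcases le_or_gt a b with hab | hab
  · induction b, hab using Nat.le_induction with
    | base => simp [icoProd_self]
    | succ b hab ih =>
      rw [icoProd_succ x hab, icoProd_succ x (by omega), mul_assoc, h.shift b (by omega) (by omega),
        ← mul_assoc, ih (by omega), mul_assoc]
  · simp [icoProd, List.Ico.eq_nil_of_le hab.le,
      List.Ico.eq_nil_of_le (show b + 1 ≤ a + 1 by omega)]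

/-- The index of `x i` changes by one and comes back while it crosses the word `e l`. For `l < i`
the factors before `x 0` lower it and `x 0` raises it; for `l > i` it is raised by `x 0` and lowered
by the factors after it. -/
theorem x_comm_e {i l : ℕ} (hi : 1 ≤ i) (hik : i < k) (hl : l < k) (hil : l ≠ i) (hil' : l + 1 ≠ i) :
    x i * e k x l = e k x l * x i := by
  have h0 : icoProd x 0 (l + 1) = x 0 * icoProd x 1 (l + 1) := icoProd_eq_cons x (by omega)
  rcases lt_or_ge l i with hlt | hge
  · obtain ⟨j, rfl⟩ : ∃ j, i = j + 1 := ⟨i - 1, by omega⟩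
    rw [e, ← mul_assoc, h.braid (by omega) (by omega) hik le_rfl, mul_assoc, h0, ← mul_assoc (x j),
      h.shift j (by omega) (by omega), mul_assoc (x 0), h.far_right le_rfl (by omega) hik]
    simp only [mul_assoc]
  · rw [e, ← mul_assoc, h.far_left hi (by omega) le_rfl, mul_assoc, h0, ← mul_assoc (x i),
      h.shift i hi (by omega), mul_assoc (x 0), h.braid le_rfl hi (by omega) (by omega)]
    simp only [mul_assoc]

theorem cube {i : ℕ} (hi : i + 1 < k) :
    x (i + 1) * (x (i + 1) * x (i + 1)) = x (i + 1) * x (i + 1) := by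
  rw [← h.e_mul_x_eq_sq (by omega) hi, ← mul_assoc, h.x_mul_e hi, h.e_mul_x_eq_sq (by omega) hi]

/-- The product `x (i + 2) * x (i + 1)` is fixed under right multiplication by `x (i + 2)`, hence
also by `z (i + 2)`. Multiplying on the left by `z (i + 1) * z (i + 2)` transfers this to `e (i + 1)
* e (i + 2)`. The first fixation identifies that idempotent with the square of `x (i + 2)`; the
second then gives the claim. -/
theorem x_mul_e_pred_of_two_le {i : ℕ} (hi : i + 2 < k) :
    x (i + 2) * e k x (i + 1) = x (i + 2) * x (i + 2) := by
  have hv : x (i + 2) * x (i + 1) * x (i + 2) = x (i + 2) * x (i + 1) :=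
    h.near (i + 1) (by omega) (by omega)
  have hv' : x (i + 2) * x (i + 1) * z k x (i + 2) = x (i + 2) * x (i + 1) := by
    rw [← hv, mul_assoc _ (x (i + 2)) (z k x (i + 2)), x_mul_z hi, hv, mul_assoc,
      h.x_mul_e (by omega)]
  have key : ∀ c, x (i + 2) * x (i + 1) * c = x (i + 2) * x (i + 1) →
      e k x (i + 1) * e k x (i + 2) * c = e k x (i + 1) * e k x (i + 2) := by
    intro c hc
    have h1 : z k x (i + 1) * (z k x (i + 2) * (x (i + 2) * x (i + 1))) =
        e k x (i + 1) * e k x (i + 2) := by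
      rw [← mul_assoc (z k x (i + 2)), z_mul_x, ← h.x_comm_e (by omega) (by omega) hi (by omega)
        (by omega), ← mul_assoc, z_mul_x]
    rw [← h1]
    simp only [mul_assoc] at hc ⊢
    rw [hc]
  have h1 := key _ hv
  rw [mul_assoc, h.e_mul_x_eq_sq (by omega) hi, ← mul_assoc, h.e_mul_x hi] at h1
  have h2 := key _ hv'
  rw [← h1, mul_assoc, x_mul_z hi] at h2
  exact h2

theorem zero_mul_e : 0 < k → x 0 * e k x 0 = x 0 := by
  intro hk
  have h0 := h.regular 0 (by omega)
  rw [icoProd_self, mul_one] at h0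
  rw [e, zero_add, icoProd_succ x le_rfl, icoProd_self, one_mul, ← mul_assoc,
    ← icoProd_eq_cons x (by omega), h0]

/-- Here the predecessor `x 0` is not a step, and the relation `zero_one` takes over. The element
`w` ends in `x 0 * x 0`, so it absorbs `x 1` and `z 1` from the right; together with `square` and
`cube` this forces `w = x 1 * x 1`. -/
theorem x_mul_e_zero (hk : 1 < k) : x 1 * e k x 0 = x 1 * x 1 := by
  have hU : icoProd x 1 k = x 1 * icoProd x 2 k := icoProd_eq_cons x hk
  have he : e k x 0 = icoProd x 1 k * x 0 := by
    rw [e, zero_add, icoProd_succ x le_rfl, icoProd_self, one_mul]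
  have hz : z k x 1 = icoProd x 2 k * x 0 := by
    rw [z, icoProd_succ x le_rfl, icoProd_self, one_mul]
  have hcomm : e k x 0 * icoProd x 2 k = icoProd x 2 k * e k x 0 :=
    icoProd_commute x _ _ _ fun l h1 h2 =>
      (h.x_comm_e (by omega) h2 (by omega) (by omega) (by omega)).symm
  have hxz : x 1 * z k x 1 = e k x 0 := x_mul_z hk
  have h1 : x 1 * x 1 * z k x 1 * z k x 1 = icoProd x 1 k * icoProd x 1 k * (x 0 * x 0) := by
    rw [mul_assoc (x 1), hxz, mul_assoc, hz, ← mul_assoc (e k x 0), hcomm, hU, he, hU]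
    simp only [mul_assoc]
  set w := x 1 * x 1 * z k x 1 * z k x 1 with hw
  have h2 : w * x 1 = w := by rw [h1, mul_assoc, h.zero_one]
  have h3 : w * z k x 1 = w := by
    rw [← h2, mul_assoc, hxz, h2, h1, mul_assoc, mul_assoc (x 0), h.zero_mul_e (by omega)]
  have h4 : z k x 1 * (x 1 * x 1) = x 1 * x 1 := h.square 1 le_rfl hk
  have h5 : w = x 1 * x 1 := by
    calc w = w * x 1 * x 1 := by rw [h2, h2]
      _ = x 1 * x 1 * z k x 1 * (z k x 1 * (x 1 * x 1)) := by rw [hw]; simp only [mul_assoc]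
      _ = x 1 * (x 1 * (x 1 * x 1)) := by rw [h4, mul_assoc, h4, mul_assoc]
      _ = x 1 * x 1 := by rw [h.cube hk, h.cube hk]
  rw [h5, mul_assoc, hxz] at h3
  exact h3

theorem x_mul_e_pred {i : ℕ} (hi : i + 1 < k) : x (i + 1) * e k x i = x (i + 1) * x (i + 1) := by
  rcases i with _ | i
  · exact h.x_mul_e_zero hi
  · exact h.x_mul_e_pred_of_two_le hi

theorem e_mul_x_self {i : ℕ} (hi : i + 1 < k) :
    e k x (i + 1) * x (i + 1) = x (i + 1) * e k x i := by
  rw [h.x_mul_e_pred hi, h.e_mul_x_eq_sq (by omega) hi]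

/-- A step does nothing once both of its labels are excluded: the product of the two idempotents is
the square of the generator, and `cube` applies. -/
theorem e_mul_e_mul_x {i : ℕ} (hi : i + 1 < k) :
    e k x (i + 1) * e k x i * x (i + 1) = e k x (i + 1) * e k x i := by
  have h1 : e k x (i + 1) * e k x i = x (i + 1) * x (i + 1) := by
    rw [← x_mul_z hi, ← mul_assoc, h.e_mul_x_eq_sq (by omega) hi, mul_assoc, x_mul_z hi,
      h.x_mul_e_pred hi]
  rw [h1, mul_assoc, h.cube hi]

/-- In `e l * x 0` a square of `x 0` appears. It absorbs the last factor `x (k - 1)` of the initial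
run by `last_zero`, the rest of that run is shifted through one `x 0`, and `zero_one` supplies the
factor `x 1` missing from `e (l + 1)`. -/
theorem e_mul_zero {l : ℕ} (hl : l + 1 < k) : e k x l * x 0 = x 0 * e k x (l + 1) := by
  obtain ⟨k, rfl⟩ : ∃ k', k = k' + 1 := ⟨k - 1, by omega⟩
  have h1 : icoProd x 0 (l + 1) * x 0 = x 0 * x 0 * icoProd x 2 (l + 2) := by
    rw [icoProd_eq_cons x (by omega), mul_assoc, h.icoProd_mul_zero (by omega) (by omega), mul_assoc]
  have h2 : icoProd x 0 (l + 2) = x 0 * (x 1 * icoProd x 2 (l + 2)) := by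
    rw [icoProd_eq_cons x (by omega), icoProd_eq_cons x (by omega)]
  rw [e, mul_assoc, h1, icoProd_succ x (by omega), e, h2, ← mul_assoc (x 0),
    ← h.icoProd_mul_zero (by omega) (by omega)]
  have h3 := h.last_zero
  rw [Nat.add_sub_cancel] at h3
  rw [mul_assoc, ← mul_assoc (x k), h3, ← h.zero_one]
  simp only [mul_assoc]

/-- Only the factor `x (l + 1)` changes the label; the idempotent commutes with all the others. -/
theorem e_mul_icoProd {l : ℕ} (hl : l + 1 < k) {j : ℕ} (hj : j ≤ l) :
    e k x (l + 1) * icoProd x (j + 1) k = icoProd x (j + 1) k * e k x l := by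
  have h1 : icoProd x (j + 1) k = icoProd x (j + 1) (l + 1) * (x (l + 1) * icoProd x (l + 2) k) := by
    rw [← icoProd_eq_cons x hl, icoProd_mul x (by omega) (by omega)]
  have h2 : e k x (l + 1) * icoProd x (j + 1) (l + 1) = icoProd x (j + 1) (l + 1) * e k x (l + 1) :=
    icoProd_commute x _ _ _ fun i _ _ =>
      (h.x_comm_e (by omega) (by omega) hl (by omega) (by omega)).symm
  have h3 : e k x l * icoProd x (l + 2) k = icoProd x (l + 2) k * e k x l :=
    icoProd_commute x _ _ _ fun i _ _ =>
      (h.x_comm_e (by omega) (by omega) (by omega) (by omega) (by omega)).symm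
  rw [h1, ← mul_assoc, h2, mul_assoc, ← mul_assoc (e k x (l + 1)), h.e_mul_x_self hl, mul_assoc, h3]
  simp only [mul_assoc]

/-- Crossing the word of `e j`, the idempotent `e l` becomes `e (l - 1)` after the first run, and `x
0` turns it back into `e l`. -/
theorem e_comm_of_lt {l j : ℕ} (hl : l < k) (hjl : j < l) : e k x l * e k x j = e k x j * e k x l := by
  obtain ⟨l, rfl⟩ : ∃ l', l = l' + 1 := ⟨l - 1, by omega⟩
  have h1 : icoProd x 0 (j + 1) = x 0 * icoProd x 1 (j + 1) := icoProd_eq_cons x (by omega)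
  have h2 : e k x (l + 1) * icoProd x 1 (j + 1) = icoProd x 1 (j + 1) * e k x (l + 1) :=
    icoProd_commute x _ _ _ fun i _ _ =>
      (h.x_comm_e (by omega) (by omega) hl (by omega) (by omega)).symm
  conv_lhs => rw [e.eq_def k x j]
  conv_rhs => rw [e.eq_def k x j]
  rw [← mul_assoc, h.e_mul_icoProd hl (by omega), h1, mul_assoc, ← mul_assoc (e k x l),
    h.e_mul_zero hl, mul_assoc (x 0), h2]
  simp only [mul_assoc]

theorem e_comm {l j : ℕ} (hl : l < k) (hj : j < k) : e k x l * e k x j = e k x j * e k x l := by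
  rcases lt_trichotomy l j with hlt | rfl | hlt
  · exact (h.e_comm_of_lt hj hlt).symm
  · rfl
  · exact h.e_comm_of_lt hl hlt

/-- Inserting `e i = x (i + 1) * z (i + 1)` replaces commutation with `z` by commutation with `x`.
-/
theorem z_comm_e {i l : ℕ} (hik : i + 1 < k) (hl : l < k) (hil : l ≠ i + 1) (hil' : l ≠ i) :
    z k x (i + 1) * e k x l = e k x l * z k x (i + 1) := by
  have hx := h.x_comm_e (Nat.succ_pos i) hik hl hil (by omega)
  calc z k x (i + 1) * e k x l = z k x (i + 1) * (e k x i * e k x l) := by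
        rw [← mul_assoc, h.z_mul_e hik]
    _ = z k x (i + 1) * (e k x l * (x (i + 1) * z k x (i + 1))) := by
        rw [h.e_comm (by omega) hl, x_mul_z hik]
    _ = z k x (i + 1) * x (i + 1) * e k x l * z k x (i + 1) := by
        rw [← mul_assoc (e k x l), ← hx]; simp only [mul_assoc]
    _ = e k x l * (e k x (i + 1) * z k x (i + 1)) := by
        rw [z_mul_x, h.e_comm hik hl, mul_assoc]
    _ = e k x l * z k x (i + 1) := by rw [h.e_mul_z hik]

/-- Used for descending induction on prefixes: starting from `x 0 * ⋯ * x (k - 1)`, which is `e (k -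
1)`, it expresses `x 0` by the inverses of the other generators. -/
theorem icoProd_mul_z {i : ℕ} (hi : 1 ≤ i) (hik : i < k) :
    icoProd x 0 (i + 1) * z k x i = icoProd x 0 i := by
  rw [z, ← mul_assoc, icoProd_mul x (by omega) (by omega), h.zero_k_mul hi hik.le]

end WRel

end Words

end POIPresentation

namespace POIPresentation

/-! ### Normal forms along paths of subsets -/

/-- Relations between idempotents `ε p`, elements `Y p` moving the point `p` to the next point, and
their inverses `Z p`. -/
structure EdgeRel {N : Type*} [Monoid N] {k : ℕ} (ε Y Z : Fin k → N) : Prop where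
  idem : ∀ p, ε p * ε p = ε p
  comm : ∀ p q, ε p * ε q = ε q * ε p
  y_z : ∀ p q : Fin k, p.val + 1 = q.val → Y p * Z p = ε q
  z_y : ∀ p q : Fin k, p.val + 1 = q.val → Z p * Y p = ε p
  ε_y : ∀ p q : Fin k, p.val + 1 = q.val → ε q * Y p = Y p
  y_ε : ∀ p q : Fin k, p.val + 1 = q.val → Y p * ε p = Y p
  ε_z : ∀ p q : Fin k, p.val + 1 = q.val → ε p * Z p = Z p
  z_ε : ∀ p q : Fin k, p.val + 1 = q.val → Z p * ε q = Z p
  ε_y_self : ∀ p q : Fin k, p.val + 1 = q.val → ε p * Y p = Y p * ε q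
  ε_ε_y : ∀ p q : Fin k, p.val + 1 = q.val → ε p * ε q * Y p = ε p * ε q
  y_comm : ∀ p q r : Fin k, p.val + 1 = q.val → r ≠ p → r ≠ q → Y p * ε r = ε r * Y p
  z_comm : ∀ p q r : Fin k, p.val + 1 = q.val → r ≠ p → r ≠ q → Z p * ε r = ε r * Z p
  far : ∀ p p' : Fin k, p.val + 1 < p'.val → p'.val + 1 < k → Y p * Y p' = Y p' * Y p

/-- The pair `p, p + 1` such that `p`, but not `p + 1`, is in `D`. -/
def IsEdge {k : ℕ} (D : Finset (Fin k)) (p q : Fin k) : Prop :=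
  p ∈ D ∧ q ∉ D ∧ p.val + 1 = q.val

/-- Move the point `p` of `D` to `q`. -/
def push {k : ℕ} (D : Finset (Fin k)) (p q : Fin k) : Finset (Fin k) := insert q (D.erase p)

/-- The distance of `D` from the upper end. -/
def weight {k : ℕ} (D : Finset (Fin k)) : ℕ := ∑ p ∈ D, (k - p.val)

theorem IsEdge.weight_push_lt {k : ℕ} {D : Finset (Fin k)} {p q : Fin k} (h : IsEdge D p q) :
    weight (push D p q) < weight D := by
  obtain ⟨hp, hq, hpq⟩ := h
  have h1 : q ∉ D.erase p := fun h => hq (Finset.mem_of_mem_erase h)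
  rw [weight, weight, push, Finset.sum_insert h1, ← Finset.add_sum_erase D _ hp]
  have := q.isLt
  omega

/-- The image of `D` under the partial permutation `θ`. -/
def pimage {k : ℕ} (θ : Fin k ≃. Fin k) (D : Finset (Fin k)) : Finset (Fin k) :=
  Finset.univ.filter fun q => ∃ p ∈ D, θ p = some q

theorem mem_pimage {k : ℕ} {θ : Fin k ≃. Fin k} {D : Finset (Fin k)} {q : Fin k} :
    q ∈ pimage θ D ↔ ∃ p ∈ D, θ p = some q := by simp [pimage]

theorem mul_eq_some {Ω : Type*} {θ θ' : Ω ≃. Ω} {p r : Ω} :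
    (θ * θ') p = some r ↔ ∃ q, θ p = some q ∧ θ' q = some r := PEquiv.trans_eq_some θ θ' p r

theorem mul_eq_none {Ω : Type*} {θ θ' : Ω ≃. Ω} {p : Ω} :
    (θ * θ') p = none ↔ θ p = none ∨ ∃ q, θ p = some q ∧ θ' q = none := by
  change (θ p).bind θ' = none ↔ _
  cases θ p <;> simp

theorem symm_mul {Ω : Type*} (θ θ' : Ω ≃. Ω) : (θ * θ').symm = θ'.symm * θ.symm := rfl

theorem one_apply {Ω : Type*} (p : Ω) : (1 : Ω ≃. Ω) p = some p := rfl

namespace EdgeRel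

variable {N : Type*} [Monoid N] {k : ℕ} {ε Y Z : Fin k → N} (h : EdgeRel ε Y Z)
include h

/-- The idempotent with domain `D`. -/
def restr (D : Finset (Fin k)) : N :=
  Finset.noncommProd Dᶜ ε fun p _ q _ _ => h.comm p q

theorem restr_of_notMem {D : Finset (Fin k)} {p : Fin k} (hp : p ∉ D) :
    h.restr D = ε p * h.restr (insert p D) := by
  have h1 : Dᶜ = insert p (insert p D)ᶜ := by
    ext q
    simp only [Finset.mem_compl, Finset.mem_insert]
    by_cases hq : q = p
    · simp [hq, hp]
    · simp [hq]
  have h2 := Finset.noncommProd_insert_of_notMem (insert p D)ᶜ p ε (fun p _ q _ _ => h.comm p q)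
    (by simp)
  rw [restr, restr, ← h2]
  exact Finset.noncommProd_congr h1 (fun _ _ => rfl) _

theorem commute_restr {D : Finset (Fin k)} {c : N} (hc : ∀ p, p ∉ D → c * ε p = ε p * c) :
    c * h.restr D = h.restr D * c :=
  Finset.noncommProd_commute _ _ _ _ fun p hp => hc p (Finset.mem_compl.1 hp)

theorem ε_comm_restr (D : Finset (Fin k)) (p : Fin k) : ε p * h.restr D = h.restr D * ε p :=
  h.commute_restr fun q _ => h.comm p q

theorem ε_mul_restr {D : Finset (Fin k)} {p : Fin k} (hp : p ∉ D) :
    ε p * h.restr D = h.restr D := by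
  rw [h.restr_of_notMem hp, ← mul_assoc, h.idem]

theorem restr_mul_ε {D : Finset (Fin k)} {p : Fin k} (hp : p ∉ D) :
    h.restr D * ε p = h.restr D := by
  rw [← h.ε_comm_restr, h.ε_mul_restr hp]

theorem mul_restr_eq {D : Finset (Fin k)} {c : N} (hc : ∀ p, p ∉ D → c * ε p = c) :
    c * h.restr D = c := by
  refine Finset.noncommProd_induction Dᶜ ε _ (fun y => c * y = c) ?_ (mul_one c) ?_
  · intro a b ha hb
    rw [← mul_assoc, ha, hb]
  · intro p hp
    exact hc p (Finset.mem_compl.1 hp)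

theorem restr_mul_eq {D : Finset (Fin k)} {c : N} (hc : ∀ p, p ∉ D → ε p * c = c) :
    h.restr D * c = c := by
  refine Finset.noncommProd_induction Dᶜ ε _ (fun y => y * c = c) ?_ (one_mul c) ?_
  · intro a b ha hb
    rw [mul_assoc, hb, ha]
  · intro p hp
    exact hc p (Finset.mem_compl.1 hp)

theorem restr_mul_self (D : Finset (Fin k)) : h.restr D * h.restr D = h.restr D :=
  h.mul_restr_eq fun _ hp => h.restr_mul_ε hp

/-- The factor `ε q` is absorbed by `Y p` from the left, the factor `ε p` can be created on its
right, and the other factors commute with `Y p`. -/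
theorem restr_mul_y {D : Finset (Fin k)} {p q : Fin k} (he : IsEdge D p q) :
    h.restr D * Y p = Y p * h.restr (push D p q) := by
  obtain ⟨hp, hq, hpq⟩ := he
  have hne : p ≠ q := fun h => hq (h ▸ hp)
  have h1 : insert p (push D p q) = insert q D := by
    rw [push, Finset.insert_comm, Finset.insert_erase hp]
  have h2 : p ∉ push D p q := by simp [push, hne]
  have h3 : Y p * h.restr (insert q D) = h.restr (insert q D) * Y p := by
    refine h.commute_restr fun r hr => h.y_comm p q r hpq ?_ ?_
    · rintro rfl; simp [hp] at hr
    · rintro rfl; simp at hr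
  rw [h.restr_of_notMem hq, h.restr_of_notMem h2, h1, mul_assoc, ← h3, ← mul_assoc, h.ε_y p q hpq,
    ← mul_assoc, h.y_ε p q hpq]

theorem restr_mul_y_of_notMem {D : Finset (Fin k)} {p q : Fin k} (hp : p ∉ D) (hq : q ∉ D)
    (hpq : p.val + 1 = q.val) : h.restr D * Y p = h.restr D := by
  have h1 : h.restr D = h.restr D * (ε p * ε q) := by
    rw [← mul_assoc, h.restr_mul_ε hp, h.restr_mul_ε hq]
  rw [h1, mul_assoc, h.ε_ε_y p q hpq]

theorem restr_mul_z_of_notMem {D : Finset (Fin k)} {p q : Fin k} (hp : p ∉ D) (hq : q ∉ D)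
    (hpq : p.val + 1 = q.val) : h.restr D * Z p = h.restr D := by
  conv_lhs => rw [← h.restr_mul_y_of_notMem hp hq hpq, mul_assoc, h.y_z p q hpq]
  exact h.restr_mul_ε hq

open Classical in
/-- An element moving `D` to an upper subset, by steps from a point to the next one. -/
noncomputable def climb (h : EdgeRel ε Y Z) (D : Finset (Fin k)) : N :=
  if he : ∃ e : Fin k × Fin k, IsEdge D e.1 e.2 then
    -- The edge is arbitrary; `restr_mul_y_mul_climb` shows that the choice is immaterial.
    h.restr D * Y he.choose.1 * climb h (push D he.choose.1 he.choose.2)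
  else h.restr D
termination_by weight D
decreasing_by exact he.choose_spec.weight_push_lt

theorem restr_mul_climb (D : Finset (Fin k)) : h.restr D * h.climb D = h.climb D := by
  rw [climb]
  split_ifs with he
  · rw [← mul_assoc, ← mul_assoc, h.restr_mul_self]
  · exact h.restr_mul_self D

/-- The path is undone step by step by the elements `Z p`: `Y p * Z p = ε q` is absorbed by `restr
D`, since `q ∉ D`. -/
theorem exists_climb_mul (D : Finset (Fin k)) : ∃ t, h.climb D * t = h.restr D := by
  induction hn : weight D using Nat.strong_induction_on generalizing D with
  | _ n ih =>
    rw [climb]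
    split_ifs with he
    · obtain ⟨t, ht⟩ := ih _ (hn ▸ he.choose_spec.weight_push_lt) _ rfl
      refine ⟨t * Z he.choose.1, ?_⟩
      rw [← mul_assoc, mul_assoc (h.restr D * _), ht, h.restr_mul_y he.choose_spec, mul_assoc (Y _),
        h.restr_mul_self, ← h.restr_mul_y he.choose_spec, mul_assoc,
        h.y_z _ _ he.choose_spec.2.2, h.restr_mul_ε he.choose_spec.2.1]
    · exact ⟨1, by rw [mul_one]⟩

/-- The element `climb D` does not depend on the first step. -/
theorem restr_mul_y_mul_climb (D : Finset (Fin k)) (p q : Fin k) (he : IsEdge D p q) :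
    h.restr D * Y p * h.climb (push D p q) = h.climb D := by
  induction hn : weight D using Nat.strong_induction_on generalizing D p q with
  | _ n ih =>
    have hex : ∃ e : Fin k × Fin k, IsEdge D e.1 e.2 := ⟨(p, q), he⟩
    rw [climb.eq_def h D, dif_pos hex]
    have hc := hex.choose_spec
    generalize hex.choose.1 = p₀ at hc ⊢
    generalize hex.choose.2 = q₀ at hc ⊢
    by_cases hp : p = p₀
    · subst hp
      obtain rfl : q = q₀ := Fin.ext (by rw [← he.2.2, ← hc.2.2])
      rfl
    have hqq : q ≠ q₀ := by
      rintro rfl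
      exact hp (Fin.ext (by have := he.2.2; have := hc.2.2; omega))
    have hpq₀ : p ≠ q₀ := fun h => hc.2.1 (h ▸ he.1)
    have hp₀q : p₀ ≠ q := fun h => he.2.1 (h ▸ hc.1)
    -- Diamond argument: each of the two edges survives the other step, and both orders lead to the
    -- same set, so the induction hypothesis can be applied after either first step.
    have he' : IsEdge (push D p q) p₀ q₀ :=
      ⟨by simp [push, hc.1, Ne.symm hp], by simp [push, hc.2.1, Ne.symm hqq], hc.2.2⟩
    have hc' : IsEdge (push D p₀ q₀) p q :=
      ⟨by simp [push, he.1, hp], by simp [push, he.2.1, hqq], he.2.2⟩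
    have hpush : push (push D p q) p₀ q₀ = push (push D p₀ q₀) p q := by
      ext r
      simp only [push, Finset.mem_insert, Finset.mem_erase]
      grind
    -- The edges share no point, so `p` and `p₀` are at distance at least two and `far` applies.
    have hYY : Y p * Y p₀ = Y p₀ * Y p := by
      have h1 := q.isLt
      have h2 := q₀.isLt
      have h3 := he.2.2
      have h4 := hc.2.2
      have h5 : p.val ≠ p₀.val := fun h => hp (Fin.ext h)
      have h6 : p.val ≠ q₀.val := fun h => hpq₀ (Fin.ext h)
      have h7 : p₀.val ≠ q.val := fun h => hp₀q (Fin.ext h)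
      rcases lt_or_gt_of_ne h5 with hlt | hlt
      · exact h.far p p₀ (by omega) (by omega)
      · exact (h.far p₀ p (by omega) (by omega)).symm
    rw [← ih _ (hn ▸ he.weight_push_lt) _ _ _ he' rfl, ← ih _ (hn ▸ hc.weight_push_lt) _ _ _ hc' rfl,
      hpush]
    have h1 : h.restr D * Y p * (h.restr (push D p q) * Y p₀) = h.restr D * (Y p * Y p₀) := by
      rw [h.restr_mul_y he, mul_assoc, ← mul_assoc (h.restr _), h.restr_mul_self,
        ← mul_assoc, ← h.restr_mul_y he, mul_assoc]
    have h2 : h.restr D * Y p₀ * (h.restr (push D p₀ q₀) * Y p) = h.restr D * (Y p₀ * Y p) := by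
      rw [h.restr_mul_y hc, mul_assoc, ← mul_assoc (h.restr _), h.restr_mul_self,
        ← mul_assoc, ← h.restr_mul_y hc, mul_assoc]
    rw [← mul_assoc (h.restr D * Y p) (h.restr (push D p q) * Y p₀), h1,
      ← mul_assoc (h.restr D * Y p₀) (h.restr (push D p₀ q₀) * Y p), h2, hYY]

/-! ### Elements compatible with the idempotents and the paths -/

/-- The element `c` moves the idempotents `ε p` as the partial permutation `θ` moves the points. -/
structure Follows (ε : Fin k → N) (θ : Fin k ≃. Fin k) (c : N) : Prop where
  left_none : ∀ p, θ p = none → ε p * c = c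
  left_some : ∀ p q, θ p = some q → ε p * c = c * ε q
  right_none : ∀ q, θ.symm q = none → c * ε q = c

omit h in
theorem Follows.one : Follows ε 1 (1 : N) where
  left_none p hp := by simp [one_apply] at hp
  left_some p q hpq := by
    rw [one_apply] at hpq
    obtain rfl := Option.some.inj hpq
    rw [mul_one, one_mul]
  right_none q hq := by
    change (1 : Fin k ≃. Fin k) q = none at hq
    simp [one_apply] at hq

omit h in
theorem Follows.mul {θ θ' : Fin k ≃. Fin k} {c c' : N} (hc : Follows ε θ c)
    (hc' : Follows ε θ' c') : Follows ε (θ * θ') (c * c') where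
  left_none p hp := by
    rcases mul_eq_none.1 hp with h | ⟨q, h, h'⟩
    · rw [← mul_assoc, hc.left_none p h]
    · rw [← mul_assoc, hc.left_some p q h, mul_assoc, hc'.left_none q h']
  left_some p r hpr := by
    obtain ⟨q, h, h'⟩ := mul_eq_some.1 hpr
    rw [← mul_assoc, hc.left_some p q h, mul_assoc, hc'.left_some q r h', mul_assoc]
  right_none q hq := by
    rw [symm_mul] at hq
    rcases mul_eq_none.1 hq with h | ⟨p, h, h'⟩
    · rw [mul_assoc, hc'.right_none q h]
    · rw [mul_assoc, ← hc'.left_some p q ((PEquiv.eq_some_iff θ').1 h), ← mul_assoc,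
        hc.right_none p h']

/-- A point `q` outside the image of `D` either has no preimage under `θ`, so that `c` absorbs `ε
q`, or has a preimage `p ∉ D`, and then the factor `ε p` of `restr D` crosses `c` as `ε q`. -/
theorem restr_mul_restr_pimage {θ : Fin k ≃. Fin k} {c : N} (hc : Follows ε θ c)
    (D : Finset (Fin k)) : h.restr D * c * h.restr (pimage θ D) = h.restr D * c := by
  refine h.mul_restr_eq fun q hq => ?_
  cases hp : θ.symm q with
  | none => rw [mul_assoc, hc.right_none q hp]
  | some p =>
    have hp' := (PEquiv.eq_some_iff θ).1 hp
    have hpD : p ∉ D := fun h => hq (mem_pimage.2 ⟨p, h, hp'⟩)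
    rw [mul_assoc, ← hc.left_some p q hp', ← mul_assoc, h.restr_mul_ε hpD]

/-- The element `c` follows `θ`, and moves the paths to upper subsets accordingly. -/
structure Good (θ : Fin k ≃. Fin k) (c : N) : Prop where
  follows : Follows ε θ c
  path : ∀ D : Finset (Fin k), (∀ p ∈ D, θ p ≠ none) →
    h.restr D * c * h.climb (pimage θ D) = h.climb D

theorem good_one : h.Good 1 1 where
  follows := Follows.one
  path D _ := by
    have : pimage 1 D = D := by
      ext q
      simp [mem_pimage, one_apply]
    rw [this, mul_one, h.restr_mul_climb]

theorem good_mul {θ θ' : Fin k ≃. Fin k} {c c' : N} (hc : h.Good θ c) (hc' : h.Good θ' c') :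
    h.Good (θ * θ') (c * c') where
  follows := hc.follows.mul hc'.follows
  path D hD := by
    have h1 : pimage (θ * θ') D = pimage θ' (pimage θ D) := by
      ext r
      simp only [mem_pimage, mul_eq_some]
      constructor
      · rintro ⟨p, hp, q, hq, hr⟩
        exact ⟨q, ⟨p, hp, hq⟩, hr⟩
      · rintro ⟨q, ⟨p, hp, hq⟩, hr⟩
        exact ⟨p, hp, q, hq, hr⟩
    have h2 : ∀ p ∈ D, θ p ≠ none := fun p hp h0 => hD p hp (mul_eq_none.2 (Or.inl h0))
    have h3 : ∀ q ∈ pimage θ D, θ' q ≠ none := by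
      intro q hq h0
      obtain ⟨p, hp, hpq⟩ := mem_pimage.1 hq
      exact hD p hp (mul_eq_none.2 (Or.inr ⟨q, hpq, h0⟩))
    rw [h1, ← mul_assoc, ← h.restr_mul_restr_pimage hc.follows D, mul_assoc, mul_assoc,
      ← mul_assoc (h.restr (pimage θ D)), hc'.path _ h3, hc.path D h2]

/-- An element that follows a partial permutation with the path property is determined by this
partial permutation. -/
theorem good_unique {θ : Fin k ≃. Fin k} {c c' : N} (hc : h.Good θ c) (hc' : h.Good θ c') :
    c = c' := by
  classical
  let D : Finset (Fin k) := Finset.univ.filter fun p => θ p ≠ none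
  have hD : ∀ p ∈ D, θ p ≠ none := fun p hp => (Finset.mem_filter.1 hp).2
  -- Here `D` is the domain of `θ`, and `t` leads from the top back down to the image. Both are
  -- determined before `c` is considered, so `climb D * t` is a formula valid for every good `c`.
  obtain ⟨t, ht⟩ := h.exists_climb_mul (pimage θ D)
  have key : ∀ c, h.Good θ c → c = h.climb D * t := by
    intro c hc
    have h1 : h.restr D * c = c := h.restr_mul_eq fun p hp => by
      refine hc.follows.left_none p ?_
      by_contra h0
      exact hp (Finset.mem_filter.2 ⟨Finset.mem_univ _, h0⟩)
    rw [← hc.path D hD, mul_assoc, ht, h.restr_mul_restr_pimage hc.follows, h1]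
  rw [key c hc, key c' hc']

/-- `θ` moves `p` to `q`, is undefined at `q`, and fixes the other points. -/
structure IsStep (θ : Fin k ≃. Fin k) (p q : Fin k) : Prop where
  next : p.val + 1 = q.val
  apply_left : θ p = some q
  apply_right : θ q = none
  apply_of_ne : ∀ r, r ≠ p → r ≠ q → θ r = some r

omit h in
theorem IsStep.ne {θ : Fin k ≃. Fin k} {p q : Fin k} (hθ : IsStep θ p q) : p ≠ q := by
  rintro rfl
  have := hθ.next
  omega

omit h in
theorem IsStep.symm_apply_left {θ : Fin k ≃. Fin k} {p q : Fin k} (hθ : IsStep θ p q) :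
    θ.symm p = none := by
  cases hr : θ.symm p with
  | none => rfl
  | some r =>
    have h1 := (PEquiv.eq_some_iff θ).1 hr
    by_cases hrp : r = p
    · subst hrp
      rw [hθ.apply_left] at h1
      exact absurd (Option.some.inj h1).symm hθ.ne
    by_cases hrq : r = q
    · subst hrq
      rw [hθ.apply_right] at h1
      exact absurd h1 (by simp)
    rw [hθ.apply_of_ne r hrp hrq] at h1
    exact absurd (Option.some.inj h1) hrp

/-- In the path condition `q ∉ D`, as `θ` is undefined there. If `p ∈ D`, the step begins a path and
path independence applies; if `p ∉ D`, then `θ` fixes `D` pointwise and `restr D` absorbs `Y p`. -/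
theorem good_y {θ : Fin k ≃. Fin k} {p q : Fin k} (hθ : IsStep θ p q) : h.Good θ (Y p) where
  follows := by
    have hpq := hθ.next
    refine ⟨fun r hr => ?_, fun r r' hr => ?_, fun r hr => ?_⟩
    · by_cases hrp : r = p
      · rw [hrp, hθ.apply_left] at hr; simp at hr
      by_cases hrq : r = q
      · rw [hrq, h.ε_y p q hpq]
      · rw [hθ.apply_of_ne r hrp hrq] at hr; simp at hr
    · by_cases hrp : r = p
      · rw [hrp, hθ.apply_left] at hr
        rw [hrp, ← Option.some.inj hr, h.ε_y_self p q hpq]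
      by_cases hrq : r = q
      · rw [hrq, hθ.apply_right] at hr; simp at hr
      · rw [hθ.apply_of_ne r hrp hrq] at hr
        rw [← Option.some.inj hr, h.y_comm p q r hpq hrp hrq]
    · by_cases hrp : r = p
      · rw [hrp, h.y_ε p q hpq]
      by_cases hrq : r = q
      · rw [hrq, (PEquiv.eq_some_iff θ).2 hθ.apply_left] at hr; simp at hr
      · rw [(PEquiv.eq_some_iff θ).2 (hθ.apply_of_ne r hrp hrq)] at hr; simp at hr
  path D hD := by
    have hq : q ∉ D := fun hq => hD q hq hθ.apply_right
    by_cases hp : p ∈ D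
    · have h1 : pimage θ D = push D p q := by
        ext r
        simp only [mem_pimage, push, Finset.mem_insert, Finset.mem_erase]
        constructor
        · rintro ⟨s, hs, hsr⟩
          by_cases hsp : s = p
          · rw [hsp, hθ.apply_left] at hsr
            exact Or.inl (Option.some.inj hsr).symm
          · rw [hθ.apply_of_ne s hsp (fun h => hq (h ▸ hs))] at hsr
            rw [← Option.some.inj hsr]
            exact Or.inr ⟨hsp, hs⟩
        · rintro (rfl | ⟨hrp, hr⟩)
          · exact ⟨p, hp, hθ.apply_left⟩
          · exact ⟨r, hr, hθ.apply_of_ne r hrp (fun h => hq (h ▸ hr))⟩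
      rw [h1, h.restr_mul_y_mul_climb D p q ⟨hp, hq, hθ.next⟩]
    · have h1 : pimage θ D = D := by
        ext r
        simp only [mem_pimage]
        have : ∀ s ∈ D, θ s = some s := fun s hs =>
          hθ.apply_of_ne s (fun h => hp (h ▸ hs)) (fun h => hq (h ▸ hs))
        constructor
        · rintro ⟨s, hs, hsr⟩
          rw [this s hs] at hsr
          rwa [← Option.some.inj hsr]
        · intro hr
          exact ⟨r, hr, this r hr⟩
      rw [h1, h.restr_mul_y_of_notMem hp hq hθ.next, h.restr_mul_climb]

theorem good_z {θ : Fin k ≃. Fin k} {p q : Fin k} (hθ : IsStep θ p q) : h.Good θ.symm (Z p) := by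
  have hpq := hθ.next
  have hright : θ.symm q = some p := (PEquiv.eq_some_iff θ).2 hθ.apply_left
  have hother : ∀ r, r ≠ p → r ≠ q → θ.symm r = some r := fun r hrp hrq =>
    (PEquiv.eq_some_iff θ).2 (hθ.apply_of_ne r hrp hrq)
  have hf : Follows ε θ.symm (Z p) := by
    refine ⟨fun r hr => ?_, fun r r' hr => ?_, fun r hr => ?_⟩
    · by_cases hrp : r = p
      · rw [hrp, h.ε_z p q hpq]
      by_cases hrq : r = q
      · rw [hrq, hright] at hr; simp at hr
      · rw [hother r hrp hrq] at hr; simp at hr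
    · by_cases hrp : r = p
      · rw [hrp, hθ.symm_apply_left] at hr; simp at hr
      by_cases hrq : r = q
      · rw [hrq, hright] at hr
        rw [hrq, ← Option.some.inj hr]
        -- The only case of `Follows` for `Z p` that is not part of `EdgeRel`; it comes from
        -- `ε_y_self` by multiplying with `Z p` on both sides.
        calc ε q * Z p = ε p * ε q * Z p := by rw [h.comm p q, mul_assoc, h.ε_z p q hpq]
          _ = Z p * (ε p * (Y p * Z p)) := by
            rw [← mul_assoc (ε p), h.ε_y_self p q hpq, ← mul_assoc, ← mul_assoc, h.z_y p q hpq]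
          _ = Z p * ε p := by rw [h.y_z p q hpq, h.comm p q, ← mul_assoc, h.z_ε p q hpq]
      · rw [hother r hrp hrq] at hr
        rw [← Option.some.inj hr, h.z_comm p q r hpq hrp hrq]
    · rw [PEquiv.symm_symm] at hr
      by_cases hrp : r = p
      · rw [hrp, hθ.apply_left] at hr; simp at hr
      by_cases hrq : r = q
      · rw [hrq, h.z_ε p q hpq]
      · rw [hθ.apply_of_ne r hrp hrq] at hr; simp at hr
  refine ⟨hf, fun D hD => ?_⟩
  have hp : p ∉ D := fun hp => hD p hp hθ.symm_apply_left
  by_cases hq : q ∈ D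
  · have h1 : IsEdge (pimage θ.symm D) p q := by
      refine ⟨mem_pimage.2 ⟨q, hq, hright⟩, fun h0 => ?_, hpq⟩
      obtain ⟨r, hr, hrq⟩ := mem_pimage.1 h0
      have := (PEquiv.eq_some_iff θ).1 hrq
      rw [hθ.apply_right] at this
      simp at this
    have h2 : push (pimage θ.symm D) p q = D := by
      ext r
      simp only [push, Finset.mem_insert, Finset.mem_erase, mem_pimage]
      constructor
      · rintro (rfl | ⟨hrp, s, hs, hsr⟩)
        · exact hq
        · by_cases hsq : s = q
          · rw [hsq, hright] at hsr
            exact absurd (Option.some.inj hsr).symm hrp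
          · rw [hother s (fun h => hp (h ▸ hs)) hsq] at hsr
            rwa [← Option.some.inj hsr]
      · intro hr
        by_cases hrq : r = q
        · exact Or.inl hrq
        · have hrp : r ≠ p := fun h => hp (h ▸ hr)
          exact Or.inr ⟨hrp, r, hr, hother r hrp hrq⟩
    -- The image of `D` can climb by first stepping back from `p` to `q`. This `Y p` cancels the
    -- preceding `Z p` up to `ε p`, which is absorbed because `p ∉ D`.
    rw [← h.restr_mul_y_mul_climb _ p q h1, h2, ← mul_assoc, ← mul_assoc,
      h.restr_mul_restr_pimage hf, mul_assoc (h.restr D), h.z_y p q hpq, h.restr_mul_ε hp,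
      h.restr_mul_climb]
  · have h1 : pimage θ.symm D = D := by
      ext r
      simp only [mem_pimage]
      have : ∀ s ∈ D, θ.symm s = some s := fun s hs =>
        hother s (fun h => hp (h ▸ hs)) (fun h => hq (h ▸ hs))
      constructor
      · rintro ⟨s, hs, hsr⟩
        rw [this s hs] at hsr
        rwa [← Option.some.inj hsr]
      · intro hr
        exact ⟨r, hr, this r hr⟩
    rw [h1, h.restr_mul_z_of_notMem hp hq hpq, h.restr_mul_climb]

end EdgeRel

end POIPresentation

namespace POIPresentation

/-! ### The generators satisfy the relations of order preserving partial permutations -/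

/-- The action of a partial permutation of `Fin k` on labels: the label of `p` is `k - 1 - p`, and
`k` stands for undefined. -/
def labelFun {k : ℕ} (θ : Fin k ≃. Fin k) (l : ℕ) : ℕ :=
  if h : l < k then (θ ⟨k - 1 - l, by omega⟩).elim k fun q => k - 1 - q.val else l

theorem labelFun_one {k : ℕ} (l : ℕ) : labelFun (1 : Fin k ≃. Fin k) l = l := by
  rw [labelFun]
  split_ifs with h
  · rw [one_apply, Option.elim_some]
    simp only
    omega
  · rfl

/-- All numbers from `k` on are fixed, so being undefined propagates through products. Identities of
partial permutations thereby become identities of total functions on `ℕ`, checked by case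
distinction. -/
theorem labelFun_mul {k : ℕ} (θ θ' : Fin k ≃. Fin k) (l : ℕ) :
    labelFun (θ * θ') l = labelFun θ' (labelFun θ l) := by
  by_cases h : l < k
  · have h1 : labelFun θ l = (θ ⟨k - 1 - l, by omega⟩).elim k fun q => k - 1 - q.val := dif_pos h
    have h2 : labelFun (θ * θ') l =
      ((θ ⟨k - 1 - l, by omega⟩).bind θ').elim k fun q => k - 1 - q.val := dif_pos h
    rw [h1, h2]
    cases θ ⟨k - 1 - l, by omega⟩ with
    | none => simp [labelFun]
    | some q =>
      have h3 : (⟨k - 1 - (k - 1 - q.val), by omega⟩ : Fin k) = q := Fin.ext (by simp; omega)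
      simp only [Option.elim_some, Option.bind_some]
      rw [labelFun, dif_pos (by omega), h3]
  · simp [labelFun, h]

theorem labelFun_injective {k : ℕ} {θ θ' : Fin k ≃. Fin k} (h : ∀ l, labelFun θ l = labelFun θ' l) :
    θ = θ' := by
  ext1 p
  have h1 := h (k - 1 - p.val)
  have h3 : (⟨k - 1 - (k - 1 - p.val), by omega⟩ : Fin k) = p := Fin.ext (by simp; omega)
  rw [labelFun, labelFun, dif_pos (by omega), dif_pos (by omega), h3] at h1
  cases hp : θ p with
  | none =>
    cases hp' : θ' p with
    | none => rfl
    | some q => rw [hp, hp'] at h1; simp at h1; omega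
  | some q =>
    cases hp' : θ' p with
    | none => rw [hp, hp'] at h1; simp at h1; omega
    | some q' => rw [hp, hp'] at h1; simp at h1; congr 1; ext; omega

/-- The generator `x_i` of the monoid of order preserving partial permutations of `Fin k`. -/
def xGen (k : ℕ) (i : ℕ) : Fin k ≃. Fin k := if h : i < k then xPoint k ⟨i, h⟩ else 1

theorem xGen_of_lt {k i : ℕ} (h : i < k) : xGen k i = xPoint k ⟨i, h⟩ := dif_pos h

theorem labelFun_xGen_zero {k : ℕ} (hk : 0 < k) (l : ℕ) :
    labelFun (xGen k 0) l = if k ≤ l then l else l + 1 := by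
  rw [xGen_of_lt hk, labelFun]
  by_cases h : l < k
  · rw [dif_pos h, if_neg (by omega)]
    change Option.elim (dite _ _ _) _ _ = _
    split_ifs with h1 <;> simp at * <;> omega
  · rw [dif_neg h, if_pos (by omega)]

theorem labelFun_xGen {k i : ℕ} (hi : 1 ≤ i) (hk : i < k) (l : ℕ) :
    labelFun (xGen k i) l = if k ≤ l then l else if l = i then i - 1 else
      if l + 1 = i then k else l := by
  rw [xGen_of_lt hk, labelFun]
  by_cases h : l < k
  · rw [dif_pos h, if_neg (by omega)]
    change Option.elim (dite _ _ _) _ _ = _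
    rw [dif_neg (by simp; omega)]
    simp only
    split_ifs <;> simp <;> omega
  · rw [dif_neg h, if_pos (by omega)]

theorem labelFun_prefix {k : ℕ} (i : ℕ) (hi : 1 ≤ i) (hik : i ≤ k) (l : ℕ) :
    labelFun (icoProd (xGen k) 0 i) l = if k ≤ l then l else if l + 1 < i then l else l + 1 := by
  induction i, hi using Nat.le_induction with
  | base =>
    rw [icoProd_succ _ le_rfl, icoProd_self, one_mul, labelFun_xGen_zero hik]
    simp
  | succ i hi ih =>
    rw [icoProd_succ _ (Nat.zero_le i), labelFun_mul, ih (by omega), labelFun_xGen hi (by omega)]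
    split_ifs <;> omega

/-- The inner case `i = k` is the empty product, which is defined everywhere. -/
theorem labelFun_suffix {k : ℕ} (d i : ℕ) (hd : i + d = k) (hi : 1 ≤ i) (l : ℕ) :
    labelFun (icoProd (xGen k) i k) l = if k ≤ l then l else if l + 1 < i then l else
      if l + 1 = i then (if i = k then l else k) else l - 1 := by
  induction d generalizing i l with
  | zero =>
    obtain rfl : i = k := hd
    rw [icoProd_self, labelFun_one]
    split_ifs <;> omega
  | succ d ih =>
    rw [icoProd_eq_cons _ (by omega), labelFun_mul, ih (i + 1) (by omega) (by omega),
      labelFun_xGen hi (by omega)]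
    split_ifs <;> omega

theorem xGen_shift {k i : ℕ} (h1 : 1 ≤ i) (h2 : i + 2 ≤ k) :
    xGen k i * xGen k 0 = xGen k 0 * xGen k (i + 1) := labelFun_injective fun l => by
  simp only [labelFun_mul, labelFun_xGen_zero (show 0 < k by omega),
    labelFun_xGen h1 (show i < k by omega),
    labelFun_xGen (show 1 ≤ i + 1 by omega) (show i + 1 < k by omega)]
  split_ifs <;> omega

theorem xGen_far {k i j : ℕ} (h1 : 1 ≤ i) (h2 : i + 1 < j) (h3 : j + 1 ≤ k) :
    xGen k j * xGen k i = xGen k i * xGen k j := labelFun_injective fun l => by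
  simp only [labelFun_mul, labelFun_xGen h1 (show i < k by omega),
    labelFun_xGen (show 1 ≤ j by omega) (show j < k by omega)]
  split_ifs <;> omega

theorem xGen_zero_one {k : ℕ} (hk : 2 ≤ k) :
    xGen k 0 * xGen k 0 * xGen k 1 = xGen k 0 * xGen k 0 := labelFun_injective fun l => by
  simp only [labelFun_mul, labelFun_xGen_zero (show 0 < k by omega),
    labelFun_xGen le_rfl (show 1 < k by omega)]
  split_ifs <;> omega

theorem xGen_last_zero {k : ℕ} (hk : 2 ≤ k) :
    xGen k (k - 1) * (xGen k 0 * xGen k 0) = xGen k 0 * xGen k 0 := labelFun_injective fun l => by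
  simp only [labelFun_mul, labelFun_xGen_zero (show 0 < k by omega),
    labelFun_xGen (show 1 ≤ k - 1 by omega) (show k - 1 < k by omega)]
  split_ifs <;> omega

theorem xGen_near {k i : ℕ} (h1 : 1 ≤ i) (h2 : i + 2 ≤ k) :
    xGen k (i + 1) * xGen k i * xGen k (i + 1) = xGen k (i + 1) * xGen k i :=
  labelFun_injective fun l => by
    have e := labelFun_xGen h1 (show i < k by omega)
    have e' := labelFun_xGen (show 1 ≤ i + 1 by omega) (show i + 1 < k by omega)
    simp only [labelFun_mul]
    rw [e' l]
    split_ifs <;> simp only [e, e'] <;> split_ifs <;> omega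

theorem xGen_near' {k i : ℕ} (h1 : 1 ≤ i) (h2 : i + 2 ≤ k) :
    xGen k i * xGen k (i + 1) * xGen k i = xGen k (i + 1) * xGen k i :=
  labelFun_injective fun l => by
    have e := labelFun_xGen h1 (show i < k by omega)
    have e' := labelFun_xGen (show 1 ≤ i + 1 by omega) (show i + 1 < k by omega)
    simp only [labelFun_mul]
    rw [e l, e' l]
    split_ifs <;> simp only [e, e'] <;> split_ifs <;> omega

theorem xGen_regular {k i : ℕ} (h1 : i + 1 ≤ k) :
    icoProd (xGen k) i k * icoProd (xGen k) 0 i * xGen k i = xGen k i :=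
  labelFun_injective fun l => by
    rcases Nat.eq_zero_or_pos i with rfl | hi
    · simp only [icoProd_self, mul_one, labelFun_mul, labelFun_prefix k (show 1 ≤ k by omega) le_rfl,
        labelFun_xGen_zero (show 0 < k by omega)]
      split_ifs <;> omega
    · simp only [labelFun_mul]
      have a₁ := labelFun_suffix (k := k) (k - i) i (by omega) hi l
      generalize labelFun (icoProd (xGen k) i k) l = c₁ at a₁ ⊢
      have a₂ := labelFun_prefix i hi (show i ≤ k by omega) c₁
      generalize labelFun (icoProd (xGen k) 0 i) c₁ = c₂ at a₂ ⊢
      rw [labelFun_xGen hi (show i < k by omega) c₂, labelFun_xGen hi (show i < k by omega) l]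
      split_ifs at a₁ <;> split_ifs at a₂ <;> (try omega) <;> split_ifs <;> omega

theorem labelFun_z {k i : ℕ} (h1 : 1 ≤ i) (h2 : i + 1 ≤ k) (l : ℕ) :
    labelFun (WRel.z k (xGen k) i) l = if k ≤ l then l else if l + 1 = i then i else
      if l = i then k else l := by
  rw [WRel.z, labelFun_mul]
  have a₁ := labelFun_suffix (k := k) (k - (i + 1)) (i + 1) (by omega) (by omega) l
  generalize labelFun (icoProd (xGen k) (i + 1) k) l = c₁ at a₁ ⊢
  rw [labelFun_prefix i h1 (show i ≤ k by omega) c₁]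
  split_ifs at a₁ <;> split_ifs <;> omega

theorem xGen_square {k i : ℕ} (h1 : 1 ≤ i) (h2 : i + 1 ≤ k) :
    icoProd (xGen k) (i + 1) k * icoProd (xGen k) 0 i * (xGen k i * xGen k i) =
      xGen k i * xGen k i :=
  labelFun_injective fun l => by
    rw [← WRel.z]
    simp only [labelFun_mul]
    have e := labelFun_xGen h1 (show i < k by omega)
    rw [labelFun_z h1 h2, e l]
    split_ifs <;> simp only [e] <;> split_ifs <;> omega

theorem wRel_xGen {k : ℕ} (hk : 2 ≤ k) : WRel k (xGen k) where
  shift _ := xGen_shift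
  far _ _ := xGen_far
  zero_one := xGen_zero_one hk
  last_zero := xGen_last_zero hk
  near _ := xGen_near
  near' _ := xGen_near'
  regular _ := xGen_regular
  square _ := xGen_square

/-- Inverses are unique in the symmetric inverse monoid; this identifies the words `z i` with the
true inverses of the generators. -/
theorem eq_symm_of_mul_mul {Ω : Type*} {θ θ' : Ω ≃. Ω} (h : θ * θ' * θ = θ) (h' : θ' * θ * θ' = θ') :
    θ' = θ.symm := by
  have key : ∀ {θ θ' : Ω ≃. Ω}, θ * θ' * θ = θ → ∀ p q, θ p = some q → θ' q = some p := by
    intro θ θ' h p q hpq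
    rw [← h] at hpq
    obtain ⟨r, hr, hrq⟩ := mul_eq_some.1 hpq
    obtain ⟨q', hq', hr'⟩ := mul_eq_some.1 hr
    have h1 : θ p = some q := by rw [← h]; exact hpq
    have h2 : q' = q := Option.some.inj (hq'.symm.trans h1)
    have h3 : r = p := θ.inj hrq h1
    rw [← h2, hr', h3]
  ext q p
  rw [PEquiv.eq_some_iff]
  exact ⟨key h' q p, key h p q⟩

theorem xGen_isStep {k i : ℕ} (hi : 1 ≤ i) (hik : i < k) :
    EdgeRel.IsStep (xGen k i) ⟨k - 1 - i, by omega⟩ ⟨k - i, by omega⟩ := by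
  rw [xGen_of_lt hik]
  refine ⟨by simp only; omega, ?_, ?_, ?_⟩
  · change dite _ _ _ = _
    rw [dif_neg (by simp only; omega), if_neg (by simp only; omega), dif_pos (by simp only; omega)]
    congr 2
    simp only
    omega
  · change dite _ _ _ = _
    rw [dif_neg (by simp only; omega), if_pos (by simp only; omega)]
  · intro r h1 h2
    have h1 := Fin.val_ne_of_ne h1
    have h2 := Fin.val_ne_of_ne h2
    simp only at h1 h2
    change dite _ _ _ = _
    rw [dif_neg (by simp only; omega), if_neg (by simp only; omega), dif_neg (by simp only; omega)]

namespace WRel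

variable {N : Type*} [Monoid N] {k : ℕ} {x : ℕ → N}

theorem symm_xGen {i : ℕ} (hk : i + 1 < k) : z k (xGen k) (i + 1) = (xGen k (i + 1)).symm := by
  have h := wRel_xGen (show 2 ≤ k by omega)
  refine eq_symm_of_mul_mul ?_ ?_
  · rw [x_mul_z hk, h.e_mul_x hk]
  · rw [z_mul_x, h.e_mul_z hk]

/-- Passing from labels to points reverses the order, so that lowering a label moves a point up. At
the last point `Y` is `x 0`, which is not a step; the conditions `p + 1 = q` and, in `far`, `p' + 1
< k` keep it out of all relations. -/
theorem edgeRel (h : WRel k x) : EdgeRel (fun p : Fin k => e k x (k - 1 - p.val))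
    (fun p => x (k - 1 - p.val)) (fun p => z k x (k - 1 - p.val)) := by
  have key : ∀ p q : Fin k, p.val + 1 = q.val → k - 1 - p.val = k - 1 - q.val + 1 := by
    intro p q hpq
    have := q.isLt
    omega
  have hlt : ∀ p q : Fin k, p.val + 1 = q.val → k - 1 - q.val + 1 < k := by
    intro p q hpq
    have := q.isLt
    omega
  constructor
  · exact fun p => h.e_mul_self (by have := p.isLt; omega)
  · exact fun p q => h.e_comm (by have := p.isLt; omega) (by have := q.isLt; omega)
  · intro p q hpq
    simp only [key p q hpq]
    exact x_mul_z (hlt p q hpq)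
  · exact fun p q hpq => z_mul_x _
  · intro p q hpq
    simp only [key p q hpq]
    exact h.e_mul_x (hlt p q hpq)
  · intro p q hpq
    simp only [key p q hpq]
    exact h.x_mul_e (hlt p q hpq)
  · intro p q hpq
    simp only [key p q hpq]
    exact h.e_mul_z (hlt p q hpq)
  · intro p q hpq
    simp only [key p q hpq]
    exact h.z_mul_e (hlt p q hpq)
  · intro p q hpq
    simp only [key p q hpq]
    exact h.e_mul_x_self (hlt p q hpq)
  · intro p q hpq
    simp only [key p q hpq]
    exact h.e_mul_e_mul_x (hlt p q hpq)
  · intro p q r hpq h1 h2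
    have h1 := Fin.val_ne_of_ne h1
    have h2 := Fin.val_ne_of_ne h2
    have := r.isLt
    have := q.isLt
    exact h.x_comm_e (by omega) (by omega) (by omega) (by omega) (by omega)
  · intro p q r hpq h1 h2
    have h1 := Fin.val_ne_of_ne h1
    have h2 := Fin.val_ne_of_ne h2
    have := r.isLt
    have := q.isLt
    simp only [key p q hpq]
    exact h.z_comm_e (by omega) (by omega) (by omega) (by omega)
  · intro p q h1 h2
    exact h.far _ _ (by omega) (by omega) (by omega)

theorem good_x (h : WRel k x) {i : ℕ} (hi : 1 ≤ i) (hik : i < k) :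
    h.edgeRel.Good (xGen k i) (x i) := by
  have := h.edgeRel.good_y (xGen_isStep hi hik)
  simpa only [show k - 1 - (k - 1 - i) = i by omega] using this

theorem good_z (h : WRel k x) {i : ℕ} (hi : 1 ≤ i) (hik : i < k) :
    h.edgeRel.Good (z k (xGen k) i) (z k x i) := by
  have := h.edgeRel.good_z (xGen_isStep hi hik)
  obtain ⟨i, rfl⟩ : ∃ j, i = j + 1 := ⟨i - 1, by omega⟩
  rw [symm_xGen hik]
  simpa only [show k - 1 - (k - 1 - (i + 1)) = i + 1 by omega] using this

/-- Since `x 0` is not a step, it is reached by descending induction on the length of the prefix `x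
0 * ⋯ * x (i - 1)`. The full prefix is `z (k - 1) * x (k - 1)`, and each multiplication by some `z
i` removes a factor. -/
theorem good_prefix (h : WRel k x) (hk : 2 ≤ k) (d i : ℕ) (hd : i + d = k) (hi : 1 ≤ i) :
    h.edgeRel.Good (icoProd (xGen k) 0 i) (icoProd x 0 i) := by
  induction d generalizing i with
  | zero =>
    obtain rfl : i = k := hd
    obtain ⟨n, rfl⟩ : ∃ n, i = n + 2 := ⟨i - 2, by omega⟩
    have key : ∀ {N : Type _} [Monoid N] (x : ℕ → N), icoProd x 0 (n + 2) =
        z (n + 2) x (n + 1) * x (n + 1) := by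
      intro N _ x
      rw [z_mul_x, e, icoProd_self, one_mul]
    have key' : icoProd (xGen (n + 2)) 0 (n + 2) =
        z (n + 2) (xGen (n + 2)) (n + 1) * xGen (n + 2) (n + 1) := by
      rw [z_mul_x, e, icoProd_self, one_mul]
    rw [key x, key']
    exact h.edgeRel.good_mul (h.good_z (by omega) (by omega)) (h.good_x (by omega) (by omega))
  | succ d ih =>
    rw [← h.icoProd_mul_z hi (by omega), ← (wRel_xGen hk).icoProd_mul_z hi (by omega)]
    exact h.edgeRel.good_mul (ih (i + 1) (by omega) (by omega)) (h.good_z hi (by omega))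

theorem good_gen (h : WRel k x) (hk : 2 ≤ k) {i : ℕ} (hik : i < k) :
    h.edgeRel.Good (xGen k i) (x i) := by
  rcases Nat.eq_zero_or_pos i with rfl | hi
  · have := h.good_prefix hk (k - 1) 1 (by omega) le_rfl
    simpa only [icoProd_succ _ le_rfl, icoProd_self, one_mul] using this
  · exact h.good_x hi hik

/-- Two words in the letters `x_i` that represent the same partial permutation of `Fin k` have the
same value under every interpretation satisfying the relations. -/
theorem lift_eq_of_lift_eq (h : WRel k x) (hk : 2 ≤ k) (w w' : FreeMonoid (Fin k))
    (hw : FreeMonoid.lift (xPoint k) w = FreeMonoid.lift (xPoint k) w') :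
    FreeMonoid.lift (fun i : Fin k => x i) w = FreeMonoid.lift (fun i : Fin k => x i) w' := by
  have key : ∀ w : FreeMonoid (Fin k),
      h.edgeRel.Good (FreeMonoid.lift (xPoint k) w) (FreeMonoid.lift (fun i : Fin k => x i) w) := by
    intro w
    induction w using FreeMonoid.inductionOn' with
    | one => simpa using h.edgeRel.good_one
    | of_mul i w ih =>
      rw [map_mul, map_mul, FreeMonoid.lift_eval_of, FreeMonoid.lift_eval_of]
      have := h.good_gen hk i.isLt
      rw [xGen_of_lt i.isLt] at this
      exact h.edgeRel.good_mul this ih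
  have h1 := key w
  rw [hw] at h1
  exact h.edgeRel.good_unique h1 (key w')

end WRel

end POIPresentation

namespace POIPresentation

/-! ### Generation of the monoid of order preserving partial permutations -/

theorem OrderPreserving.symm {k : ℕ} {θ : Fin k ≃. Fin k} (h : OrderPreserving id θ) :
    OrderPreserving id θ.symm := by
  intro x y x' y' hx hy hxy
  have hx' := (PEquiv.eq_some_iff θ).1 hx
  have hy' := (PEquiv.eq_some_iff θ).1 hy
  by_contra hlt
  have h1 : y ≤ x := h y' x' y x hy' hx' (not_le.1 hlt).le
  have h2 : x = y := le_antisymm hxy h1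
  subst h2
  exact hlt (le_of_eq (θ.inj hx' hy'))

theorem OrderPreserving.mul {k : ℕ} {θ θ' : Fin k ≃. Fin k} (h : OrderPreserving id θ)
    (h' : OrderPreserving id θ') : OrderPreserving id (θ * θ') := by
  intro x y x' y' hx hy hxy
  obtain ⟨u, hu, hu'⟩ := mul_eq_some.1 hx
  obtain ⟨v, hv, hv'⟩ := mul_eq_some.1 hy
  exact h' u v x' y' hu' hv' (h x y u v hu hv hxy)

theorem orderPreserving_xPoint (k : ℕ) (i : Fin k) : OrderPreserving id (xPoint k i) := by
  intro x y x' y' hx hy hxy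
  change dite _ _ _ = _ at hx hy
  simp only [id, Fin.le_def] at hxy ⊢
  split_ifs at hx hy <;> simp only [Option.some.injEq, Fin.ext_iff] at hx hy <;> omega

/-- The submonoid generated by the generators `x_i`. -/
def xRange (k : ℕ) : Submonoid (Fin k ≃. Fin k) := MonoidHom.mrange (FreeMonoid.lift (xPoint k))

theorem xPoint_mem (k : ℕ) (i : Fin k) : xPoint k i ∈ xRange k :=
  ⟨FreeMonoid.of i, FreeMonoid.lift_eval_of _ _⟩

theorem xGen_mem {k i : ℕ} : xGen k i ∈ xRange k := by
  rw [xGen]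
  split_ifs
  · exact xPoint_mem k _
  · exact one_mem _

theorem icoProd_xGen_mem {k i j : ℕ} : icoProd (xGen k) i j ∈ xRange k := by
  refine Submonoid.list_prod_mem _ fun y hy => ?_
  obtain ⟨l, _, rfl⟩ := List.mem_map.1 hy
  exact xGen_mem

theorem orderPreserving_of_mem_xRange {k : ℕ} {θ : Fin k ≃. Fin k} (h : θ ∈ xRange k) :
    OrderPreserving id θ := by
  obtain ⟨w, rfl⟩ := h
  induction w using FreeMonoid.inductionOn' with
  | one =>
    intro x y x' y' hx hy hxy
    rw [map_one, one_apply] at hx hy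
    rwa [← Option.some.inj hx, ← Option.some.inj hy]
  | of_mul i w ih =>
    rw [map_mul, FreeMonoid.lift_eval_of]
    exact (orderPreserving_xPoint k i).mul ih

/-- The inverse of `x_0` is `x_1 ⋯ x_{k-1}`, that of any other `x_i` is the word `z i`. -/
theorem symm_xGen_mem {k i : ℕ} (hk : 2 ≤ k) (hi : i < k) : (xGen k i).symm ∈ xRange k := by
  have h := wRel_xGen hk
  rcases i with _ | i
  · have h0 := h.regular 0 (by omega)
    rw [icoProd_self, mul_one] at h0
    have h1 : icoProd (xGen k) 1 k = (xGen k 0).symm := by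
      refine eq_symm_of_mul_mul ?_ ?_
      · rw [← icoProd_eq_cons _ (by omega), h0]
      · have h2 : WRel.e k (xGen k) 0 = icoProd (xGen k) 1 k * xGen k 0 := by
          rw [WRel.e, icoProd_succ _ (Nat.zero_le 0), icoProd_self, one_mul]
        rw [← h2, icoProd_eq_cons _ (by omega), ← mul_assoc, h.e_mul_x (by omega)]
    rw [← h1]
    exact icoProd_xGen_mem
  · rw [← WRel.symm_xGen hi]
    exact mul_mem icoProd_xGen_mem icoProd_xGen_mem

theorem symm_mem_xRange {k : ℕ} (hk : 2 ≤ k) {θ : Fin k ≃. Fin k} (h : θ ∈ xRange k) :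
    θ.symm ∈ xRange k := by
  obtain ⟨w, rfl⟩ := h
  induction w using FreeMonoid.inductionOn' with
  | one => exact one_mem _
  | of_mul i w ih =>
    rw [map_mul, FreeMonoid.lift_eval_of, symm_mul, ← xGen_of_lt i.isLt]
    exact mul_mem ih (symm_xGen_mem hk i.isLt)

theorem mul_symm_self {Ω : Type*} (θ : Ω ≃. Ω) (p q : Ω) :
    (θ * θ.symm) p = some q ↔ p = q ∧ θ p ≠ none := by
  rw [mul_eq_some]
  constructor
  · rintro ⟨r, h, h'⟩
    have h' := (PEquiv.eq_some_iff θ).1 h'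
    exact ⟨θ.inj h h', by rw [h]; simp⟩
  · rintro ⟨rfl, h⟩
    obtain ⟨r, hr⟩ := Option.ne_none_iff_exists'.1 h
    exact ⟨r, hr, (PEquiv.eq_some_iff θ).2 hr⟩

theorem xPoint_eq_none_iff {k : ℕ} (i p : Fin k) :
    xPoint k i p = none ↔ (i.val = 0 ∧ p.val = 0) ∨ (i.val ≠ 0 ∧ p.val + i.val = k) := by
  change dite _ _ _ = _ ↔ _
  split_ifs <;> simp <;> omega

/-- Exactly one generator is undefined at `a` and nowhere else: `x_0` if `a` is the first point,
`x_{k-a}` in zero-based numbering otherwise. Its product with its inverse is the required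
idempotent. -/
theorem ofSet_ne_mem {k : ℕ} (hk : 2 ≤ k) (a : Fin k) {θ : Fin k ≃. Fin k}
    (hθ : ∀ p q, θ p = some q ↔ p = q ∧ p ≠ a) : θ ∈ xRange k := by
  have ha := a.isLt
  obtain ⟨i, hi⟩ : ∃ i : Fin k, ∀ p, xPoint k i p = none ↔ p = a := by
    by_cases h0 : a.val = 0
    · refine ⟨⟨0, by omega⟩, fun p => ?_⟩
      rw [xPoint_eq_none_iff, Fin.ext_iff, h0]
      simp
    · refine ⟨⟨k - a.val, by omega⟩, fun p => ?_⟩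
      rw [xPoint_eq_none_iff, Fin.ext_iff]
      simp only
      omega
  have : θ = xPoint k i * (xPoint k i).symm := by
    ext p q
    rw [hθ, mul_symm_self, Ne, Ne, hi]
  rw [this]
  exact mul_mem (xPoint_mem k i) (symm_mem_xRange hk (xPoint_mem k i))

theorem partial_id_mem {k : ℕ} (hk : 2 ≤ k) (D : Finset (Fin k)) {θ : Fin k ≃. Fin k}
    (hθ : ∀ p q, θ p = some q ↔ p = q ∧ p ∉ D) : θ ∈ xRange k := by
  induction D using Finset.induction_on generalizing θ with
  | empty =>
    have : θ = 1 := by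
      ext p q
      rw [hθ, one_apply]
      simp
    rw [this]
    exact one_mem _
  | insert a D ha ih =>
    have h1 : ∀ (s : Set (Fin k)) [DecidablePred (· ∈ s)] (p q : Fin k),
        PEquiv.ofSet s p = some q ↔ p = q ∧ p ∈ s := by
      intro s _ p q
      rw [PEquiv.ofSet_eq_some_iff]
      constructor
      · rintro ⟨rfl, h⟩; exact ⟨rfl, h⟩
      · rintro ⟨rfl, h⟩; exact ⟨rfl, h⟩
    have h2 : θ = PEquiv.ofSet {p | p ≠ a} * PEquiv.ofSet {p | p ∉ D} := by
      ext p q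
      rw [hθ, mul_eq_some]
      simp only [h1, Finset.mem_insert, not_or, Set.mem_ofPred_eq]
      constructor
      · rintro ⟨rfl, h, h'⟩; exact ⟨p, ⟨rfl, h⟩, rfl, h'⟩
      · rintro ⟨_, ⟨rfl, h⟩, rfl, h'⟩; exact ⟨rfl, h, h'⟩
    rw [h2]
    exact mul_mem (ofSet_ne_mem hk a fun p q => h1 _ p q) (ih fun p q => h1 _ p q)

/-- Generators push `D` along its edges until none is left, and a set without edges is closed
upwards. -/
theorem exists_mem_xRange_upper {k : ℕ} (hk : 2 ≤ k) (D : Finset (Fin k)) :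
    ∃ γ ∈ xRange k, (∀ p, γ p ≠ none ↔ p ∈ D) ∧
      ∀ p q, γ.symm p ≠ none → p ≤ q → γ.symm q ≠ none := by
  induction hn : weight D using Nat.strong_induction_on generalizing D with
  | _ n ih =>
    by_cases he : ∃ p q, IsEdge D p q
    · obtain ⟨p, q, he⟩ := he
      obtain ⟨γ, hγ, hdom, hup⟩ := ih _ (hn ▸ he.weight_push_lt) _ rfl
      obtain ⟨hp, hq, hpq⟩ := he
      have hqk := q.isLt
      -- In zero-based numbering `x_i` moves `k - 1 - i` to `k - i`; solving for the target `q`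
      -- gives the index `k - q`.
      have hs : EdgeRel.IsStep (xGen k (k - q.val)) p q := by
        have := xGen_isStep (k := k) (i := k - q.val) (by omega) (by omega)
        have h1 : (⟨k - 1 - (k - q.val), by omega⟩ : Fin k) = p := Fin.ext (by simp only; omega)
        have h2 : (⟨k - (k - q.val), by omega⟩ : Fin k) = q := Fin.ext (by simp only; omega)
        rwa [h1, h2] at this
      have hne := hs.ne
      refine ⟨xGen k (k - q.val) * γ, mul_mem xGen_mem hγ, fun r => ?_, ?_⟩
      · rw [Ne, mul_eq_none, not_or]
        by_cases hrp : r = p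
        · subst hrp
          have : γ q ≠ none := (hdom q).2 (by simp [push])
          simp [hs.apply_left, this, hp]
        by_cases hrq : r = q
        · subst hrq
          simp [hs.apply_right, hq]
        · have : γ r = none ↔ r ∉ D := by
            rw [← not_iff_not, not_not, ← Ne, hdom r]
            simp [push, hrp, hrq]
          simp [hs.apply_of_ne r hrp hrq, this]
      · have hsymm : ∀ r, (xGen k (k - q.val) * γ).symm r ≠ none ↔ γ.symm r ≠ none := by
          intro r
          rw [symm_mul, Ne, mul_eq_none, not_or]
          constructor
          · exact fun h => h.1
          · refine fun h => ⟨h, ?_⟩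
            rintro ⟨s, hs1, hs2⟩
            have hs3 : s ∈ push D p q := by
              rw [← hdom, (PEquiv.eq_some_iff γ).1 hs1]
              simp
            rcases Finset.mem_insert.1 hs3 with rfl | hs3
            · rw [(PEquiv.eq_some_iff _).2 hs.apply_left] at hs2
              simp at hs2
            · obtain ⟨hsp, hsD⟩ := Finset.mem_erase.1 hs3
              rw [(PEquiv.eq_some_iff _).2 (hs.apply_of_ne s hsp fun h => hq (h ▸ hsD))] at hs2
              simp at hs2
        intro r s hr hrs
        rw [hsymm] at hr ⊢
        exact hup r s hr hrs
    · have hup : ∀ d (p q : Fin k), p ∈ D → p.val + d = q.val → q ∈ D := by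
        intro d
        induction d with
        | zero =>
          intro p q hp hpq
          rwa [← Fin.ext (show p.val = q.val from hpq)]
        | succ d ihd =>
          intro p q hp hpq
          have h1 := ihd p ⟨p.val + d, by have := q.isLt; omega⟩ hp rfl
          by_contra hq
          exact he ⟨_, q, h1, hq, by simp only; omega⟩
      have h1 : ∀ p q, PEquiv.ofSet {p : Fin k | p ∈ D} p = some q ↔ p = q ∧ p ∉ Dᶜ := by
        intro p q
        rw [PEquiv.ofSet_eq_some_iff, Finset.mem_compl, not_not, Set.mem_ofPred_eq]
        constructor
        · rintro ⟨rfl, h⟩; exact ⟨rfl, h⟩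
        · rintro ⟨rfl, h⟩; exact ⟨rfl, h⟩
      have h2 : ∀ p, PEquiv.ofSet {p : Fin k | p ∈ D} p ≠ none ↔ p ∈ D := by
        intro p
        rw [Option.ne_none_iff_exists']
        simp
      refine ⟨PEquiv.ofSet {p | p ∈ D}, partial_id_mem hk Dᶜ h1, h2, ?_⟩
      intro p q hp hpq
      rw [PEquiv.ofSet_symm, h2] at hp ⊢
      exact hup (q.val - p.val) p q hp (by have := Fin.le_def.1 hpq; omega)

/-- Descending induction on `p`, with `d = k - p`. The points of the domain above `p` are fixed, so
`p` cannot move up by injectivity. If it moved down, `p` would be the image of a smaller point, as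
the image is an upper set, and order would be violated. -/
theorem OrderPreserving.eq_of_upper {k : ℕ} {φ : Fin k ≃. Fin k} (h : OrderPreserving id φ)
    (hdom : ∀ p q, φ p ≠ none → p ≤ q → φ q ≠ none)
    (him : ∀ p q, φ.symm p ≠ none → p ≤ q → φ.symm q ≠ none) (d : ℕ) (p q : Fin k)
    (hd : p.val + d = k) (hpq : φ p = some q) : p = q := by
  induction d using Nat.strong_induction_on generalizing p q with
  | _ d ih =>
    have ih' : ∀ r, p < r → ∀ s, φ r = some s → r = s := fun r hr s hs =>
      ih (k - r.val) (by have := Fin.lt_def.1 hr; have := r.isLt; omega) r s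
        (by have := r.isLt; omega) hs
    rcases lt_trichotomy p q with hlt | rfl | hlt
    · obtain ⟨s, hs⟩ := Option.ne_none_iff_exists'.1 (hdom p q (by rw [hpq]; simp) hlt.le)
      have h1 := ih' q hlt s hs
      rw [← h1] at hs
      exact φ.inj hpq hs
    · rfl
    · have hq : φ.symm q = some p := (PEquiv.eq_some_iff φ).2 hpq
      obtain ⟨s, hs⟩ := Option.ne_none_iff_exists'.1 (him q p (by rw [hq]; simp) hlt.le)
      have hs' := (PEquiv.eq_some_iff φ).1 hs
      rcases lt_trichotomy p s with hps | rfl | hps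
      · have := ih' s hps p hs'
        exact absurd this hps.ne'
      · rw [hs'] at hpq
        exact Option.some.inj hpq
      · exact absurd (h s p p q hs' hpq hps.le) (not_le.2 hlt)

/-- The generators `x_i` generate the monoid of order preserving partial permutations. -/
theorem OrderPreserving.mem_xRange {k : ℕ} (hk : 2 ≤ k) {θ : Fin k ≃. Fin k}
    (h : OrderPreserving id θ) : θ ∈ xRange k := by
  classical
  obtain ⟨γ, hγ, hγd, hγu⟩ :=
    exists_mem_xRange_upper hk (Finset.univ.filter fun p => θ p ≠ none)
  obtain ⟨δ, hδ, hδd, hδu⟩ :=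
    exists_mem_xRange_upper hk (Finset.univ.filter fun p => θ.symm p ≠ none)
  simp only [Finset.mem_filter, Finset.mem_univ, true_and] at hγd hδd
  -- Once domain and image have been moved to the upper end, order leaves only a partial identity;
  -- undoing the two moves recovers `θ`.
  set φ := γ.symm * θ * δ with hφ
  have hop : OrderPreserving id φ :=
    ((orderPreserving_of_mem_xRange hγ).symm.mul h).mul (orderPreserving_of_mem_xRange hδ)
  have total : ∀ {γ θ δ : Fin k ≃. Fin k}, (∀ p, γ p ≠ none ↔ θ p ≠ none) →
      (∀ p, δ p ≠ none ↔ θ.symm p ≠ none) → ∀ p, (γ.symm * θ * δ) p ≠ none ↔ γ.symm p ≠ none := by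
    intro γ θ δ hγ hδ p
    constructor
    · intro h h'
      exact h (mul_eq_none.2 (Or.inl (mul_eq_none.2 (Or.inl h'))))
    · intro h
      obtain ⟨q, hq⟩ := Option.ne_none_iff_exists'.1 h
      have h1 : θ q ≠ none := by
        rw [← hγ, (PEquiv.eq_some_iff γ).1 hq]
        simp
      obtain ⟨r, hr⟩ := Option.ne_none_iff_exists'.1 h1
      have h2 : δ r ≠ none := by
        rw [hδ, (PEquiv.eq_some_iff θ).2 hr]
        simp
      obtain ⟨s, hs⟩ := Option.ne_none_iff_exists'.1 h2
      rw [mul_eq_some.2 ⟨r, mul_eq_some.2 ⟨q, hq, hr⟩, hs⟩]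
      simp
  have hdom := total hγd hδd
  have him : ∀ p, φ.symm p ≠ none ↔ δ.symm p ≠ none := by
    have h1 : φ.symm = δ.symm * θ.symm * γ := by
      rw [hφ, symm_mul, symm_mul, mul_assoc]
      rfl
    rw [h1]
    exact total hδd hγd
  have hid : ∀ p q, φ p = some q → p = q := fun p q hpq =>
    hop.eq_of_upper (fun p q hp hpq => (hdom q).2 (hγu p q ((hdom p).1 hp) hpq))
      (fun p q hp hpq => (him q).2 (hδu p q ((him p).1 hp) hpq)) (k - p.val) p q
      (by have := p.isLt; omega) hpq
  have hφmem : φ ∈ xRange k := by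
    refine partial_id_mem hk (Finset.univ.filter fun p => φ p = none) fun p q => ?_
    simp only [Finset.mem_filter, Finset.mem_univ, true_and]
    constructor
    · intro hpq
      exact ⟨hid p q hpq, by rw [hpq]; simp⟩
    · rintro ⟨rfl, hp⟩
      obtain ⟨q, hq⟩ := Option.ne_none_iff_exists'.1 hp
      rw [hq, hid p q hq]
  have hθ : θ = γ * φ * δ.symm := by
    have h1 : γ * φ * δ.symm = (γ * γ.symm) * θ * (δ * δ.symm) := by
      rw [hφ]; simp only [mul_assoc]
    rw [h1]
    ext p q
    rw [mul_eq_some]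
    constructor
    · intro hpq
      refine ⟨q, mul_eq_some.2 ⟨p, (mul_symm_self _ _ _).2 ⟨rfl, (hγd p).2 ?_⟩, hpq⟩,
        (mul_symm_self _ _ _).2 ⟨rfl, (hδd q).2 ?_⟩⟩
      · rw [hpq]; simp
      · rw [(PEquiv.eq_some_iff θ).2 hpq]; simp
    · rintro ⟨r, hr, hrq⟩
      obtain ⟨s, hs, hsr⟩ := mul_eq_some.1 hr
      obtain rfl := ((mul_symm_self _ _ _).1 hs).1
      obtain rfl := ((mul_symm_self _ _ _).1 hrq).1
      exact hsr
  rw [hθ]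
  exact mul_mem (mul_mem hγ hφmem) (symm_mem_xRange hk hδ)

end POIPresentation

namespace POIPresentation

/-! ### The structure of `POI_{k×m}` -/

section Structure

variable {k m : ℕ}

theorem divNat_finProdFinEquiv (r : Fin k) (j : Fin m) : (finProdFinEquiv (r, j)).divNat = r := by
  have := finProdFinEquiv.symm_apply_apply (r, j)
  rw [finProdFinEquiv_symm_apply] at this
  exact congrArg Prod.fst this

theorem modNat_finProdFinEquiv (r : Fin k) (j : Fin m) : (finProdFinEquiv (r, j)).modNat = j := by
  have := finProdFinEquiv.symm_apply_apply (r, j)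
  rw [finProdFinEquiv_symm_apply] at this
  exact congrArg Prod.snd this

theorem exists_eq_finProdFinEquiv (y : Fin (k * m)) : ∃ r j, y = finProdFinEquiv (r, j) :=
  ⟨y.divNat, y.modNat, by rw [← finProdFinEquiv_symm_apply, Equiv.apply_symm_apply]⟩

theorem pequiv_ext_prod {α β : Fin (k * m) ≃. Fin (k * m)}
    (h : ∀ r j, α (finProdFinEquiv (r, j)) = β (finProdFinEquiv (r, j))) : α = β := by
  ext1 y
  obtain ⟨r, j, rfl⟩ := exists_eq_finProdFinEquiv y
  exact h r j

theorem inflate_apply (θ : Fin k ≃. Fin k) (r : Fin k) (j : Fin m) :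
    inflate k m θ (finProdFinEquiv (r, j)) = (θ r).map fun s => finProdFinEquiv (s, j) := by
  change (θ (finProdFinEquiv (r, j)).divNat).map _ = _
  rw [divNat_finProdFinEquiv, modNat_finProdFinEquiv]

theorem blockPerm_apply (z : Fin k → Equiv.Perm (Fin m)) (r : Fin k) (j : Fin m) :
    blockPerm k m z (finProdFinEquiv (r, j)) = some (finProdFinEquiv (r, z r j)) := by
  rw [blockPerm, Equiv.toPEquiv_apply, Equiv.trans_apply, Equiv.trans_apply,
    Equiv.symm_apply_apply, Equiv.prodCongrRight_apply]

theorem mul_apply_of_some {Ω : Type*} {α β : Ω ≃. Ω} {x y : Ω} (h : α x = some y) :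
    (α * β) x = β y := by
  change (α x).bind β = _
  rw [h, Option.bind_some]

theorem mul_apply_of_none {Ω : Type*} {α β : Ω ≃. Ω} {x : Ω} (h : α x = none) :
    (α * β) x = none := by
  change (α x).bind β = _
  rw [h, Option.bind_none]

/-- Inflation of partial permutations as a homomorphism. -/
def inflateHom (k m : ℕ) : (Fin k ≃. Fin k) →* (Fin (k * m) ≃. Fin (k * m)) where
  toFun := inflate k m
  map_one' := pequiv_ext_prod fun r j => by rw [inflate_apply, one_apply, one_apply]; rfl
  map_mul' θ θ' := pequiv_ext_prod fun r j => by
    rw [inflate_apply]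
    cases hr : θ r with
    | none => rw [mul_apply_of_none hr, mul_apply_of_none (by rw [inflate_apply, hr]; rfl)]; rfl
    | some s =>
      rw [mul_apply_of_some hr,
        mul_apply_of_some (show inflate k m θ (finProdFinEquiv (r, j)) = some (finProdFinEquiv (s, j))
          by rw [inflate_apply, hr]; rfl), inflate_apply]

theorem inflateHom_apply (θ : Fin k ≃. Fin k) : inflateHom k m θ = inflate k m θ := rfl

/-- The homomorphism from the `k`-th power of the symmetric group onto the units; the inverse is due
to the order of composition of partial permutations. -/
def blockHom (k m : ℕ) : (Fin k → Equiv.Perm (Fin m)) →* (Fin (k * m) ≃. Fin (k * m)) where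
  toFun z := blockPerm k m z⁻¹
  map_one' := pequiv_ext_prod fun r j => by rw [blockPerm_apply, one_apply]; rfl
  map_mul' z z' := pequiv_ext_prod fun r j => by
    rw [blockPerm_apply, mul_apply_of_some (blockPerm_apply _ r j), blockPerm_apply, mul_inv_rev]
    rfl

theorem blockHom_apply (z : Fin k → Equiv.Perm (Fin m)) (r : Fin k) (j : Fin m) :
    blockHom k m z (finProdFinEquiv (r, j)) = some (finProdFinEquiv (r, (z r)⁻¹ j)) :=
  blockPerm_apply _ r j

theorem blockHom_mul_inflate_apply (z : Fin k → Equiv.Perm (Fin m)) (θ : Fin k ≃. Fin k)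
    (r : Fin k) (j : Fin m) : (blockHom k m z * inflateHom k m θ) (finProdFinEquiv (r, j)) =
      (θ r).map fun s => finProdFinEquiv (s, (z r)⁻¹ j) := by
  rw [mul_apply_of_some (blockHom_apply z r j), inflateHom_apply, inflate_apply]

theorem genVal_a (hm : 2 ≤ m) (r : Fin k) : genVal hm (Letter.a r) =
    blockHom k m (Pi.mulSingle r (Equiv.swap ⟨0, by omega⟩ ⟨1, by omega⟩)) := by
  change blockPerm _ _ _ = blockPerm _ _ _
  rw [← Pi.mulSingle_inv, Equiv.swap_inv]

theorem genVal_b (hm : 2 ≤ m) (r : Fin k) : genVal hm (Letter.b r) =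
    blockHom k m (Pi.mulSingle r (finRotate m)⁻¹) := by
  change blockPerm _ _ _ = blockPerm _ _ _
  rw [← Pi.mulSingle_inv, inv_inv]

theorem blockHom_mulSingle_apply (r : Fin k) (g : Equiv.Perm (Fin m)) (s : Fin k) (j : Fin m) :
    blockHom k m (Pi.mulSingle r g) (finProdFinEquiv (s, j)) =
      some (finProdFinEquiv (s, if s = r then g⁻¹ j else j)) := by
  rw [blockHom_apply]
  by_cases h : s = r
  · subst h
    rw [Pi.mulSingle_eq_same, if_pos rfl]
  · rw [Pi.mulSingle_eq_of_ne h, if_neg h]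
    rfl

/-- Inflations translate blocks, so permuting block `r` first is the same as permuting its image
block afterwards. This is the source of the relations `R'`, for any permutation `g` of a block. -/
theorem follows_blockHom (g : Equiv.Perm (Fin m)) (θ : Fin k ≃. Fin k) :
    EdgeRel.Follows (fun r => blockHom k m (Pi.mulSingle r g)) θ (inflateHom k m θ) where
  left_none r hr := pequiv_ext_prod fun s j => by
    rw [mul_apply_of_some (blockHom_mulSingle_apply r g s j), inflateHom_apply, inflate_apply,
      inflate_apply]
    by_cases h : s = r
    · rw [h, hr]; rfl
    · rw [if_neg h]
  left_some r r' hr := pequiv_ext_prod fun s j => by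
    rw [mul_apply_of_some (blockHom_mulSingle_apply r g s j), inflateHom_apply, inflate_apply]
    cases hs : θ s with
    | none => rw [mul_apply_of_none (by rw [inflate_apply, hs]; rfl)]; rfl
    | some s' =>
      rw [mul_apply_of_some (show inflate k m θ (finProdFinEquiv (s, j)) =
        some (finProdFinEquiv (s', j)) by rw [inflate_apply, hs]; rfl), blockHom_mulSingle_apply]
      have : s = r ↔ s' = r' := by
        constructor
        · rintro rfl
          exact Option.some.inj (hs.symm.trans hr)
        · rintro rfl
          exact θ.inj hs hr
      simp only [this]
      rfl
  right_none r hr := pequiv_ext_prod fun s j => by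
    rw [inflateHom_apply, inflate_apply]
    cases hs : θ s with
    | none => rw [mul_apply_of_none (by rw [inflate_apply, hs]; rfl)]; rfl
    | some s' =>
      rw [mul_apply_of_some (show inflate k m θ (finProdFinEquiv (s, j)) =
        some (finProdFinEquiv (s', j)) by rw [inflate_apply, hs]; rfl), blockHom_mulSingle_apply]
      have : s' ≠ r := by
        rintro rfl
        rw [(PEquiv.eq_some_iff θ).2 hs] at hr
        simp at hr
      rw [if_neg this]
      rfl

theorem blockPerm_mem_POI (z : Fin k → Equiv.Perm (Fin m)) : blockPerm k m z ∈ POI k m := by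
  have key : ∀ y y', blockPerm k m z y = some y' → y'.divNat = y.divNat := by
    intro y y' h
    obtain ⟨r, j, rfl⟩ := exists_eq_finProdFinEquiv y
    rw [blockPerm_apply] at h
    rw [← Option.some.inj h, divNat_finProdFinEquiv, divNat_finProdFinEquiv]
  refine ⟨fun y y' h => ⟨fun x _ => ?_, ?_⟩, fun x y x' y' hx hy hxy => ?_⟩
  · obtain ⟨r, j, rfl⟩ := exists_eq_finProdFinEquiv x
    exact ⟨_, blockPerm_apply z r j⟩
  · ext w
    simp only [Set.mem_ofPred_eq]
    rw [key y y' h]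
    constructor
    · rintro ⟨x, hx, hxw⟩
      rw [key x w hxw, hx]
    · intro hw
      obtain ⟨r, j, rfl⟩ := exists_eq_finProdFinEquiv w
      refine ⟨finProdFinEquiv (r, (z r)⁻¹ j), ?_, ?_⟩
      · rw [divNat_finProdFinEquiv] at hw ⊢
        exact hw
      · rw [blockPerm_apply]
        simp
  · rw [key x x' hx, key y y' hy]
    exact hxy

theorem inflate_mem_POI {θ : Fin k ≃. Fin k} (hθ : OrderPreserving id θ) :
    inflate k m θ ∈ POI k m := by
  have key : ∀ (y y' : Fin (k * m)), inflate k m θ y = some y' →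
      θ y.divNat = some y'.divNat := by
    intro y y' h
    obtain ⟨r, j, rfl⟩ := exists_eq_finProdFinEquiv y
    rw [inflate_apply] at h
    obtain ⟨s, hs, rfl⟩ := Option.map_eq_some_iff.1 h
    rw [divNat_finProdFinEquiv, divNat_finProdFinEquiv, hs]
  refine ⟨fun y y' h => ⟨fun x hx => ?_, ?_⟩, fun x y x' y' hx hy hxy => ?_⟩
  · obtain ⟨r, j, rfl⟩ := exists_eq_finProdFinEquiv x
    have h1 := key y y' h
    rw [← hx, divNat_finProdFinEquiv] at h1
    exact ⟨finProdFinEquiv (y'.divNat, j), by rw [inflate_apply, h1]; rfl⟩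
  · have h1 := key y y' h
    ext w
    simp only [Set.mem_ofPred_eq]
    constructor
    · rintro ⟨x, hx, hxw⟩
      have h2 := key x w hxw
      rw [hx, h1] at h2
      exact (Option.some.inj h2).symm
    · intro hw
      obtain ⟨r, j, rfl⟩ := exists_eq_finProdFinEquiv w
      rw [divNat_finProdFinEquiv] at hw
      refine ⟨finProdFinEquiv (y.divNat, j), divNat_finProdFinEquiv _ _, ?_⟩
      rw [inflate_apply, h1, hw]
      rfl
  · exact hθ _ _ _ _ (key x x' hx) (key y y' hy) hxy

/-- The partial permutation of the set of blocks induced by a stable partial permutation. -/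
def blockMap (hm : 0 < m) {α : Fin (k * m) ≃. Fin (k * m)}
    (h : Stable (Fin.divNat : Fin (k * m) → Fin k) α) : Fin k ≃. Fin k where
  -- By stability the first point of a block decides where the whole block goes.
  toFun r := (α (finProdFinEquiv (r, ⟨0, hm⟩))).map Fin.divNat
  invFun s := (α.symm (finProdFinEquiv (s, ⟨0, hm⟩))).map Fin.divNat
  inv r s := by
    simp only [Option.map_eq_some_iff]
    constructor
    · rintro ⟨y, hy, rfl⟩
      have hy' := (PEquiv.eq_some_iff α).1 hy
      obtain ⟨h1, h2⟩ := h y _ hy'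
      obtain ⟨y', hy'⟩ := h1 (finProdFinEquiv (y.divNat, ⟨0, hm⟩)) (divNat_finProdFinEquiv _ _)
      refine ⟨y', hy', ?_⟩
      have h3 : y' ∈ {y' | ∃ x', x'.divNat = y.divNat ∧ α x' = some y'} :=
        ⟨_, divNat_finProdFinEquiv _ _, hy'⟩
      rw [h2] at h3
      exact h3.trans (divNat_finProdFinEquiv _ _)
    · rintro ⟨y, hy, rfl⟩
      obtain ⟨h1, h2⟩ := h _ y hy
      have h3 : finProdFinEquiv (y.divNat, ⟨0, hm⟩) ∈ {y' | y'.divNat = y.divNat} :=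
        divNat_finProdFinEquiv _ _
      rw [← h2] at h3
      obtain ⟨x, hx, hx'⟩ := h3
      exact ⟨x, (PEquiv.eq_some_iff α).2 hx', hx.trans (divNat_finProdFinEquiv _ _)⟩

theorem blockMap_eq_some_iff (hm : 0 < m) {α : Fin (k * m) ≃. Fin (k * m)}
    (h : Stable (Fin.divNat : Fin (k * m) → Fin k) α) (r s : Fin k) :
    blockMap hm h r = some s ↔ ∃ y, α (finProdFinEquiv (r, ⟨0, hm⟩)) = some y ∧ y.divNat = s :=
  Option.map_eq_some_iff

theorem Stable.apply_of_blockMap (hm : 0 < m) {α : Fin (k * m) ≃. Fin (k * m)}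
    (h : Stable (Fin.divNat : Fin (k * m) → Fin k) α) {r s : Fin k}
    (hrs : blockMap hm h r = some s) (j : Fin m) :
    ∃ t, α (finProdFinEquiv (r, j)) = some (finProdFinEquiv (s, t)) := by
  obtain ⟨y, hy, rfl⟩ := (blockMap_eq_some_iff hm h r s).1 hrs
  obtain ⟨h1, h2⟩ := h _ y hy
  have hj : (finProdFinEquiv (r, j)).divNat = (finProdFinEquiv (r, (⟨0, hm⟩ : Fin m))).divNat := by
    rw [divNat_finProdFinEquiv, divNat_finProdFinEquiv]
  obtain ⟨y', hy'⟩ := h1 _ hj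
  have h3 : y' ∈ {y' | y'.divNat = y.divNat} := h2 ▸ ⟨_, hj, hy'⟩
  obtain ⟨s, t, rfl⟩ := exists_eq_finProdFinEquiv y'
  have h3 : s = y.divNat := (divNat_finProdFinEquiv s t).symm.trans h3
  exact ⟨t, h3 ▸ hy'⟩

/-- Each element of `POI_{k×m}` is the product of a unit and an inflated partial permutation. -/
theorem exists_eq_blockHom_mul_inflate (hm : 0 < m) {α : Fin (k * m) ≃. Fin (k * m)}
    (hα : α ∈ POI k m) : ∃ z θ, OrderPreserving id θ ∧ α = blockHom k m z * inflateHom k m θ := by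
  obtain ⟨h, hop⟩ := hα
  have hz : ∀ r : Fin k, ∃ g : Equiv.Perm (Fin m), ∀ s, blockMap hm h r = some s →
      ∀ j, α (finProdFinEquiv (r, j)) = some (finProdFinEquiv (s, g j)) := by
    intro r
    cases hr : blockMap hm h r with
    -- On a block outside the domain the permutation is irrelevant.
    | none => exact ⟨1, by simp⟩
    | some s =>
      choose g hg using fun j => h.apply_of_blockMap hm hr j
      have hinj : Function.Injective g := by
        intro j j' hjj
        have := hg j'
        rw [← hjj] at this
        have := finProdFinEquiv.injective (α.inj (hg j) this)
        exact congrArg Prod.snd this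
      refine ⟨Equiv.ofBijective g (Finite.injective_iff_bijective.1 hinj), fun s' hs j => ?_⟩
      rw [← Option.some.inj hs]
      exact hg j
  choose g hg using hz
  -- The inverse compensates for the one in `blockHom`.
  refine ⟨g⁻¹, blockMap hm h, ?_, pequiv_ext_prod fun r j => ?_⟩
  · intro r r' s s' hrs hrs' hle
    obtain ⟨y, hy, rfl⟩ := (blockMap_eq_some_iff hm h r s).1 hrs
    obtain ⟨y', hy', rfl⟩ := (blockMap_eq_some_iff hm h r' s').1 hrs'
    refine hop _ _ y y' hy hy' ?_
    rw [divNat_finProdFinEquiv, divNat_finProdFinEquiv]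
    exact hle
  · rw [blockHom_mul_inflate_apply, Pi.inv_apply, inv_inv]
    cases hr : blockMap hm h r with
    | some s => exact hg r s hr j
    | none =>
      rw [Option.map_none]
      by_contra hne
      obtain ⟨y, hy⟩ := Option.ne_none_iff_exists'.1 hne
      obtain ⟨y', hy'⟩ := (h _ y hy).1 (finProdFinEquiv (r, ⟨0, hm⟩)) (by
        rw [divNat_finProdFinEquiv, divNat_finProdFinEquiv])
      have := (blockMap_eq_some_iff hm h r y'.divNat).2 ⟨y', hy', rfl⟩
      rw [hr] at this
      simp at this

end Structure

end POIPresentation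

namespace POIPresentation

/-! ### Faithfulness of the presentation -/

open Equiv

theorem closure_swap_finRotate {m : ℕ} (hm : 2 ≤ m) : Subgroup.closure
    ({swap ⟨0, by omega⟩ ⟨1, by omega⟩, (finRotate m)⁻¹} : Set (Perm (Fin m))) = ⊤ := by
  obtain ⟨n, rfl⟩ : ∃ n, m = n + 2 := ⟨m - 2, by omega⟩
  rw [eq_top_iff, ← Perm.closure_cycle_adjacent_swap isCycle_finRotate support_finRotate 0,
    Subgroup.closure_le]
  have h0 : finRotate (n + 2) 0 = ⟨1, by omega⟩ := by
    ext
    rw [val_finRotate]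
    simp
  rintro g (rfl | rfl)
  · have := Subgroup.subset_closure (k := ({swap ⟨0, by omega⟩ ⟨1, by omega⟩,
      (finRotate (n + 2))⁻¹} : Set (Perm (Fin (n + 2))))) (Or.inr rfl)
    simpa using inv_mem this
  · rw [h0]
    exact Subgroup.subset_closure (Or.inl rfl)

theorem MooreRel.of_map {M M' : Type*} [Monoid M] [Monoid M'] {m : ℕ} {a b : M} (f : M →* M')
    (hf : Function.Injective f) (h : MooreRel m (f a) (f b)) : MooreRel m a b where
  sq := hf (by rw [map_pow, h.sq, map_one])
  pow := hf (by rw [map_pow, h.pow, map_one])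
  prod := hf (by rw [map_pow, map_mul, h.prod, map_one])
  braid hm := hf (by simp only [map_mul, map_pow]; rw [h.braid hm, map_one])
  comm j h1 h2 := hf (by simp only [map_mul, map_pow]; rw [h.comm j h1 h2, map_one])

/-- Moore's relations define homomorphisms from the symmetric group to monoids. -/
theorem MooreRel.exists_hom_units {M : Type*} [Monoid M] {m : ℕ} (hm : 2 ≤ m) {a b : M}
    (h : MooreRel m a b) : ∃ f : Perm (Fin m) →* Mˣ,
      (f (swap ⟨0, by omega⟩ ⟨1, by omega⟩) : M) = a ∧ (f (finRotate m)⁻¹ : M) = b := by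
  -- Moore's relations make `a` and `b` invertible, so the statement for groups can be applied to
  -- the group of units.
  have ha : a * a = 1 := by rw [← pow_two, h.sq]
  have hb : b * b ^ (m - 1) = 1 := by rw [← pow_succ', Nat.sub_add_cancel (by omega), h.pow]
  have hb' : b ^ (m - 1) * b = 1 := by rw [← pow_succ, Nat.sub_add_cancel (by omega), h.pow]
  have h' : MooreRel m (⟨a, a, ha, ha⟩ : Mˣ) (⟨b, b ^ (m - 1), hb, hb'⟩ : Mˣ) :=
    MooreRel.of_map (Units.coeHom M) Units.val_injective h
  obtain ⟨f, hfa, hfb⟩ := h'.exists_hom hm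
  exact ⟨f, by rw [hfa], by rw [hfb]⟩

theorem commute_of_closure {G G' H : Type*} [Group G] [Group G'] [Group H] {s : Set G} {t : Set G'}
    (hs : Subgroup.closure s = ⊤) (ht : Subgroup.closure t = ⊤) (f : G →* H) (g : G' →* H)
    (h : ∀ x ∈ s, ∀ y ∈ t, Commute (f x) (g y)) (x : G) (y : G') : Commute (f x) (g y) := by
  have key : ∀ x ∈ s, ∀ y, Commute (f x) (g y) := by
    intro x hx y
    have : (Subgroup.centralizer {f x}).comap g = ⊤ := by
      rw [eq_top_iff, ← ht, Subgroup.closure_le]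
      intro y hy
      rw [SetLike.mem_coe, Subgroup.mem_comap, Subgroup.mem_centralizer_singleton_iff]
      exact (h x hx y hy).symm.eq
    have hy : y ∈ (Subgroup.centralizer {f x}).comap g := this ▸ Subgroup.mem_top y
    rw [Subgroup.mem_comap, Subgroup.mem_centralizer_singleton_iff] at hy
    exact hy.symm
  have : (Subgroup.centralizer {g y}).comap f = ⊤ := by
    rw [eq_top_iff, ← hs, Subgroup.closure_le]
    intro x hx
    rw [SetLike.mem_coe, Subgroup.mem_comap, Subgroup.mem_centralizer_singleton_iff]
    exact (key x hx y).eq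
  have hx : x ∈ (Subgroup.centralizer {g y}).comap f := this ▸ Subgroup.mem_top x
  rw [Subgroup.mem_comap, Subgroup.mem_centralizer_singleton_iff] at hx
  exact hx

/-- The elements of a group whose images act trivially from the left on an element of a monoid. -/
def leftFixer {G N : Type*} [Group G] [Monoid N] (f : G →* N) (c : N) : Subgroup G where
  carrier := {g | f g * c = c}
  one_mem' := by
    change f 1 * c = c
    rw [map_one, one_mul]
  mul_mem' {g h} hg hh := by
    change f (g * h) * c = c
    rw [map_mul, mul_assoc, hh, hg]
  inv_mem' {g} hg := by
    change f g⁻¹ * c = c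
    have hg : f g * c = c := hg
    conv_lhs => rw [← hg]
    rw [← mul_assoc, ← map_mul, inv_mul_cancel, map_one, one_mul]

/-- Elements of a monoid satisfying the relations of `POI_{k×m}`. -/
structure POIRel {N : Type*} [Monoid N] (k m : ℕ) (A B : Fin k → N) (x : ℕ → N) : Prop where
  moore : ∀ r, MooreRel m (A r) (B r)
  comm_a : ∀ r s, r ≠ s → Commute (A r) (A s)
  comm_b : ∀ r s, r ≠ s → Commute (B r) (B s)
  comm_ab : ∀ r s, r ≠ s → Commute (A r) (B s)
  wRel : WRel k x
  follows_a : ∀ i : Fin k, EdgeRel.Follows A (xPoint k i) (x i)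
  follows_b : ∀ i : Fin k, EdgeRel.Follows B (xPoint k i) (x i)

namespace POIRel

variable {N : Type*} [Monoid N] {k m : ℕ} {A B : Fin k → N} {x : ℕ → N}

/-- The homomorphisms attached to different blocks have commuting images, by the commutation
relations on generators; so they combine into one on the product group. -/
theorem exists_hom (h : POIRel k m A B x) (hm : 2 ≤ m) : ∃ Φ : (Fin k → Perm (Fin m)) →* N,
    (∀ r, Φ (Pi.mulSingle r (swap ⟨0, by omega⟩ ⟨1, by omega⟩)) = A r) ∧
      ∀ r, Φ (Pi.mulSingle r (finRotate m)⁻¹) = B r := by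
  choose f hfa hfb using fun r => (h.moore r).exists_hom_units hm
  have hcomm : Pairwise fun r s => ∀ g g',
      Commute ((Units.coeHom N).comp (f r) g) ((Units.coeHom N).comp (f s) g') := by
    intro r s hrs g g'
    refine Commute.map (commute_of_closure (closure_swap_finRotate hm) (closure_swap_finRotate hm)
      (f r) (f s) ?_ g g') (Units.coeHom N)
    rintro g (rfl | rfl) g' (rfl | rfl) <;> rw [Commute, SemiconjBy, Units.ext_iff]
    · simpa only [Units.val_mul, hfa] using (h.comm_a r s hrs).eq
    · simpa only [Units.val_mul, hfa, hfb] using (h.comm_ab r s hrs).eq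
    · simpa only [Units.val_mul, hfa, hfb] using (h.comm_ab s r hrs.symm).symm.eq
    · simpa only [Units.val_mul, hfb] using (h.comm_b r s hrs).eq
  refine ⟨MonoidHom.noncommPiCoprod (fun r => (Units.coeHom N).comp (f r)) hcomm,
    fun r => ?_, fun r => ?_⟩
  · rw [MonoidHom.noncommPiCoprod_mulSingle]
    exact hfa r
  · rw [MonoidHom.noncommPiCoprod_mulSingle]
    exact hfb r

theorem follows_lift {ε : Fin k → N} (h : ∀ i : Fin k, EdgeRel.Follows ε (xPoint k i) (x i))
    (w : FreeMonoid (Fin k)) : EdgeRel.Follows ε (FreeMonoid.lift (xPoint k) w)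
      (FreeMonoid.lift (fun i : Fin k => x i) w) := by
  induction w using FreeMonoid.inductionOn' with
  | one => simpa using EdgeRel.Follows.one
  | of_mul i w ih =>
    rw [map_mul, map_mul, FreeMonoid.lift_eval_of, FreeMonoid.lift_eval_of]
    exact (h i).mul ih

/-- A homomorphism to `POI_{k×m}` which maps elements satisfying the relations to the standard
generators, and whose domain is generated by these elements, is an isomorphism. -/
theorem injective_and_surjective (h : POIRel k m A B x) (hk : 2 ≤ k) (hm : 2 ≤ m)
    (hgen : Submonoid.closure (Set.range A ∪ Set.range B ∪ Set.range fun i : Fin k => x i) = ⊤)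
    (π : N →* (Fin (k * m) ≃. Fin (k * m)))
    (hπa : ∀ r, π (A r) = blockHom k m (Pi.mulSingle r (swap ⟨0, by omega⟩ ⟨1, by omega⟩)))
    (hπb : ∀ r, π (B r) = blockHom k m (Pi.mulSingle r (finRotate m)⁻¹))
    (hπx : ∀ i : Fin k, π (x i) = inflateHom k m (xPoint k i)) :
    Function.Injective π ∧ ∀ α ∈ POI k m, ∃ n, π n = α := by
  obtain ⟨Φ, hΦa, hΦb⟩ := h.exists_hom hm
  have hπΦ : ∀ z, π (Φ z) = blockHom k m z := by
    intro z
    have : π.comp Φ = blockHom k m := by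
      refine MonoidHom.pi_ext fun r g => ?_
      have h1 : (π.comp Φ).comp (MonoidHom.mulSingle _ r) =
          (blockHom k m).comp (MonoidHom.mulSingle _ r) := by
        refine MonoidHom.eq_of_eqOn_dense (closure_swap_finRotate hm) ?_
        rintro g (rfl | rfl)
        · exact (congrArg π (hΦa r)).trans (hπa r)
        · exact (congrArg π (hΦb r)).trans (hπb r)
      exact DFunLike.congr_fun h1 g
    exact DFunLike.congr_fun this z
  let X := FreeMonoid.lift fun i : Fin k => x i
  have hπX : ∀ w, π (X w) = inflateHom k m (FreeMonoid.lift (xPoint k) w) := by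
    intro w
    have : π.comp X = (inflateHom k m).comp (FreeMonoid.lift (xPoint k)) := by
      refine FreeMonoid.hom_eq fun i => ?_
      rw [MonoidHom.comp_apply, MonoidHom.comp_apply, FreeMonoid.lift_eval_of,
        FreeMonoid.lift_eval_of, hπx]
    exact DFunLike.congr_fun this w
  -- Normal form: a letter `a_r` or `b_r` multiplied on the right is absorbed by `X w`, or crosses
  -- it and joins the unit on the left.
  have hnormal : ∀ n, ∃ z w, n = Φ z * X w := by
    intro n
    have hn : n ∈ Submonoid.closure (Set.range A ∪ Set.range B ∪ Set.range fun i : Fin k => x i) :=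
      hgen ▸ Submonoid.mem_top n
    have step : ∀ (ε : Fin k → N) (g : Perm (Fin m)), (∀ r, Φ (Pi.mulSingle r g) = ε r) →
        (∀ i : Fin k, EdgeRel.Follows ε (xPoint k i) (x i)) → ∀ z w r,
        ∃ z' w', Φ z * X w * ε r = Φ z' * X w' := by
      intro ε g hg hε z w r
      have hf := follows_lift hε w
      cases hr : (FreeMonoid.lift (xPoint k) w).symm r with
      | none => exact ⟨z, w, by rw [mul_assoc, hf.right_none r hr]⟩
      | some s =>
        refine ⟨z * Pi.mulSingle s g, w, ?_⟩
        rw [mul_assoc, ← hf.left_some s r ((PEquiv.eq_some_iff _).1 hr), map_mul, hg, mul_assoc]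
    induction hn using Submonoid.closure_induction_right with
    | one => exact ⟨1, 1, by simp⟩
    | mul_right n _ c hc ih =>
      obtain ⟨z, w, rfl⟩ := ih
      rcases hc with (⟨r, rfl⟩ | ⟨r, rfl⟩) | ⟨i, rfl⟩
      · exact step A _ hΦa h.follows_a z w r
      · exact step B _ hΦb h.follows_b z w r
      · exact ⟨z, w * FreeMonoid.of i, by
          rw [map_mul, mul_assoc]; simp only [X, FreeMonoid.lift_eval_of]⟩
  constructor
  · intro n n' hn
    obtain ⟨z, w, rfl⟩ := hnormal n
    obtain ⟨z', w', rfl⟩ := hnormal n'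
    rw [map_mul, map_mul, hπΦ, hπΦ, hπX, hπX] at hn
    set θ := FreeMonoid.lift (xPoint k) w with hθ
    -- Evaluation at a point of block `r` shows `θ` through the block of the image and, where `θ` is
    -- defined, `z r` through the position inside it.
    have happ : ∀ r j, (θ r).map (fun s => finProdFinEquiv (s, (z r)⁻¹ j)) =
        ((FreeMonoid.lift (xPoint k) w') r).map fun s => finProdFinEquiv (s, (z' r)⁻¹ j) := by
      intro r j
      rw [← blockHom_mul_inflate_apply, ← blockHom_mul_inflate_apply, hn]
    have hθθ : θ = FreeMonoid.lift (xPoint k) w' := by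
      ext1 r
      have h1 := congrArg (Option.map Fin.divNat) (happ r ⟨0, by omega⟩)
      simpa only [Option.map_map, Function.comp_def, divNat_finProdFinEquiv, Option.map_id'] using h1
    have hzz : ∀ r, θ r ≠ none → z r = z' r := by
      intro r hr
      obtain ⟨s, hs⟩ := Option.ne_none_iff_exists'.1 hr
      rw [← inv_inj]
      ext1 j
      have h1 := happ r j
      rw [← hθθ, hs, Option.map_some, Option.map_some] at h1
      exact congrArg Prod.snd (finProdFinEquiv.injective (Option.some.inj h1))
    have hX : X w = X w' := h.wRel.lift_eq_of_lift_eq hk w w' hθθ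
    -- The two units agree on the blocks in the domain of `θ`; at any other block the symmetric
    -- group is generated by two elements that `X w` absorbs.
    have hfix : z'⁻¹ * z ∈ leftFixer Φ (X w) := by
      refine Subgroup.pi_mem_of_mulSingle_mem _ fun r => ?_
      by_cases hr : θ r = none
      · have htop : (leftFixer Φ (X w)).comap (MonoidHom.mulSingle _ r) = ⊤ := by
          rw [eq_top_iff, ← closure_swap_finRotate hm, Subgroup.closure_le]
          rintro g (rfl | rfl)
          · change Φ (Pi.mulSingle r _) * X w = X w
            rw [hΦa]
            exact (follows_lift h.follows_a w).left_none r hr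
          · change Φ (Pi.mulSingle r _) * X w = X w
            rw [hΦb]
            exact (follows_lift h.follows_b w).left_none r hr
        have : (z'⁻¹ * z) r ∈ (leftFixer Φ (X w)).comap (MonoidHom.mulSingle _ r) :=
          htop ▸ Subgroup.mem_top _
        exact this
      · rw [Pi.mul_apply, Pi.inv_apply, hzz r hr, inv_mul_cancel, Pi.mulSingle_one]
        exact one_mem _
    have hfix : Φ (z'⁻¹ * z) * X w = X w := hfix
    calc Φ z * X w = Φ (z' * (z'⁻¹ * z)) * X w := by rw [mul_inv_cancel_left]
      _ = Φ z' * X w' := by rw [map_mul, mul_assoc, hfix, hX]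
  · intro α hα
    obtain ⟨z, θ, hθ, rfl⟩ := exists_eq_blockHom_mul_inflate (by omega) hα
    obtain ⟨w, rfl⟩ := hθ.mem_xRange hk
    exact ⟨Φ z * X w, by rw [map_mul, hπΦ, hπX]⟩

end POIRel

theorem WRel.map {N N' : Type*} [Monoid N] [Monoid N'] {k : ℕ} {x : ℕ → N} (h : WRel k x)
    (f : N →* N') : WRel k fun i => f (x i) where
  shift i h1 h2 := by simp only [← map_mul, h.shift i h1 h2]
  far i j h1 h2 h3 := by simp only [← map_mul, h.far i j h1 h2 h3]
  zero_one := by simp only [← map_mul, h.zero_one]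
  last_zero := by simp only [← map_mul, h.last_zero]
  near i h1 h2 := by simp only [← map_mul, h.near i h1 h2]
  near' i h1 h2 := by simp only [← map_mul, h.near' i h1 h2]
  regular i h1 := by simp only [← map_icoProd, ← map_mul, h.regular i h1]
  square i h1 h2 := by simp only [← map_icoProd, ← map_mul, h.square i h1 h2]

theorem commute_blockHom_mulSingle {k m : ℕ} {r s : Fin k} (hrs : r ≠ s) (g g' : Perm (Fin m)) :
    Commute (blockHom k m (Pi.mulSingle r g)) (blockHom k m (Pi.mulSingle s g')) := by
  have h : Commute (Pi.mulSingle r g : Fin k → Perm (Fin m)) (Pi.mulSingle s g') :=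
    Pi.mulSingle_commute (f := fun _ : Fin k => Perm (Fin m)) hrs g g'
  rw [Commute, SemiconjBy, ← map_mul, ← map_mul, h.eq]

/-- The standard generators satisfy the relations. -/
theorem poiRel_generators {k m : ℕ} (hk : 2 ≤ k) (hm : 2 ≤ m) : POIRel k m
    (fun r => blockHom k m (Pi.mulSingle r (swap ⟨0, by omega⟩ ⟨1, by omega⟩)))
    (fun r => blockHom k m (Pi.mulSingle r (finRotate m)⁻¹))
    (fun i => inflateHom k m (xGen k i)) where
  moore r := by
    have := (mooreRel_perm m hm).map ((blockHom k m).comp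
      (MonoidHom.mulSingle (fun _ : Fin k => Perm (Fin m)) r))
    simpa only [MonoidHom.comp_apply, MonoidHom.mulSingle_apply] using this
  comm_a r s hrs := commute_blockHom_mulSingle hrs _ _
  comm_b r s hrs := commute_blockHom_mulSingle hrs _ _
  comm_ab r s hrs := commute_blockHom_mulSingle hrs _ _
  wRel := (wRel_xGen hk).map (inflateHom k m)
  follows_a i := by
    rw [xGen_of_lt i.isLt]
    exact follows_blockHom _ _
  follows_b i := by
    rw [xGen_of_lt i.isLt]
    exact follows_blockHom _ _

end POIPresentation

namespace POIPresentation

/-! ### The relations of the presentation -/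

theorem xPoint_apply {k : ℕ} (i p : Fin k) : xPoint k i p =
    if hi : i.val = 0 then
      if p.val = 0 then none else some ⟨p.val - 1, by omega⟩
    else if p.val + i.val = k then none
    else if hp : p.val + 1 + i.val = k then some ⟨p.val + 1, by omega⟩
    else some p := rfl

theorem xPoint_symm_apply {k : ℕ} (i q : Fin k) : (xPoint k i).symm q =
    if i.val = 0 then
      if hq : q.val + 1 < k then some ⟨q.val + 1, hq⟩ else none
    else if q.val + 1 + i.val = k then none
    else if q.val + i.val = k then some ⟨q.val - 1, by omega⟩
    else some q := rfl

/-- The relations `R'` for one of the two families of generators of the symmetric groups. -/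
structure MixedRel {N : Type*} [Monoid N] (k : ℕ) (c x : ℕ → N) : Prop where
  fix_zero : c 1 * x 0 = x 0
  shift_zero : ∀ i, 1 ≤ i → i ≤ k - 1 → x 0 * c i = c (i + 1) * x 0
  fix_right : ∀ i, 0 ≤ i → i ≤ k - 1 → x i * c (k - i) = x i
  fix_left : ∀ i, 2 ≤ i → i ≤ k → c i * x (k - i + 1) = x (k - i + 1)
  move : ∀ i, 1 ≤ i → i ≤ k - 1 → x i * c (k - i + 1) = c (k - i) * x i
  comm : ∀ i j, 1 ≤ i → i ≤ k - 1 → 1 ≤ j → j ≤ k → j ≠ k - i → j ≠ k - i + 1 →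
    x i * c j = c j * x i

/-- The relations are the cases of `Follows`: `fix_zero` and `fix_left` for points outside the
domain, `shift_zero`, `move` and `comm` for points inside it, `fix_right` for the point outside the
image. The index `r + 1` converts from `Fin k` to numbering from one. -/
theorem MixedRel.follows {N : Type*} [Monoid N] {k : ℕ} {c x : ℕ → N} (h : MixedRel k c x)
    (i : Fin k) : EdgeRel.Follows (fun r : Fin k => c (r + 1)) (xPoint k i) (x i) := by
  have hi := i.isLt
  rcases Nat.eq_zero_or_pos i.val with h0 | h0
  · constructor
    · intro p hp
      rw [xPoint_apply, dif_pos h0] at hp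
      split_ifs at hp with hp0
      rw [h0, hp0]
      exact h.fix_zero
    · intro p q hpq
      rw [xPoint_apply, dif_pos h0] at hpq
      split_ifs at hpq with hp0
      obtain rfl := Option.some.inj hpq
      have := h.shift_zero p (by omega) (by omega)
      rw [h0, ← this]
      congr 2
      change _ = p.val - 1 + 1
      omega
    · intro q hq
      rw [xPoint_symm_apply, if_pos h0] at hq
      split_ifs at hq with hq0
      have := h.fix_right 0 le_rfl (by omega)
      rw [h0]
      convert this using 3
      omega
  · constructor
    · intro p hp
      rw [xPoint_apply, dif_neg h0.ne'] at hp
      split_ifs at hp with hp0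
      have := h.fix_left (p + 1) (by omega) (by omega)
      rwa [show k - (p.val + 1) + 1 = i by omega] at this
    · intro p q hpq
      rw [xPoint_apply, dif_neg h0.ne'] at hpq
      split_ifs at hpq with hp0 hp1
      · obtain rfl := Option.some.inj hpq
        have := h.move i h0 (by omega)
        rw [show k - i.val = p + 1 by omega] at this
        exact this.symm
      · obtain rfl := Option.some.inj hpq
        exact (h.comm i (p + 1) h0 (by omega) (by omega) (by omega) (by omega) (by omega)).symm
    · intro q hq
      rw [xPoint_symm_apply, if_neg h0.ne'] at hq
      split_ifs at hq with hq0
      have := h.fix_right i h0.le (by omega)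
      rwa [show k - i.val = q + 1 by omega] at this

theorem MixedRel.of_follows {N : Type*} [Monoid N] {k : ℕ} {c x : ℕ → N} (hk : 0 < k)
    (h : ∀ i : Fin k, EdgeRel.Follows (fun r : Fin k => c (r + 1)) (xPoint k i) (x i)) :
    MixedRel k c x where
  fix_zero := (h ⟨0, hk⟩).left_none ⟨0, hk⟩ rfl
  shift_zero i h1 h2 := by
    have := (h ⟨0, hk⟩).left_some ⟨i, by omega⟩ ⟨i - 1, by omega⟩ (by
      rw [xPoint_apply, dif_pos rfl, if_neg (by simp; omega)])
    simp only [Nat.sub_add_cancel h1] at this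
    exact this.symm
  fix_right i _ h2 := by
    have := (h ⟨i, by omega⟩).right_none ⟨k - i - 1, by omega⟩ (by
      rw [xPoint_symm_apply]
      simp only
      split_ifs <;> first | rfl | omega)
    simpa only [show k - i - 1 + 1 = k - i by omega] using this
  fix_left i h1 h2 := by
    have := (h ⟨k - i + 1, by omega⟩).left_none ⟨i - 1, by omega⟩ (by
      rw [xPoint_apply]
      simp only
      split_ifs <;> first | rfl | omega)
    simpa only [show i - 1 + 1 = i by omega] using this
  move i h1 h2 := by
    have := (h ⟨i, by omega⟩).left_some ⟨k - i - 1, by omega⟩ ⟨k - i, by omega⟩ (by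
      rw [xPoint_apply]
      simp only
      split_ifs <;> first | omega | (simp only [Option.some.injEq, Fin.mk.injEq]; omega))
    simp only [show k - i - 1 + 1 = k - i by omega] at this
    exact this.symm
  comm i j h1 h2 h3 h4 h5 h6 := by
    have := (h ⟨i, by omega⟩).left_some ⟨j - 1, by omega⟩ ⟨j - 1, by omega⟩ (by
      rw [xPoint_apply]
      simp only
      split_ifs <;> first | rfl | omega)
    simp only [Nat.sub_add_cancel h3] at this
    exact this.symm

theorem wa_succ {k : ℕ} (r : Fin k) : wa (r + 1) = FreeMonoid.of (Letter.a r) := by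
  rw [wa, dif_pos ⟨by omega, by omega⟩]
  rfl

theorem wb_succ {k : ℕ} (r : Fin k) : wb (r + 1) = FreeMonoid.of (Letter.b r) := by
  rw [wb, dif_pos ⟨by omega, by omega⟩]
  rfl

theorem wx_val {k : ℕ} (i : Fin k) : wx i = FreeMonoid.of (Letter.x i) := dif_pos i.isLt

theorem map_wxProd {N : Type*} [Monoid N] {k : ℕ} (F : FreeMonoid (Letter k) →* N) (i j : ℕ) :
    F (wxProd i j) = icoProd (fun l => F (wx l)) i j := map_icoProd F wx i j

/-- The relations `S` hold for the images of the letters under `F`. -/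
def Satisfies {N : Type*} [Monoid N] {k : ℕ} (F : FreeMonoid (Letter k) →* N) (S : Relations k) :
    Prop := ∀ u v, (u, v) ∈ S → F u = F v

theorem Satisfies.union {N : Type*} [Monoid N] {k : ℕ} {F : FreeMonoid (Letter k) →* N}
    {S T : Relations k} (hS : Satisfies F S) (hT : Satisfies F T) : Satisfies F (S ∪ T) := by
  rintro u v (h | h)
  exacts [hS u v h, hT u v h]

section

variable {N : Type*} [Monoid N] {k m : ℕ} (F : FreeMonoid (Letter k) →* N)

theorem wRel_iff (hk : 2 ≤ k) : WRel k (fun i => F (wx i)) ↔ Satisfies F (W k) := by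
  constructor
  · intro h
    rintro u v (((((hu | hu) | hu) | hu) | hu) | hu)
    · obtain ⟨i, h1, h2, hp⟩ := hu
      obtain ⟨rfl, rfl⟩ := Prod.mk.inj hp
      simpa only [map_mul] using h.shift i h1 (by omega)
    · obtain ⟨i, j, h1, h2, h3, hp⟩ := hu
      obtain ⟨rfl, rfl⟩ := Prod.mk.inj hp
      simpa only [map_mul] using h.far i j (by omega) h2 (by omega)
    · rcases hu with hp | hp
      · obtain ⟨rfl, rfl⟩ := Prod.mk.inj hp
        simpa only [map_mul, pow_two] using h.zero_one
      · obtain ⟨rfl, rfl⟩ := Prod.mk.inj hp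
        simpa only [map_mul, pow_two] using h.last_zero.symm
    · rcases hu with hu | hu
      · obtain ⟨i, h1, h2, hp⟩ := hu
        obtain ⟨rfl, rfl⟩ := Prod.mk.inj hp
        simpa only [map_mul] using h.near i h1 (by omega)
      · obtain ⟨i, h1, h2, hp⟩ := hu
        obtain ⟨rfl, rfl⟩ := Prod.mk.inj hp
        simpa only [map_mul] using (h.near' i h1 (by omega)).symm
    · obtain ⟨i, h1, h2, hp⟩ := hu
      obtain ⟨rfl, rfl⟩ := Prod.mk.inj hp
      simpa only [map_mul, map_wxProd] using h.regular i (by omega)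
    · obtain ⟨i, h1, h2, hp⟩ := hu
      obtain ⟨rfl, rfl⟩ := Prod.mk.inj hp
      simpa only [map_mul, map_wxProd, pow_two] using h.square i h1 (by omega)
  · intro h
    constructor
    · intro i h1 h2
      simpa only [map_mul] using
        h _ _ (Or.inl (Or.inl (Or.inl (Or.inl (Or.inl ⟨i, h1, by omega, rfl⟩)))))
    · intro i j h1 h2 h3
      simpa only [map_mul] using
        h _ _ (Or.inl (Or.inl (Or.inl (Or.inl (Or.inr ⟨i, j, by omega, h2, by omega, rfl⟩)))))
    · simpa only [map_mul, pow_two] using h _ _ (Or.inl (Or.inl (Or.inl (Or.inr (Or.inl rfl)))))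
    · simpa only [map_mul, pow_two] using
        (h _ _ (Or.inl (Or.inl (Or.inl (Or.inr (Or.inr rfl)))))).symm
    · intro i h1 h2
      simpa only [map_mul] using
        h _ _ (Or.inl (Or.inl (Or.inr (Or.inl ⟨i, h1, by omega, rfl⟩))))
    · intro i h1 h2
      simpa only [map_mul] using
        (h _ _ (Or.inl (Or.inl (Or.inr (Or.inr ⟨i, h1, by omega, rfl⟩))))).symm
    · intro i h1
      simpa only [map_mul, map_wxProd] using
        h _ _ (Or.inl (Or.inr ⟨i, by omega, by omega, rfl⟩))
    · intro i h1 h2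
      simpa only [map_mul, map_wxProd, pow_two] using h _ _ (Or.inr ⟨i, h1, by omega, rfl⟩)

theorem mixedRel_iff : (MixedRel k (fun i => F (wa i)) (fun i => F (wx i)) ∧
    MixedRel k (fun i => F (wb i)) (fun i => F (wx i))) ↔ Satisfies F (R' k) := by
  constructor
  · rintro ⟨ha, hb⟩
    rintro u v (((((hu | hu) | hu) | hu) | hu) | hu)
    · rcases hu with hp | hp <;> obtain ⟨rfl, rfl⟩ := Prod.mk.inj hp <;> rw [map_mul]
      exacts [ha.fix_zero, hb.fix_zero]
    · rcases hu with ⟨i, h1, h2, hp⟩ | ⟨i, h1, h2, hp⟩ <;> obtain ⟨rfl, rfl⟩ := Prod.mk.inj hp <;>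
        rw [map_mul, map_mul]
      exacts [ha.shift_zero i h1 h2, hb.shift_zero i h1 h2]
    · rcases hu with ⟨i, h1, h2, hp⟩ | ⟨i, h1, h2, hp⟩ <;> obtain ⟨rfl, rfl⟩ := Prod.mk.inj hp <;>
        rw [map_mul]
      exacts [ha.fix_right i h1 h2, hb.fix_right i h1 h2]
    · rcases hu with ⟨i, h1, h2, hp⟩ | ⟨i, h1, h2, hp⟩ <;> obtain ⟨rfl, rfl⟩ := Prod.mk.inj hp <;>
        rw [map_mul]
      exacts [ha.fix_left i h1 h2, hb.fix_left i h1 h2]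
    · rcases hu with ⟨i, h1, h2, hp⟩ | ⟨i, h1, h2, hp⟩ <;> obtain ⟨rfl, rfl⟩ := Prod.mk.inj hp <;>
        rw [map_mul, map_mul]
      exacts [ha.move i h1 h2, hb.move i h1 h2]
    · rcases hu with ⟨i, j, h1, h2, h3, h4, h5, h6, hp⟩ | ⟨i, j, h1, h2, h3, h4, h5, h6, hp⟩ <;>
        obtain ⟨rfl, rfl⟩ := Prod.mk.inj hp <;> rw [map_mul, map_mul]
      exacts [ha.comm i j h1 h2 h3 h4 h5 h6, hb.comm i j h1 h2 h3 h4 h5 h6]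
  · intro h
    refine ⟨⟨?_, ?_, ?_, ?_, ?_, ?_⟩, ⟨?_, ?_, ?_, ?_, ?_, ?_⟩⟩
    · rw [← map_mul]
      exact h _ _ (Or.inl (Or.inl (Or.inl (Or.inl (Or.inl (Or.inl rfl))))))
    · intro i h1 h2
      rw [← map_mul, ← map_mul]
      exact h _ _ (Or.inl (Or.inl (Or.inl (Or.inl (Or.inr (Or.inl ⟨i, h1, h2, rfl⟩))))))
    · intro i h1 h2
      rw [← map_mul]
      exact h _ _ (Or.inl (Or.inl (Or.inl (Or.inr (Or.inl ⟨i, h1, h2, rfl⟩)))))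
    · intro i h1 h2
      rw [← map_mul]
      exact h _ _ (Or.inl (Or.inl (Or.inr (Or.inl ⟨i, h1, h2, rfl⟩))))
    · intro i h1 h2
      rw [← map_mul, ← map_mul]
      exact h _ _ (Or.inl (Or.inr (Or.inl ⟨i, h1, h2, rfl⟩)))
    · intro i j h1 h2 h3 h4 h5 h6
      rw [← map_mul, ← map_mul]
      exact h _ _ (Or.inr (Or.inl ⟨i, j, h1, h2, h3, h4, h5, h6, rfl⟩))
    · rw [← map_mul]
      exact h _ _ (Or.inl (Or.inl (Or.inl (Or.inl (Or.inl (Or.inr rfl))))))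
    · intro i h1 h2
      rw [← map_mul, ← map_mul]
      exact h _ _ (Or.inl (Or.inl (Or.inl (Or.inl (Or.inr (Or.inr ⟨i, h1, h2, rfl⟩))))))
    · intro i h1 h2
      rw [← map_mul]
      exact h _ _ (Or.inl (Or.inl (Or.inl (Or.inr (Or.inr ⟨i, h1, h2, rfl⟩)))))
    · intro i h1 h2
      rw [← map_mul]
      exact h _ _ (Or.inl (Or.inl (Or.inr (Or.inr ⟨i, h1, h2, rfl⟩))))
    · intro i h1 h2
      rw [← map_mul, ← map_mul]
      exact h _ _ (Or.inl (Or.inr (Or.inr ⟨i, h1, h2, rfl⟩)))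
    · intro i j h1 h2 h3 h4 h5 h6
      rw [← map_mul, ← map_mul]
      exact h _ _ (Or.inr (Or.inr ⟨i, j, h1, h2, h3, h4, h5, h6, rfl⟩))

theorem exists_fin_of_le {i : ℕ} (h1 : 1 ≤ i) (h2 : i ≤ k) : ∃ r : Fin k, i = r + 1 :=
  ⟨⟨i - 1, by omega⟩, by simp; omega⟩

theorem POIRel.satisfies (hk : 2 ≤ k) (hm : 2 ≤ m)
    (h : POIRel k m (fun r => F (FreeMonoid.of (Letter.a r)))
      (fun r => F (FreeMonoid.of (Letter.b r))) (fun i => F (wx i))) :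
    Satisfies F (R k m ∪ W k ∪ R' k) := by
  refine Satisfies.union (Satisfies.union ?_ ((wRel_iff F hk).1 h.wRel)) ((mixedRel_iff F).1 ⟨?_, ?_⟩)
  · rintro u v (((((hu | hu) | hu) | hu) | hu) | hu)
    · obtain ⟨i, h1, h2, hp⟩ := hu
      obtain ⟨rfl, rfl⟩ := Prod.mk.inj hp
      obtain ⟨r, rfl⟩ := exists_fin_of_le h1 h2
      simpa only [map_pow, map_one, wa_succ] using (h.moore r).sq
    · obtain ⟨i, h1, h2, hp⟩ := hu
      obtain ⟨rfl, rfl⟩ := Prod.mk.inj hp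
      obtain ⟨r, rfl⟩ := exists_fin_of_le h1 h2
      simpa only [map_pow, map_one, wb_succ] using (h.moore r).pow
    · obtain ⟨i, h1, h2, hp⟩ := hu
      obtain ⟨rfl, rfl⟩ := Prod.mk.inj hp
      obtain ⟨r, rfl⟩ := exists_fin_of_le h1 h2
      simpa only [map_pow, map_mul, map_one, wa_succ, wb_succ] using (h.moore r).prod
    · obtain ⟨i, h1, h2, hp⟩ := hu
      obtain ⟨rfl, rfl⟩ := Prod.mk.inj hp
      obtain ⟨r, rfl⟩ := exists_fin_of_le h1 h2
      simpa only [map_pow, map_mul, map_one, wa_succ, wb_succ] using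
        (h.moore r).braid_of_two_le hm
    · obtain ⟨i, j, h1, h2, h3, h4, hp⟩ := hu
      obtain ⟨rfl, rfl⟩ := Prod.mk.inj hp
      obtain ⟨r, rfl⟩ := exists_fin_of_le h1 h2
      simpa only [map_pow, map_mul, map_one, wa_succ, wb_succ] using (h.moore r).comm j h3 h4
    · rcases hu with (⟨i, j, h1, h2, h3, hp⟩ | ⟨i, j, h1, h2, h3, hp⟩) |
        ⟨i, j, h1, h2, h3, h4, h5, hp⟩ <;> obtain ⟨rfl, rfl⟩ := Prod.mk.inj hp <;>
        obtain ⟨r, rfl⟩ := exists_fin_of_le (k := k) h1 (by omega) <;>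
        obtain ⟨s, rfl⟩ := exists_fin_of_le (i := j) (k := k) (by omega) (by omega)
      · simpa only [map_mul, wa_succ] using (h.comm_a r s (by rintro rfl; omega)).eq
      · simpa only [map_mul, wb_succ] using (h.comm_b r s (by rintro rfl; omega)).eq
      · simpa only [map_mul, wa_succ, wb_succ] using (h.comm_ab r s (by rintro rfl; omega)).eq
  · refine MixedRel.of_follows (by omega) fun i => ?_
    simp only [wa_succ]
    exact h.follows_a i
  · refine MixedRel.of_follows (by omega) fun i => ?_
    simp only [wb_succ]
    exact h.follows_b i

/-- `R4` is required only for `m ≥ 3`, in accordance with `MooreRel`; this makes its deletion for `m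
= 2` possible. -/
theorem POIRel.of_satisfies (hk : 2 ≤ k) (h1 : Satisfies F (R1 k)) (h2 : Satisfies F (R2 k m))
    (h3 : Satisfies F (R3 k m)) (h4 : 3 ≤ m → Satisfies F (R4 k m)) (h5 : Satisfies F (R5 k m))
    (h6 : Satisfies F (R6 k)) (hW : Satisfies F (W k)) (hR' : Satisfies F (R' k)) :
    POIRel k m (fun r => F (FreeMonoid.of (Letter.a r)))
      (fun r => F (FreeMonoid.of (Letter.b r))) (fun i => F (wx i)) := by
  have ha : ∀ r s : Fin k, r < s →
      Commute (F (FreeMonoid.of (Letter.a r))) (F (FreeMonoid.of (Letter.a s))) := fun r s hrs => by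
    simpa only [Commute, SemiconjBy, map_mul, wa_succ] using
      h6 _ _ (Or.inl (Or.inl ⟨r + 1, s + 1, by omega, by omega, by omega, rfl⟩))
  have hb : ∀ r s : Fin k, r < s →
      Commute (F (FreeMonoid.of (Letter.b r))) (F (FreeMonoid.of (Letter.b s))) := fun r s hrs => by
    simpa only [Commute, SemiconjBy, map_mul, wb_succ] using
      h6 _ _ (Or.inl (Or.inr ⟨r + 1, s + 1, by omega, by omega, by omega, rfl⟩))
  refine ⟨fun r => ⟨?_, ?_, ?_, fun hm => ?_, fun j hj hj' => ?_⟩, fun r s hrs => ?_,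
    fun r s hrs => ?_, fun r s hrs => ?_, (wRel_iff F hk).2 hW, fun i => ?_, fun i => ?_⟩
  · simpa only [map_pow, map_one, wa_succ] using h1 _ _ ⟨r + 1, by omega, by omega, rfl⟩
  · simpa only [map_pow, map_one, wb_succ] using h2 _ _ ⟨r + 1, by omega, by omega, rfl⟩
  · simpa only [map_pow, map_mul, map_one, wa_succ, wb_succ] using
      h3 _ _ ⟨r + 1, by omega, by omega, rfl⟩
  · simpa only [map_pow, map_mul, map_one, wa_succ, wb_succ] using
      h4 hm _ _ ⟨r + 1, by omega, by omega, rfl⟩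
  · simpa only [map_pow, map_mul, map_one, wa_succ, wb_succ] using
      h5 _ _ ⟨r + 1, j, by omega, by omega, hj, hj', rfl⟩
  · rcases lt_or_gt_of_ne hrs with h | h
    exacts [ha r s h, (ha s r h).symm]
  · rcases lt_or_gt_of_ne hrs with h | h
    exacts [hb r s h, (hb s r h).symm]
  · simpa only [Commute, SemiconjBy, map_mul, wa_succ, wb_succ] using
      h6 _ _ (Or.inr ⟨r + 1, s + 1, by omega, by omega, by omega, by omega, by
        simpa [Fin.ext_iff] using hrs, rfl⟩)
  · simpa only [wa_succ] using ((mixedRel_iff F).2 hR').1.follows i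
  · simpa only [wb_succ] using ((mixedRel_iff F).2 hR').2.follows i

end

theorem genVal_mem_POI {k m : ℕ} (hm : 2 ≤ m) (l : Letter k) : genVal hm l ∈ POI k m := by
  cases l with
  | a r => exact blockPerm_mem_POI _
  | b r => exact blockPerm_mem_POI _
  | x i => exact inflate_mem_POI (orderPreserving_xPoint k i)

/-- A set of the given relations defines `POI_{k×m}` if it contains all of them, with the possible
exception of `R4` for `m = 2`. -/
theorem defines_of_subset {k m : ℕ} (hk : 2 ≤ k) (hm : 2 ≤ m) {S : Relations k}
    (hS : S ⊆ R k m ∪ W k ∪ R' k) (h1 : R1 k ⊆ S) (h2 : R2 k m ⊆ S) (h3 : R3 k m ⊆ S)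
    (h4 : 3 ≤ m → R4 k m ⊆ S) (h5 : R5 k m ⊆ S) (h6 : R6 k ⊆ S) (hW : W k ⊆ S) (hR' : R' k ⊆ S) :
    Defines hm S := by
  let F := PresentedMonoid.mk fun u v => (u, v) ∈ S
  have hF : ∀ T ⊆ S, Satisfies F T := fun T hT u v huv =>
    PresentedMonoid.mk_eq_mk_of_rel (hT huv)
  have hrel := POIRel.of_satisfies F hk (hF _ h1) (hF _ h2) (hF _ h3) (fun hm => hF _ (h4 hm))
    (hF _ h5) (hF _ h6) (hF _ hW) (hF _ hR')
  let G := FreeMonoid.lift (genVal (k := k) hm)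
  have hG : Satisfies G (R k m ∪ W k ∪ R' k) := by
    refine POIRel.satisfies G hk hm ?_
    have hx : (fun i => G (wx i)) = fun i => inflateHom k m (xGen k i) := by
      funext i
      rw [wx, xGen]
      split_ifs with hi
      · rw [FreeMonoid.lift_eval_of]
        rfl
      · rw [map_one, map_one]
    have := poiRel_generators hk hm
    rw [hx]
    simpa only [G, FreeMonoid.lift_eval_of, genVal_a, genVal_b] using this
  let f : Letter k → POI k m := fun l => ⟨genVal hm l, genVal_mem_POI hm l⟩
  have hf : ∀ w, (FreeMonoid.lift f w : Fin (k * m) ≃. Fin (k * m)) = G w := by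
    intro w
    have : (POI k m).subtype.comp (FreeMonoid.lift f) = G := by
      refine FreeMonoid.hom_eq fun l => ?_
      rw [MonoidHom.comp_apply, FreeMonoid.lift_eval_of, FreeMonoid.lift_eval_of]
      rfl
    exact DFunLike.congr_fun this w
  -- Well defined because the standard generators satisfy the full set of relations, of which `S` is
  -- a part.
  let π : PresentedMonoid (fun u v => (u, v) ∈ S) →* POI k m :=
    PresentedMonoid.lift f fun u v huv => Subtype.ext (by rw [hf, hf]; exact hG u v (hS huv))
  have hπ : ∀ l, (π (PresentedMonoid.of _ l) : Fin (k * m) ≃. Fin (k * m)) = genVal hm l :=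
    fun l => congrArg Subtype.val (PresentedMonoid.lift_of (f := f) _)
  have hx : ∀ i : Fin k, F (wx i) = PresentedMonoid.of _ (Letter.x i) := fun i =>
    congrArg F (wx_val i)
  have hgen : Submonoid.closure (Set.range (fun r => F (FreeMonoid.of (Letter.a r))) ∪
      Set.range (fun r => F (FreeMonoid.of (Letter.b r))) ∪
      Set.range fun i : Fin k => F (wx i)) = ⊤ := by
    rw [eq_top_iff, ← PresentedMonoid.closure_range_of, Submonoid.closure_le]
    rintro _ ⟨l, rfl⟩
    refine Submonoid.subset_closure ?_
    cases l with
    | a r => exact Or.inl (Or.inl ⟨r, rfl⟩)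
    | b r => exact Or.inl (Or.inr ⟨r, rfl⟩)
    | x i => exact Or.inr ⟨i, hx i⟩
  obtain ⟨hinj, hsurj⟩ := hrel.injective_and_surjective hk hm hgen ((POI k m).subtype.comp π)
    (fun r => (hπ _).trans (genVal_a hm r)) (fun r => (hπ _).trans (genVal_b hm r))
    (fun i => by
      rw [hx]
      exact hπ (Letter.x i))
  refine ⟨MulEquiv.ofBijective π ⟨fun n n' h => hinj (congrArg Subtype.val h), fun α => ?_⟩, hπ⟩
  obtain ⟨n, hn⟩ := hsurj α α.2
  exact ⟨n, Subtype.ext hn⟩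

end POIPresentation

namespace POIPresentation

/-! ### The number of relations -/

section

variable {k m : ℕ}

/-- The weight of a word, where the letters `a_i`, `b_i` and `x_i` have weights `fa i`, `fb i` and
`fx i`. -/
def wt (fa fb fx : ℕ → ℕ) (w : FreeMonoid (Letter k)) : ℕ :=
  (w.toList.map fun
    | .a r => fa (r + 1)
    | .b r => fb (r + 1)
    | .x i => fx i).sum

variable {fa fb fx : ℕ → ℕ}

theorem wt_one : wt fa fb fx (1 : FreeMonoid (Letter k)) = 0 := rfl

theorem wt_mul (u v : FreeMonoid (Letter k)) :
    wt fa fb fx (u * v) = wt fa fb fx u + wt fa fb fx v := by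
  simp [wt]

theorem wt_pow (u : FreeMonoid (Letter k)) (n : ℕ) :
    wt fa fb fx (u ^ n) = n * wt fa fb fx u := by
  induction n with
  | zero => simp [wt_one]
  | succ n ih => rw [pow_succ, wt_mul, ih, Nat.succ_mul]

theorem wt_wa {i : ℕ} (h1 : 1 ≤ i) (h2 : i ≤ k) :
    wt fa fb fx (wa i : FreeMonoid (Letter k)) = fa i := by
  obtain ⟨r, rfl⟩ := exists_fin_of_le h1 h2
  rw [wa_succ]
  simp [wt]

theorem wt_wb {i : ℕ} (h1 : 1 ≤ i) (h2 : i ≤ k) :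
    wt fa fb fx (wb i : FreeMonoid (Letter k)) = fb i := by
  obtain ⟨r, rfl⟩ := exists_fin_of_le h1 h2
  rw [wb_succ]
  simp [wt]

theorem wt_wx {i : ℕ} (h : i < k) : wt fa fb fx (wx i : FreeMonoid (Letter k)) = fx i := by
  obtain ⟨r, rfl⟩ : ∃ r : Fin k, i = r := ⟨⟨i, h⟩, rfl⟩
  rw [wx_val]
  simp [wt]

theorem wt_wxProd {i j : ℕ} (h : j ≤ k) :
    wt fa fb fx (wxProd i j : FreeMonoid (Letter k)) = ∑ l ∈ Finset.Ico i j, fx l := by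
  rcases le_total j i with hij | hij
  · rw [Finset.Ico_eq_empty_of_le hij, wxProd, List.Ico.eq_nil_of_le hij]
    rfl
  · induction j, hij using Nat.le_induction with
    | base => simp [wxProd, wt_one]
    | succ j hij ih =>
      rw [Finset.sum_Ico_succ_top hij, ← ih (by omega), ← wt_wx (fa := fa) (fb := fb) (fx := fx) (k := k) h,
        ← wt_mul]
      simp [wxProd, List.Ico.succ_top hij]

/-- The number of letters `a_i` and `b_i`. -/
abbrev numAB : FreeMonoid (Letter k) → ℕ := wt (fun _ => 1) (fun _ => 1) (fun _ => 0)

/-- The number of letters `a_i`. -/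
abbrev numA : FreeMonoid (Letter k) → ℕ := wt (fun _ => 1) (fun _ => 0) (fun _ => 0)

/-- The number of letters `x_i`. -/
abbrev numX : FreeMonoid (Letter k) → ℕ := wt (fun _ => 0) (fun _ => 0) (fun _ => 1)

/-- The number of letters `x_0`. -/
abbrev numZero : FreeMonoid (Letter k) → ℕ :=
  wt (fun _ => 0) (fun _ => 0) (fun i => if i = 0 then 1 else 0)

/-- The sum of the indices of all the letters. -/
abbrev sumAll : FreeMonoid (Letter k) → ℕ := wt id id id

/-! ### Letter counts that separate the families of relations -/

theorem profile_R1 {u v : FreeMonoid (Letter k)} (h : (u, v) ∈ R1 k) :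
    numX u = 0 ∧ numAB u = 2 ∧ numA u = 2 ∧ numAB v = 0 := by
  obtain ⟨i, h1, h2, hp⟩ := h
  obtain ⟨rfl, rfl⟩ := Prod.mk.inj hp
  refine ⟨?_, ?_, ?_, ?_⟩ <;> simp (disch := omega) only [wt_pow, wt_one, wt_wa]

theorem profile_R2 {u v : FreeMonoid (Letter k)} (h : (u, v) ∈ R2 k m) :
    numX u = 0 ∧ numAB u = m ∧ numA u = 0 ∧ numAB v = 0 := by
  obtain ⟨i, h1, h2, hp⟩ := h
  obtain ⟨rfl, rfl⟩ := Prod.mk.inj hp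
  refine ⟨?_, ?_, ?_, ?_⟩ <;> simp (disch := omega) only [wt_pow, wt_one, wt_wb] <;> omega

theorem profile_R3 {u v : FreeMonoid (Letter k)} (h : (u, v) ∈ R3 k m) :
    numX u = 0 ∧ numAB u = (m - 1) * 2 ∧ numA u = m - 1 ∧ numAB v = 0 := by
  obtain ⟨i, h1, h2, hp⟩ := h
  obtain ⟨rfl, rfl⟩ := Prod.mk.inj hp
  refine ⟨?_, ?_, ?_, ?_⟩ <;> simp (disch := omega) only [wt_mul, wt_pow, wt_one, wt_wa, wt_wb] <;> omega

theorem profile_R4 {u v : FreeMonoid (Letter k)} (h : (u, v) ∈ R4 k m) :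
    numX u = 0 ∧ numAB u = 3 * (3 + (m - 1)) ∧ numA u = 6 ∧ numAB v = 0 := by
  obtain ⟨i, h1, h2, hp⟩ := h
  obtain ⟨rfl, rfl⟩ := Prod.mk.inj hp
  refine ⟨?_, ?_, ?_, ?_⟩ <;> simp (disch := omega) only [wt_mul, wt_pow, wt_one, wt_wa, wt_wb] <;> omega

theorem profile_R5 {u v : FreeMonoid (Letter k)} (h : (u, v) ∈ R5 k m) :
    numX u = 0 ∧ numAB u = 2 * (2 + m) ∧ numA u = 4 ∧ numAB v = 0 := by
  obtain ⟨i, j, h1, h2, h3, h4, hp⟩ := h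
  obtain ⟨rfl, rfl⟩ := Prod.mk.inj hp
  refine ⟨?_, ?_, ?_, ?_⟩ <;> simp (disch := omega) only [wt_mul, wt_pow, wt_one, wt_wa, wt_wb] <;> omega

theorem profile_R6 {u v : FreeMonoid (Letter k)} (h : (u, v) ∈ R6 k) :
    numX u = 0 ∧ numAB u = 2 ∧ numAB v = 2 := by
  rcases h with (⟨i, j, h1, h2, h3, hp⟩ | ⟨i, j, h1, h2, h3, hp⟩) |
    ⟨i, j, h1, h2, h3, h4, h5, hp⟩ <;> obtain ⟨rfl, rfl⟩ := Prod.mk.inj hp <;>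
    simp (disch := omega) only [wt_mul, wt_wa, wt_wb] <;> simp

/-- The left sides separate the three sets: those of `R` contain no `x_i`, those of `W` no `a_i` or
`b_i` but some `x_i`, those of `R'` exactly one letter of each sort. -/
theorem profile_R {u v : FreeMonoid (Letter k)} (h : (u, v) ∈ R k m) : numX u = 0 := by
  rcases h with ((((h | h) | h) | h) | h) | h
  exacts [(profile_R1 h).1, (profile_R2 h).1, (profile_R3 h).1, (profile_R4 h).1,
    (profile_R5 h).1, (profile_R6 h).1]

theorem profile_W1 {u v : FreeMonoid (Letter k)} (h : (u, v) ∈ W1 k) :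
    numAB u = 0 ∧ numX u = 2 ∧ numX v = 2 ∧ numZero u = 1 := by
  obtain ⟨i, h1, h2, hp⟩ := h
  obtain ⟨rfl, rfl⟩ := Prod.mk.inj hp
  refine ⟨?_, ?_, ?_, ?_⟩ <;> simp (disch := omega) only [wt_mul, wt_wx]
  split_ifs <;> omega

theorem profile_W2 {u v : FreeMonoid (Letter k)} (h : (u, v) ∈ W2 k) :
    numAB u = 0 ∧ numX u = 2 ∧ numX v = 2 ∧ numZero u = 0 := by
  obtain ⟨i, j, h1, h2, h3, hp⟩ := h
  obtain ⟨rfl, rfl⟩ := Prod.mk.inj hp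
  refine ⟨?_, ?_, ?_, ?_⟩ <;> simp (disch := omega) only [wt_mul, wt_wx]
  split_ifs <;> omega

theorem profile_W3 (hk : 2 ≤ k) {u v : FreeMonoid (Letter k)} (h : (u, v) ∈ W3 k) :
    numAB u = 0 ∧ numX u + numX v = 5 ∧ numZero u = 2 ∧ 2 ≤ numX u ∧ 2 ≤ numX v := by
  rcases h with hp | hp <;> obtain ⟨rfl, rfl⟩ := Prod.mk.inj hp <;>
    refine ⟨?_, ?_, ?_, ?_, ?_⟩ <;> simp (disch := omega) only [wt_mul, wt_pow, wt_wx] <;>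
    first | omega | simp

theorem profile_W4 {u v : FreeMonoid (Letter k)} (h : (u, v) ∈ W4 k) :
    numAB u = 0 ∧ numX u + numX v = 5 ∧ numZero u = 0 ∧ 2 ≤ numX u ∧ 2 ≤ numX v := by
  rcases h with ⟨i, h1, h2, hp⟩ | ⟨i, h1, h2, hp⟩ <;> obtain ⟨rfl, rfl⟩ := Prod.mk.inj hp <;>
    refine ⟨?_, ?_, ?_, ?_, ?_⟩ <;> simp (disch := omega) only [wt_mul, wt_wx] <;>
    first | omega | (simp; omega)

theorem profile_W5 (hk : 2 ≤ k) {u v : FreeMonoid (Letter k)} (h : (u, v) ∈ W5 k) :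
    numAB u = 0 ∧ numX u = k + 1 ∧ numX v = 1 := by
  obtain ⟨i, h1, h2, hp⟩ := h
  obtain ⟨rfl, rfl⟩ := Prod.mk.inj hp
  simp (disch := omega) only [wt_mul, wt_wx, wt_wxProd]
  simp
  omega

theorem profile_W6 {u v : FreeMonoid (Letter k)} (h : (u, v) ∈ W6 k) :
    numAB u = 0 ∧ numX u = k + 1 ∧ numX v = 2 ∧ numZero u = 1 := by
  obtain ⟨i, h1, h2, hp⟩ := h
  obtain ⟨rfl, rfl⟩ := Prod.mk.inj hp
  simp (disch := omega) only [wt_mul, wt_pow, wt_wx, wt_wxProd]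
  have h3 : i ≠ 0 := by omega
  simp [h3]
  omega

theorem profile_W (hk : 2 ≤ k) {u v : FreeMonoid (Letter k)} (h : (u, v) ∈ W k) :
    numAB u = 0 ∧ numX u ≠ 0 := by
  rcases h with ((((h | h) | h) | h) | h) | h
  · have := profile_W1 h; omega
  · have := profile_W2 h; omega
  · have := profile_W3 hk h; omega
  · have := profile_W4 h; omega
  · have := profile_W5 hk h; omega
  · have := profile_W6 h; omega

theorem profile_R'1 (hk : 2 ≤ k) {u v : FreeMonoid (Letter k)} (h : (u, v) ∈ R'1 k) :
    numAB u = 1 ∧ numX u = 1 ∧ numAB v = 0 ∧ numZero u = 1 ∧ sumAll u = 1 := by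
  rcases h with hp | hp <;> obtain ⟨rfl, rfl⟩ := Prod.mk.inj hp <;>
    simp (disch := omega) only [wt_mul, wt_wx, wt_wa, wt_wb] <;> simp

theorem profile_R'2 {u v : FreeMonoid (Letter k)} (h : (u, v) ∈ R'2 k) :
    numAB u = 1 ∧ numX u = 1 ∧ numAB v = 1 ∧ numZero u = 1 := by
  rcases h with ⟨i, h1, h2, hp⟩ | ⟨i, h1, h2, hp⟩ <;> obtain ⟨rfl, rfl⟩ := Prod.mk.inj hp <;>
    simp (disch := omega) only [wt_mul, wt_wx, wt_wa, wt_wb] <;> simp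

theorem profile_R'3 (hk : 2 ≤ k) {u v : FreeMonoid (Letter k)} (h : (u, v) ∈ R'3 k) :
    numAB u = 1 ∧ numX u = 1 ∧ numAB v = 0 ∧ sumAll u = k := by
  rcases h with ⟨i, h1, h2, hp⟩ | ⟨i, h1, h2, hp⟩ <;> obtain ⟨rfl, rfl⟩ := Prod.mk.inj hp <;>
    simp (disch := omega) only [wt_mul, wt_wx, wt_wa, wt_wb] <;> simp <;> omega

theorem profile_R'4 {u v : FreeMonoid (Letter k)} (h : (u, v) ∈ R'4 k) :
    numAB u = 1 ∧ numX u = 1 ∧ numAB v = 0 ∧ sumAll u = k + 1 := by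
  rcases h with ⟨i, h1, h2, hp⟩ | ⟨i, h1, h2, hp⟩ <;> obtain ⟨rfl, rfl⟩ := Prod.mk.inj hp <;>
    simp (disch := omega) only [wt_mul, wt_wx, wt_wa, wt_wb] <;> simp <;> omega

theorem profile_R'5 {u v : FreeMonoid (Letter k)} (h : (u, v) ∈ R'5 k) :
    numAB u = 1 ∧ numX u = 1 ∧ numAB v = 1 ∧ numZero u = 0 ∧ sumAll u = k + 1 := by
  rcases h with ⟨i, h1, h2, hp⟩ | ⟨i, h1, h2, hp⟩ <;> obtain ⟨rfl, rfl⟩ := Prod.mk.inj hp <;>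
    simp (disch := omega) only [wt_mul, wt_wx, wt_wa, wt_wb] <;> simp <;> omega

theorem profile_R'6 {u v : FreeMonoid (Letter k)} (h : (u, v) ∈ R'6 k) :
    numAB u = 1 ∧ numX u = 1 ∧ numAB v = 1 ∧ numZero u = 0 ∧ sumAll u ≠ k + 1 := by
  rcases h with ⟨i, j, h1, h2, h3, h4, h5, h6, hp⟩ | ⟨i, j, h1, h2, h3, h4, h5, h6, hp⟩ <;>
    obtain ⟨rfl, rfl⟩ := Prod.mk.inj hp <;>
    simp (disch := omega) only [wt_mul, wt_wx, wt_wa, wt_wb] <;> simp <;> omega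

theorem profile_R' (hk : 2 ≤ k) {u v : FreeMonoid (Letter k)} (h : (u, v) ∈ R' k) :
    numAB u = 1 ∧ numX u = 1 := by
  rcases h with ((((h | h) | h) | h) | h) | h
  · have := profile_R'1 hk h; omega
  · have := profile_R'2 h; omega
  · have := profile_R'3 hk h; omega
  · have := profile_R'4 h; omega
  · have := profile_R'5 h; omega
  · have := profile_R'6 h; omega

/-! ### Cardinalities of the families -/

theorem encard_union_of_disjoint {α : Type*} {S T : Set α} {s t : ℕ} (hS : S.encard = s)
    (hT : T.encard = t) (h : ∀ p ∈ S, p ∉ T) : (S ∪ T).encard = (s + t : ℕ) := by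
  rw [Set.encard_union_eq (Set.disjoint_left.2 h), hS, hT, Nat.cast_add]

theorem encard_of_param {α β : Type*} (s : Finset α) (φ : α → β) (hφ : Set.InjOn φ s) {S : Set β}
    (hS : ∀ p, p ∈ S ↔ ∃ a ∈ s, p = φ a) : S.encard = s.card := by
  have : S = φ '' s := by
    ext p
    simp only [hS, Set.mem_image, Finset.mem_coe, eq_comm]
  rw [this, hφ.encard_image, Set.encard_coe_eq_coe_finsetCard]

theorem encard_Icc_family {β : Type*} {lo hi : ℕ} (φ : ℕ → β)
    (hφ : ∀ i i', lo ≤ i → i ≤ hi → lo ≤ i' → i' ≤ hi → φ i = φ i' → i = i') :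
    {p | ∃ i, lo ≤ i ∧ i ≤ hi ∧ p = φ i}.encard = (hi + 1 - lo : ℕ) := by
  rw [← Nat.card_Icc]
  refine encard_of_param _ φ (fun i hi i' hi' h => ?_) fun p => ?_
  · rw [Finset.mem_coe, Finset.mem_Icc] at hi hi'
    exact hφ i i' hi.1 hi.2 hi'.1 hi'.2 h
  · simp only [Finset.mem_Icc, Set.mem_ofPred_eq, and_assoc]

/-- As in most of the families below, a suitable sum of letter indices recovers the parameter, so
distinct parameters give distinct relations. -/
theorem encard_R1 : (R1 k).encard = k :=
  encard_Icc_family _ fun i i' h1 h2 h3 h4 h => by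
    have := congrArg (fun p => wt id id id p.1) h
    simp (disch := omega) only [wt_pow, wt_wa, id] at this
    omega

theorem encard_R2 (hm : 2 ≤ m) : (R2 k m).encard = k :=
  encard_Icc_family _ fun i i' h1 h2 h3 h4 h => by
    have := congrArg (fun p => wt id id id p.1) h
    simp (disch := omega) only [wt_pow, wt_wb, id] at this
    exact Nat.eq_of_mul_eq_mul_left (by omega) this

theorem encard_R3 (hm : 2 ≤ m) : (R3 k m).encard = k :=
  encard_Icc_family _ fun i i' h1 h2 h3 h4 h => by
    have := congrArg (fun p => wt id id id p.1) h
    simp (disch := omega) only [wt_pow, wt_mul, wt_wa, wt_wb, id] at this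
    have := Nat.eq_of_mul_eq_mul_left (by omega) this
    omega

theorem encard_R4 : (R4 k m).encard = k :=
  encard_Icc_family _ fun i i' h1 h2 h3 h4 h => by
    have := congrArg (fun p => wt id (fun _ => 0) id p.1) h
    simp (disch := omega) only [wt_pow, wt_mul, wt_wa, wt_wb, id] at this
    omega

/-- A representation of words by functions, `a_i` doubling and `b_i` incrementing the argument. -/
def affineRep (k : ℕ) : FreeMonoid (Letter k) →* Function.End ℕ :=
  FreeMonoid.lift fun
    | .a _ => (fun n : ℕ => 2 * n : ℕ → ℕ)
    | .b _ => (fun n : ℕ => n + 1 : ℕ → ℕ)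
    | .x _ => 1

theorem affineRep_mul (u v : FreeMonoid (Letter k)) (n : ℕ) :
    affineRep k (u * v) n = affineRep k u (affineRep k v n) := by
  rw [map_mul]
  rfl

theorem affineRep_wa {i : ℕ} (h1 : 1 ≤ i) (h2 : i ≤ k) (n : ℕ) :
    affineRep k (wa i) n = 2 * n := by
  obtain ⟨r, rfl⟩ := exists_fin_of_le h1 h2
  rw [wa_succ, affineRep, FreeMonoid.lift_eval_of]

theorem affineRep_wb_pow {i : ℕ} (h1 : 1 ≤ i) (h2 : i ≤ k) (j n : ℕ) :
    affineRep k (wb i ^ j) n = n + j := by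
  obtain ⟨r, rfl⟩ := exists_fin_of_le h1 h2
  induction j generalizing n with
  | zero =>
    rw [pow_zero, map_one]
    rfl
  | succ j ih =>
    have : affineRep k (wb (r + 1)) n = n + 1 := by
      rw [wb_succ, affineRep, FreeMonoid.lift_eval_of]
    rw [pow_succ, affineRep_mul, this, ih]
    omega

theorem encard_R5 : (R5 k m).encard = (k * (m - 3) : ℕ) := by
  rw [show k * (m - 3) = (Finset.Icc 1 k ×ˢ Finset.Icc 2 (m - 2)).card by
    rw [Finset.card_product, Nat.card_Icc, Nat.card_Icc]
    congr 1]
  refine encard_of_param _ (fun q : ℕ × ℕ =>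
    ((wa q.1 * wb q.1 ^ (m - q.2) * wa q.1 * wb q.1 ^ q.2) ^ 2, 1)) ?_ fun p => ?_
  · rintro ⟨i, j⟩ hq ⟨i', j'⟩ hq' h
    simp only [Finset.mem_coe, Finset.mem_product, Finset.mem_Icc] at hq hq'
    have h1 := congrArg (fun p => wt id (fun _ => 0) id p.1) h
    simp (disch := omega) only [wt_pow, wt_mul, wt_wa, wt_wb, id] at h1
    obtain rfl : i = i' := by omega
    -- The letter counts do not depend on `j`, so an order sensitive invariant is needed: the left
    -- side evaluates at `0` to `10 * (m + j)`.
    have h2 := congrArg (fun p => affineRep k p.1 0) h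
    simp (disch := omega) only [pow_two, affineRep_mul, affineRep_wa, affineRep_wb_pow] at h2
    rw [Prod.mk.injEq]
    omega
  · simp only [Finset.mem_product, Finset.mem_Icc, Prod.exists, and_assoc]
    rfl

theorem toList_wa {i : ℕ} (h1 : 1 ≤ i) (h2 : i ≤ k) :
    (wa i : FreeMonoid (Letter k)).toList = [Letter.a ⟨i - 1, by omega⟩] := by
  rw [wa, dif_pos ⟨h1, h2⟩, FreeMonoid.toList_of]

theorem toList_wb {i : ℕ} (h1 : 1 ≤ i) (h2 : i ≤ k) :
    (wb i : FreeMonoid (Letter k)).toList = [Letter.b ⟨i - 1, by omega⟩] := by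
  rw [wb, dif_pos ⟨h1, h2⟩, FreeMonoid.toList_of]

theorem toList_wx {i : ℕ} (h : i < k) :
    (wx i : FreeMonoid (Letter k)).toList = [Letter.x ⟨i, h⟩] := by
  rw [wx, dif_pos h, FreeMonoid.toList_of]

theorem encard_pairs {β : Type*} (n : ℕ) (φ : ℕ → ℕ → β)
    (hφ : ∀ i j i' j', 1 ≤ i → i < j → j ≤ n → 1 ≤ i' → i' < j' → j' ≤ n → φ i j = φ i' j' →
      i = i' ∧ j = j') :
    {p | ∃ i j, 1 ≤ i ∧ i < j ∧ j ≤ n ∧ p = φ i j}.encard = (n.choose 2 : ℕ) := by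
  -- Pairs are grouped by the larger index `j`, which leaves `j - 1` choices for `i`.
  have hcard : n.choose 2 = ((Finset.range (n + 1)).sigma fun j => Finset.Ico 1 j).card := by
    rw [Finset.card_sigma, Finset.sum_range_succ', Nat.choose_two_right, ← Finset.sum_range_id]
    simp
  rw [hcard]
  refine encard_of_param _ (fun q : (_ : ℕ) × ℕ => φ q.2 q.1) ?_ fun p => ?_
  · rintro ⟨j, i⟩ hq ⟨j', i'⟩ hq' h
    simp only [Finset.mem_coe, Finset.mem_sigma, Finset.mem_Ico, Finset.mem_range] at hq hq'
    obtain ⟨rfl, rfl⟩ := hφ i j i' j' (by omega) (by omega) (by omega) (by omega) (by omega)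
      (by omega) h
    rfl
  · simp only [Finset.mem_sigma, Finset.mem_Ico, Finset.mem_range, Set.mem_ofPred_eq]
    constructor
    · rintro ⟨i, j, h1, h2, h3, rfl⟩
      exact ⟨⟨j, i⟩, by simp only; omega, rfl⟩
    · rintro ⟨⟨j, i⟩, h, rfl⟩
      simp only at h
      exact ⟨i, j, by omega, by omega, by omega, rfl⟩

theorem encard_R6 : (R6 k).encard = (k.choose 2 + k.choose 2 + (k * k - k) : ℕ) := by
  refine encard_union_of_disjoint (encard_union_of_disjoint
    (encard_pairs k _ fun i j i' j' h1 h2 h3 h4 h5 h6 h => ?_)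
    (encard_pairs k _ fun i j i' j' h1 h2 h3 h4 h5 h6 h => ?_) ?_) ?_ ?_
  · have := congrArg (fun p => p.1.toList) h
    simp (disch := omega) only [FreeMonoid.toList_mul, toList_wa, List.cons_append,
      List.nil_append, List.cons.injEq, Letter.a.injEq, Fin.mk.injEq] at this
    omega
  · have := congrArg (fun p => p.1.toList) h
    simp (disch := omega) only [FreeMonoid.toList_mul, toList_wb, List.cons_append,
      List.nil_append, List.cons.injEq, Letter.b.injEq, Fin.mk.injEq] at this
    omega
  · rintro _ ⟨i, j, h1, h2, h3, rfl⟩ ⟨i', j', h4, h5, h6, h⟩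
    have := congrArg (fun p => numA p.1) h
    simp (disch := omega) only [wt_mul, wt_wa, wt_wb] at this
    omega
  · have hcard : k * k - k = (Finset.Icc 1 k).offDiag.card := by
      rw [Finset.offDiag_card, Nat.card_Icc, Nat.add_sub_cancel]
    rw [hcard]
    refine encard_of_param _ (fun q : ℕ × ℕ => (wa q.1 * wb q.2, wb q.2 * wa q.1)) ?_ fun p => ?_
    · rintro ⟨i, j⟩ hq ⟨i', j'⟩ hq' h
      simp only [Finset.mem_coe, Finset.mem_offDiag, Finset.mem_Icc] at hq hq'
      have ha := congrArg (fun p => wt id (fun _ => 0) id p.1) h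
      have hb := congrArg (fun p => wt (fun _ => 0) id id p.1) h
      simp (disch := omega) only [wt_mul, wt_wa, wt_wb, id] at ha hb
      rw [Prod.mk.injEq]
      omega
    · simp only [Finset.mem_offDiag, Finset.mem_Icc, Prod.exists, and_assoc]
      rfl
  · rintro _ (⟨i, j, h1, h2, h3, rfl⟩ | ⟨i, j, h1, h2, h3, rfl⟩) ⟨i', j', h4, h5, h6, h7, h8, h⟩ <;>
      have := congrArg (fun p => numA p.1) h <;>
      simp (disch := omega) only [wt_mul, wt_wa, wt_wb] at this <;> omega

theorem encard_R (hm : 2 ≤ m) : (R k m).encard =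
    (k + k + k + k + k * (m - 3) + (k.choose 2 + k.choose 2 + (k * k - k)) : ℕ) := by
  refine encard_union_of_disjoint (encard_union_of_disjoint (encard_union_of_disjoint
    (encard_union_of_disjoint (encard_union_of_disjoint encard_R1 (encard_R2 hm) ?_)
    (encard_R3 hm) ?_) encard_R4 ?_) encard_R5 ?_) encard_R6 ?_
  · rintro ⟨u, v⟩ h h'
    have := profile_R1 h
    have := profile_R2 h'
    omega
  · rintro ⟨u, v⟩ (h | h) h' <;> have := profile_R3 h'
    · have := profile_R1 h
      omega
    · have := profile_R2 h
      omega
  · rintro ⟨u, v⟩ ((h | h) | h) h' <;> have := profile_R4 h'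
    · have := profile_R1 h
      omega
    · have := profile_R2 h
      omega
    · have := profile_R3 h
      omega
  · rintro ⟨u, v⟩ (((h | h) | h) | h) h' <;> have := profile_R5 h'
    · have := profile_R1 h
      omega
    · have := profile_R2 h
      omega
    · have := profile_R3 h
      omega
    · have := profile_R4 h
      omega
  · rintro ⟨u, v⟩ ((((h | h) | h) | h) | h) h' <;> have := profile_R6 h'
    · have := profile_R1 h
      omega
    · have := profile_R2 h
      omega
    · have := profile_R3 h
      omega
    · have := profile_R4 h
      omega
    · have := profile_R5 h
      omega

theorem encard_W1 : (W1 k).encard = (k - 2 : ℕ) :=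
  encard_Icc_family _ fun i i' h1 h2 h3 h4 h => by
    have := congrArg (fun p => wt id id id p.1) h
    simp (disch := omega) only [wt_mul, wt_wx, id] at this
    omega

theorem encard_W2 : (W2 k).encard = ((k - 2).choose 2 : ℕ) := by
  -- Replacing `j` by `j - 1` turns `i + 1 < j ≤ k - 1` into `i < j ≤ k - 2`.
  have : W2 k = {p | ∃ i j, 1 ≤ i ∧ i < j ∧ j ≤ k - 2 ∧
      p = (wx (j + 1) * wx i, wx i * wx (j + 1))} := by
    ext p
    constructor
    · rintro ⟨i, j, h1, h2, h3, rfl⟩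
      exact ⟨i, j - 1, by omega, by omega, by omega, by rw [Nat.sub_add_cancel (by omega)]⟩
    · rintro ⟨i, j, h1, h2, h3, rfl⟩
      exact ⟨i, j + 1, by omega, by omega, by omega, rfl⟩
  rw [this]
  refine encard_pairs _ _ fun i j i' j' h1 h2 h3 h4 h5 h6 h => ?_
  have := congrArg (fun p => p.1.toList) h
  simp (disch := omega) only [FreeMonoid.toList_mul, toList_wx, List.cons_append,
    List.nil_append, List.cons.injEq, Letter.x.injEq, Fin.mk.injEq] at this
  omega

theorem encard_W3 (hk : 2 ≤ k) : (W3 k).encard = 2 := by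
  refine Set.encard_pair fun h => ?_
  have := congrArg (fun p => numX p.1) h
  simp (disch := omega) only [wt_mul, wt_pow, wt_wx] at this
  omega

theorem encard_W4 : (W4 k).encard = (k - 2 + (k - 2) : ℕ) := by
  refine encard_union_of_disjoint (encard_Icc_family _ fun i i' h1 h2 h3 h4 h => ?_)
    (encard_Icc_family _ fun i i' h1 h2 h3 h4 h => ?_) ?_
  · have := congrArg (fun p => wt id id id p.2) h
    simp (disch := omega) only [wt_mul, wt_wx, id] at this
    omega
  · have := congrArg (fun p => wt id id id p.1) h
    simp (disch := omega) only [wt_mul, wt_wx, id] at this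
    omega
  · rintro _ ⟨i, h1, h2, rfl⟩ ⟨i', h3, h4, h⟩
    have := congrArg (fun p => numX p.1) h
    simp (disch := omega) only [wt_mul, wt_wx] at this
    omega

theorem encard_W5 (hk : 2 ≤ k) : (W5 k).encard = (k - 1 + 1 : ℕ) :=
  encard_Icc_family _ fun i i' h1 h2 h3 h4 h => by
    have := congrArg (fun p => wt id id id p.2) h
    simpa (disch := omega) only [wt_wx, id] using this

theorem encard_W6 : (W6 k).encard = (k - 1 : ℕ) :=
  encard_Icc_family _ fun i i' h1 h2 h3 h4 h => by
    have := congrArg (fun p => wt id id id p.2) h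
    simp (disch := omega) only [wt_pow, wt_wx, id] at this
    omega

theorem encard_W (hk : 2 ≤ k) : (W k).encard =
    (k - 2 + (k - 2).choose 2 + 2 + (k - 2 + (k - 2)) + (k - 1 + 1) + (k - 1) : ℕ) := by
  refine encard_union_of_disjoint (encard_union_of_disjoint (encard_union_of_disjoint
    (encard_union_of_disjoint (encard_union_of_disjoint encard_W1 encard_W2 ?_)
    (encard_W3 hk) ?_) encard_W4 ?_) (encard_W5 hk) ?_) encard_W6 ?_
  · rintro ⟨u, v⟩ h h'
    have := profile_W1 h
    have := profile_W2 h'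
    omega
  · rintro ⟨u, v⟩ (h | h) h' <;> have := profile_W3 hk h'
    · have := profile_W1 h
      omega
    · have := profile_W2 h
      omega
  · rintro ⟨u, v⟩ ((h | h) | h) h' <;> have := profile_W4 h'
    · have := profile_W1 h
      omega
    · have := profile_W2 h
      omega
    · have := profile_W3 hk h
      omega
  · rintro ⟨u, v⟩ (((h | h) | h) | h) h' <;> have := profile_W5 hk h'
    · have := profile_W1 h
      omega
    · have := profile_W2 h
      omega
    · have := profile_W3 hk h
      omega
    · have := profile_W4 h
      omega
  · rintro ⟨u, v⟩ ((((h | h) | h) | h) | h) h' <;> have := profile_W6 h'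
    · have := profile_W1 h
      omega
    · have := profile_W2 h
      omega
    · have := profile_W3 hk h
      omega
    · have := profile_W4 h
      omega
    · have := profile_W5 hk h
      omega

theorem encard_R'1 (hk : 2 ≤ k) : (R'1 k).encard = 2 := by
  refine Set.encard_pair fun h => ?_
  have := congrArg (fun p => numA p.1) h
  simp (disch := omega) only [wt_mul, wt_wx, wt_wa, wt_wb] at this
  omega

theorem encard_R'2 (hk : 2 ≤ k) : (R'2 k).encard = (k - 1 + (k - 1) : ℕ) := by
  refine encard_union_of_disjoint (encard_Icc_family _ fun i i' h1 h2 h3 h4 h => ?_)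
    (encard_Icc_family _ fun i i' h1 h2 h3 h4 h => ?_) ?_
  · have := congrArg (fun p => wt id id id p.1) h
    simp (disch := omega) only [wt_mul, wt_wx, wt_wa, id] at this
    omega
  · have := congrArg (fun p => wt id id id p.1) h
    simp (disch := omega) only [wt_mul, wt_wx, wt_wb, id] at this
    omega
  · rintro _ ⟨i, h1, h2, rfl⟩ ⟨i', h3, h4, h⟩
    have := congrArg (fun p => numA p.1) h
    simp (disch := omega) only [wt_mul, wt_wx, wt_wa, wt_wb] at this
    omega

theorem encard_R'3 (hk : 2 ≤ k) : (R'3 k).encard = (k - 1 + 1 + (k - 1 + 1) : ℕ) := by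
  refine encard_union_of_disjoint (encard_Icc_family _ fun i i' h1 h2 h3 h4 h => ?_)
    (encard_Icc_family _ fun i i' h1 h2 h3 h4 h => ?_) ?_
  · have := congrArg (fun p => wt id id id p.2) h
    simpa (disch := omega) only [wt_wx, id] using this
  · have := congrArg (fun p => wt id id id p.2) h
    simpa (disch := omega) only [wt_wx, id] using this
  · rintro _ ⟨i, h1, h2, rfl⟩ ⟨i', h3, h4, h⟩
    have := congrArg (fun p => numA p.1) h
    simp (disch := omega) only [wt_mul, wt_wx, wt_wa, wt_wb] at this
    omega

theorem encard_R'4 : (R'4 k).encard = (k - 1 + (k - 1) : ℕ) := by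
  refine encard_union_of_disjoint (encard_Icc_family _ fun i i' h1 h2 h3 h4 h => ?_)
    (encard_Icc_family _ fun i i' h1 h2 h3 h4 h => ?_) ?_
  · have := congrArg (fun p => wt id id id p.2) h
    simp (disch := omega) only [wt_wx, id] at this
    omega
  · have := congrArg (fun p => wt id id id p.2) h
    simp (disch := omega) only [wt_wx, id] at this
    omega
  · rintro _ ⟨i, h1, h2, rfl⟩ ⟨i', h3, h4, h⟩
    have := congrArg (fun p => numA p.1) h
    simp (disch := omega) only [wt_mul, wt_wx, wt_wa, wt_wb] at this
    omega

theorem encard_R'5 : (R'5 k).encard = (k - 1 + (k - 1) : ℕ) := by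
  refine encard_union_of_disjoint (encard_Icc_family _ fun i i' h1 h2 h3 h4 h => ?_)
    (encard_Icc_family _ fun i i' h1 h2 h3 h4 h => ?_) ?_
  · have := congrArg (fun p => wt (fun _ => 0) id id p.1) h
    simpa (disch := omega) only [wt_mul, wt_wx, wt_wa, id, add_zero] using this
  · have := congrArg (fun p => wt id (fun _ => 0) id p.1) h
    simpa (disch := omega) only [wt_mul, wt_wx, wt_wb, id, add_zero] using this
  · rintro _ ⟨i, h1, h2, rfl⟩ ⟨i', h3, h4, h⟩
    have := congrArg (fun p => numA p.1) h
    simp (disch := omega) only [wt_mul, wt_wx, wt_wa, wt_wb] at this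
    omega

/-- For each `i` the two excluded values of `j` are distinct and lie between `1` and `k`, which
leaves `k - 2` values. -/
theorem encard_separated_family {β : Type*} (hk : 2 ≤ k) (φ : ℕ → ℕ → β)
    (hφ : ∀ i j i' j', 1 ≤ i → i < k → 1 ≤ j → j ≤ k → 1 ≤ i' → i' < k → 1 ≤ j' → j' ≤ k →
      φ i j = φ i' j' → i = i' ∧ j = j') :
    {p | ∃ i j, 1 ≤ i ∧ i ≤ k - 1 ∧ 1 ≤ j ∧ j ≤ k ∧ j ≠ k - i ∧ j ≠ k - i + 1 ∧
      p = φ i j}.encard = ((k - 1) * (k - 2) : ℕ) := by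
  have hcard : (k - 1) * (k - 2) = ((Finset.Icc 1 (k - 1)).sigma
      fun i => Finset.Icc 1 k \ {k - i, k - i + 1}).card := by
    rw [Finset.card_sigma, Finset.sum_congr rfl (g := fun _ => k - 2), Finset.sum_const,
      Nat.card_Icc, smul_eq_mul, Nat.add_sub_cancel]
    intro i hi
    rw [Finset.mem_Icc] at hi
    rw [Finset.card_sdiff_of_subset, Nat.card_Icc, Finset.card_pair (by omega)]
    · omega
    · intro j hj
      rw [Finset.mem_insert, Finset.mem_singleton] at hj
      rw [Finset.mem_Icc]
      omega
  rw [hcard]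
  refine encard_of_param _ (fun q : (_ : ℕ) × ℕ => φ q.1 q.2) ?_ fun p => ?_
  · rintro ⟨i, j⟩ hq ⟨i', j'⟩ hq' h
    simp only [Finset.mem_coe, Finset.mem_sigma, Finset.mem_Icc, Finset.mem_sdiff] at hq hq'
    obtain ⟨rfl, rfl⟩ := hφ i j i' j' (by omega) (by omega) (by omega) (by omega) (by omega)
      (by omega) (by omega) (by omega) h
    rfl
  · simp only [Finset.mem_sigma, Finset.mem_Icc, Finset.mem_sdiff, Finset.mem_insert,
      Finset.mem_singleton, Set.mem_ofPred_eq]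
    constructor
    · rintro ⟨i, j, h1, h2, h3, h4, h5, h6, rfl⟩
      exact ⟨⟨i, j⟩, by simp only; omega, rfl⟩
    · rintro ⟨⟨i, j⟩, h, rfl⟩
      simp only at h
      exact ⟨i, j, by omega, by omega, by omega, by omega, by omega, by omega, rfl⟩

theorem encard_R'6 (hk : 2 ≤ k) :
    (R'6 k).encard = ((k - 1) * (k - 2) + (k - 1) * (k - 2) : ℕ) := by
  refine encard_union_of_disjoint
    (encard_separated_family hk _ fun i j i' j' h1 h2 h3 h4 h5 h6 h7 h8 h => ?_)
    (encard_separated_family hk _ fun i j i' j' h1 h2 h3 h4 h5 h6 h7 h8 h => ?_) ?_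
  · have hx := congrArg (fun p => wt (fun _ => 0) id id p.1) h
    have ha := congrArg (fun p => wt id id (fun _ => 0) p.1) h
    simp (disch := omega) only [wt_mul, wt_wx, wt_wa, id] at hx ha
    omega
  · have hx := congrArg (fun p => wt id (fun _ => 0) id p.1) h
    have hb := congrArg (fun p => wt id id (fun _ => 0) p.1) h
    simp (disch := omega) only [wt_mul, wt_wx, wt_wb, id] at hx hb
    omega
  · rintro _ ⟨i, j, h1, h2, h3, h4, h5, h6, rfl⟩ ⟨i', j', h1', h2', h3', h4', h5', h6', h⟩
    have := congrArg (fun p => numA p.1) h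
    simp (disch := omega) only [wt_mul, wt_wx, wt_wa, wt_wb] at this
    omega

theorem encard_R' (hk : 2 ≤ k) : (R' k).encard =
    (2 + (k - 1 + (k - 1)) + (k - 1 + 1 + (k - 1 + 1)) + (k - 1 + (k - 1)) + (k - 1 + (k - 1)) +
      ((k - 1) * (k - 2) + (k - 1) * (k - 2)) : ℕ) := by
  refine encard_union_of_disjoint (encard_union_of_disjoint (encard_union_of_disjoint
    (encard_union_of_disjoint (encard_union_of_disjoint (encard_R'1 hk) (encard_R'2 hk) ?_)
    (encard_R'3 hk) ?_) encard_R'4 ?_) encard_R'5 ?_) (encard_R'6 hk) ?_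
  · rintro ⟨u, v⟩ h h'
    have := profile_R'1 hk h
    have := profile_R'2 h'
    omega
  · rintro ⟨u, v⟩ (h | h) h' <;> have := profile_R'3 hk h'
    · have := profile_R'1 hk h
      omega
    · have := profile_R'2 h
      omega
  · rintro ⟨u, v⟩ ((h | h) | h) h' <;> have := profile_R'4 h'
    · have := profile_R'1 hk h
      omega
    · have := profile_R'2 h
      omega
    · have := profile_R'3 hk h
      omega
  · rintro ⟨u, v⟩ (((h | h) | h) | h) h' <;> have := profile_R'5 h'
    · have := profile_R'1 hk h
      omega
    · have := profile_R'2 h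
      omega
    · have := profile_R'3 hk h
      omega
    · have := profile_R'4 h
      omega
  · rintro ⟨u, v⟩ ((((h | h) | h) | h) | h) h' <;> have := profile_R'6 h'
    · have := profile_R'1 hk h
      omega
    · have := profile_R'2 h
      omega
    · have := profile_R'3 hk h
      omega
    · have := profile_R'4 h
      omega
    · have := profile_R'5 h
      omega

theorem encard_relations (hk : 2 ≤ k) (hm : 2 ≤ m) : (R k m ∪ W k ∪ R' k).encard =
    (k + k + k + k + k * (m - 3) + (k.choose 2 + k.choose 2 + (k * k - k)) +
      (k - 2 + (k - 2).choose 2 + 2 + (k - 2 + (k - 2)) + (k - 1 + 1) + (k - 1)) +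
      (2 + (k - 1 + (k - 1)) + (k - 1 + 1 + (k - 1 + 1)) + (k - 1 + (k - 1)) +
        (k - 1 + (k - 1)) + ((k - 1) * (k - 2) + (k - 1) * (k - 2))) : ℕ) := by
  refine encard_union_of_disjoint (encard_union_of_disjoint (encard_R hm) (encard_W hk) ?_)
    (encard_R' hk) ?_
  · rintro ⟨u, v⟩ h h'
    have := profile_R h
    have := profile_W hk h'
    omega
  · rintro ⟨u, v⟩ (h | h) h' <;> have := profile_R' hk h'
    · have := profile_R h
      omega
    · have := profile_W hk h
      omega

/-- The truncated difference `m - 3` counts the values of `j` in `R5`. At `m = 2` it is `0` rather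
than `-1`, and this is where the additional `k` in the count comes from. -/
theorem ncard_relations (hk : 2 ≤ k) (hm : 2 ≤ m) : ((R k m ∪ W k ∪ R' k).ncard : ℚ) =
    (9 * k ^ 2 + 13 * k - 4) / 2 + k * (m - 3 : ℕ) := by
  rw [Set.ncard_def, encard_relations hk hm, ENat.toNat_natCast]
  obtain ⟨k, rfl⟩ : ∃ l, k = l + 2 := ⟨k - 2, by omega⟩
  have h1 : (k + 2) * (k + 2) - (k + 2) = (k + 2) * (k + 1) := by
    rw [Nat.sub_eq_iff_eq_add (by nlinarith)]
    ring
  rw [h1, show k + 2 - 1 = k + 1 by omega, Nat.add_sub_cancel]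
  push_cast [Nat.cast_choose_two]
  ring

theorem card_letter : Nat.card (Letter k) = 3 * k := by
  let e : Letter k ≃ Fin k ⊕ Fin k ⊕ Fin k :=
    { toFun := fun
        | .a r => .inl r
        | .b r => .inr (.inl r)
        | .x i => .inr (.inr i)
      invFun := fun
        | .inl r => .a r
        | .inr (.inl r) => .b r
        | .inr (.inr i) => .x i
      left_inv := by rintro (r | r | i) <;> rfl
      right_inv := by rintro (r | r | i) <;> rfl }
  rw [Nat.card_congr e, Nat.card_sum, Nat.card_sum, Nat.card_fin]
  omega

/-- Ensures that deleting the set `R4` removes no relation belonging to another family. -/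
theorem disjoint_R4 (hk : 2 ≤ k) :
    Disjoint (R1 k ∪ R2 k m ∪ R3 k m ∪ R5 k m ∪ R6 k ∪ W k ∪ R' k) (R4 k m) := by
  rw [Set.disjoint_left]
  rintro ⟨u, v⟩ ((((((h | h) | h) | h) | h) | h) | h) h' <;> have := profile_R4 h'
  · have := profile_R1 h
    omega
  · have := profile_R2 h
    omega
  · have := profile_R3 h
    omega
  · have := profile_R5 h
    omega
  · have := profile_R6 h
    omega
  · have := profile_W hk h
    omega
  · have := profile_R' hk h
    omega

end

/-- The relations `R`, `W` and `R'` define `POI_{k×m}`, and the number of these relations. -/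
theorem defines_and_card_relations (k m : ℕ) (hk : 2 ≤ k) (hm : 2 ≤ m) :
    Defines hm
        (R k m ∪ W k ∪ R' k) ∧
      Nat.card (Letter k) = 3 * k ∧
      (3 ≤ m →
        ((R k m ∪ W k ∪ R' k).ncard : ℚ) =
          (9 * k ^ 2 + (2 * m + 7) * k - 4) / 2) ∧
      (m = 2 →
        ((R k m ∪ W k ∪ R' k).ncard : ℚ) =
            (9 * k ^ 2 + (2 * m + 7) * k - 4) / 2 + k ∧
          Defines hm
            ((R k m ∪ W k ∪ R' k) \
              R4 k m) ∧
          (((R k m ∪ W k ∪ R' k) \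
              R4 k m).ncard : ℚ) =
            (9 * k ^ 2 + (2 * m + 7) * k - 4) / 2) := by
  have h4 : R4 k m ⊆ R k m ∪ W k ∪ R' k := fun p h =>
    Or.inl (Or.inl (Or.inl (Or.inl (Or.inr h))))
  have hsub : R1 k ∪ R2 k m ∪ R3 k m ∪ R5 k m ∪ R6 k ∪ W k ∪ R' k ⊆ R k m ∪ W k ∪ R' k := by
    rintro p ((((((h | h) | h) | h) | h) | h) | h)
    exacts [Or.inl (Or.inl (Or.inl (Or.inl (Or.inl (Or.inl (Or.inl h)))))),
      Or.inl (Or.inl (Or.inl (Or.inl (Or.inl (Or.inl (Or.inr h)))))),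
      Or.inl (Or.inl (Or.inl (Or.inl (Or.inl (Or.inr h))))),
      Or.inl (Or.inl (Or.inl (Or.inr h))), Or.inl (Or.inl (Or.inr h)), Or.inl (Or.inr h), Or.inr h]
  have hdef : ∀ S ⊆ R k m ∪ W k ∪ R' k,
      R1 k ∪ R2 k m ∪ R3 k m ∪ R5 k m ∪ R6 k ∪ W k ∪ R' k ⊆ S → (3 ≤ m → R4 k m ⊆ S) →
      Defines hm S := by
    intro S hS h h4
    simp only [Set.union_subset_iff] at h
    obtain ⟨⟨⟨⟨⟨⟨h1, h2⟩, h3⟩, h5⟩, h6⟩, hW⟩, hR'⟩ := h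
    exact defines_of_subset hk hm hS h1 h2 h3 h4 h5 h6 hW hR'
  have hcard := ncard_relations hk hm
  refine ⟨hdef _ subset_rfl hsub fun _ => h4, card_letter, fun hm3 => ?_, ?_⟩
  · rw [hcard, Nat.cast_sub hm3]
    push_cast
    ring
  · rintro rfl
    have hcard2 : ((R k 2 ∪ W k ∪ R' k).ncard : ℚ) =
        (9 * k ^ 2 + (2 * (2 : ℕ) + 7) * k - 4) / 2 + k := by
      rw [hcard]
      push_cast
      ring
    refine ⟨hcard2, hdef _ Set.sdiff_subset (Set.subset_sdiff.2 ⟨hsub, disjoint_R4 hk⟩)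
      (fun h => by omega), ?_⟩
    have hfin : (R k 2 ∪ W k ∪ R' k).Finite :=
      Set.finite_of_encard_eq_coe (encard_relations hk hm)
    have hsum := Set.ncard_sdiff_add_ncard_of_subset h4 hfin
    have h4card : (R4 k 2).ncard = k := by rw [Set.ncard_def, encard_R4, ENat.toNat_natCast]
    rw [← hsum, h4card, Nat.cast_add] at hcard2
    linarith

end POIPresentation

theorem theorem3p10 (k m : ℕ) (hk : 2 ≤ k) (hm : 2 ≤ m) :
    POIPresentation.Defines hm
        (POIPresentation.R k m ∪ POIPresentation.W k ∪ POIPresentation.R' k) ∧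
      Nat.card (POIPresentation.Letter k) = 3 * k ∧
      (3 ≤ m →
        ((POIPresentation.R k m ∪ POIPresentation.W k ∪ POIPresentation.R' k).ncard : ℚ) =
          (9 * k ^ 2 + (2 * m + 7) * k - 4) / 2) ∧
      (m = 2 →
        ((POIPresentation.R k m ∪ POIPresentation.W k ∪ POIPresentation.R' k).ncard : ℚ) =
            (9 * k ^ 2 + (2 * m + 7) * k - 4) / 2 + k ∧
          POIPresentation.Defines hm
            ((POIPresentation.R k m ∪ POIPresentation.W k ∪ POIPresentation.R' k) \
              POIPresentation.R4 k m) ∧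
          (((POIPresentation.R k m ∪ POIPresentation.W k ∪ POIPresentation.R' k) \
              POIPresentation.R4 k m).ncard : ℚ) =
            (9 * k ^ 2 + (2 * m + 7) * k - 4) / 2) :=
  POIPresentation.defines_and_card_relations k m hk hm
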